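/- Let $m\ge 3$. There exist constants $a,b\ge 0$, depending only on $m$, with the following property. For every non-decreasing function $G\colon\mathbb R_{\ge0}\to\mathbb R_{\ge0}$ with $G(r)\to\infty$ as $r\to\infty$ there exists a smooth complete Riemannian metric $g$ on $\mathbb R^m$ with bounded geometry (i.e. there is $\varepsilon>0$ such that for every $x$ the exponential map $\exp_x$ is a diffeomorphism from the ball of radius $\varepsilon$ in the tangent space at $x$ onto an open set, and the curvature tensor is uniformly bounded) such that, with balls $B(x,r)$ taken with respect to the Riemannian distance of $g$: (a) $(\mathbb R^m,g)$ is uniformly contractible: there is a non-decreasing function $\mathfrak R\colon\mathbb R_{\ge0}\to\mathbb R_{\ge0}$ with $\mathfrak R(r)\ge r$ such that for all $x\in\mathbb R^m$ and $r\ge0$ there is a continuous map $H\colon B(x,r)\times[0,1]\to B(x,\mathfrak R(r))$ with $H(y,0)=y$ and $H(y,1)=x$ for all $y\in B(x,r)$; (b) $(\mathbb R^m,g)$ has asymptotic dimension $\le m$ with the diameter control $\mathfrak D(r)=ar+b$, which is independent of $G$ and satisfies $\mathfrak D(r)\ge r$: for every $r>0$ there is a cover of $\mathbb R^m$ by sets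 of diameter at most $\mathfrak D(r)$ such that every ball of radius $r$ meets at most $m+1$ members of the cover; (c) the scalar curvature $k$ of $g$ is positive everywhere, and for every $x_0\in\mathbb R^m$ $$\lim_{r\to+\infty}\Big(G(r)\cdot\inf_{x\in B(x_0,r)}k(x)\Big)=+\infty .$$ -/

import Mathlib

open Set Filter Topology Manifold Bundle
open scoped NNReal ContDiff

noncomputable section

namespace ScalarDecay

/-- The manifold `ℝ^m`, with its standard smooth structure. -/
abbrev Euc (m : ℕ) : Type := EuclideanSpace ℝ (Fin m)

/-- A smooth (`C^∞`) Riemannian metric on the manifold `ℝ^m`. -/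
abbrev SmoothMetric (m : ℕ) : Type :=
  ContMDiffRiemannianMetric 𝓘(ℝ, Euc m) ∞ (Euc m)
    (fun x : Euc m ↦ TangentSpace 𝓘(ℝ, Euc m) x)

section Distance

/-- In a connected extended metric space all distances are finite. -/
theorem edist_ne_top_of_preconnected {X : Type*} [EMetricSpace X] [PreconnectedSpace X]
    (x y : X) : edist x y ≠ ⊤ := by
  have hclopen : IsClopen (Metric.eball x ⊤) := by
    refine ⟨?_, Metric.isOpen_eball⟩
    rw [← isOpen_compl_iff, EMetric.isOpen_iff]
    intro z hz
    refine ⟨1, one_pos, fun w hw hwx ↦ hz ?_⟩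
    rw [Metric.mem_eball] at hw hwx ⊢
    calc edist z x ≤ edist z w + edist w x := edist_triangle _ _ _
      _ < ⊤ := ENNReal.add_lt_top.2
        ⟨by rw [edist_comm]; exact hw.trans ENNReal.one_lt_top, hwx⟩
  have huniv := hclopen.eq_univ ⟨x, by simp [Metric.mem_eball]⟩
  have hy : y ∈ Metric.eball x ⊤ := huniv ▸ mem_univ y
  rw [Metric.mem_eball, edist_comm] at hy
  exact hy.ne

/-- The Riemannian distance of `g`, i.e. the infimum of the `g`-lengths of the `C^1` paths
between two points, as a metric on `ℝ^m`. -/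
abbrev metricSpaceOf {m : ℕ} (g : SmoothMetric m) : MetricSpace (Euc m) :=
  letI : RiemannianBundle (fun x : Euc m ↦ TangentSpace 𝓘(ℝ, Euc m) x) :=
    ⟨g.toRiemannianMetric⟩
  haveI : IsContinuousRiemannianBundle (Euc m)
      (fun x : Euc m ↦ TangentSpace 𝓘(ℝ, Euc m) x) :=
    ⟨⟨g.inner, g.contMDiff.continuous, fun _ _ _ ↦ rfl⟩⟩
  letI M : EMetricSpace (Euc m) := EMetricSpace.ofRiemannianMetric 𝓘(ℝ, Euc m) (Euc m)
  @EMetricSpace.toMetricSpace (Euc m) M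
    (fun x y ↦ @edist_ne_top_of_preconnected (Euc m) M inferInstance x y)

/-- `ℝ^m` as a metric space with the Riemannian distance of `g`. -/
def RiemannianSpace {m : ℕ} (_g : SmoothMetric m) : Type := Euc m

instance {m : ℕ} (g : SmoothMetric m) : MetricSpace (RiemannianSpace g) := metricSpaceOf g

end Distance

section Curvature

variable {m : ℕ} (g : SmoothMetric m)

/-- The inner product `g_x(v, w)` of two tangent vectors at `x`. -/
def metricInner (x v w : Euc m) : ℝ := g.inner x v w

/-- The length of a tangent vector `v` at `x` with respect to `g`. -/
def metricNorm (x v : Euc m) : ℝ := Real.sqrt (metricInner g x v v)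

/-- The matrix `g_{ij}(x)` of the metric in the standard coordinates. -/
def gram (x : Euc m) : Matrix (Fin m) (Fin m) ℝ :=
  Matrix.of fun i j ↦ metricInner g x (EuclideanSpace.single i 1) (EuclideanSpace.single j 1)

/-- The partial derivative `∂_i f` at `x`. -/
def partialDeriv (i : Fin m) (f : Euc m → ℝ) (x : Euc m) : ℝ :=
  fderiv ℝ f x (EuclideanSpace.single i 1)

/-- The Christoffel symbol
`Γ^k_{ij} = 1/2 ∑_l g^{kl} (∂_i g_{jl} + ∂_j g_{il} - ∂_l g_{ij})` at `x`. -/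
def christoffel (k i j : Fin m) (x : Euc m) : ℝ :=
  (1 / 2) * ∑ l, (gram g x)⁻¹ k l *
    (partialDeriv i (fun y ↦ gram g y j l) x + partialDeriv j (fun y ↦ gram g y i l) x
      - partialDeriv l (fun y ↦ gram g y i j) x)

/-- The components of the curvature tensor of the Levi-Civita connection,
`R(∂_i, ∂_j) ∂_k = ∑_l (riemannCoeff l k i j) ∂_l`, where
`R(X, Y) Z = ∇_X ∇_Y Z - ∇_Y ∇_X Z - ∇_{[X, Y]} Z`. -/
def riemannCoeff (l k i j : Fin m) (x : Euc m) : ℝ :=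
  partialDeriv i (christoffel g l j k) x - partialDeriv j (christoffel g l i k) x
    + ∑ p, (christoffel g l i p x * christoffel g p j k x
      - christoffel g l j p x * christoffel g p i k x)

/-- The curvature tensor `R(u, v) w` at `x`. -/
def curvature (x u v w : Euc m) : Euc m :=
  WithLp.toLp 2 fun l ↦ ∑ i, ∑ j, ∑ k, riemannCoeff g l k i j x * u i * v j * w k

/-- The Ricci curvature `Ric(∂_j, ∂_k)` at `x`, the trace of `X ↦ R(X, ∂_j) ∂_k`. -/
def ricci (j k : Fin m) (x : Euc m) : ℝ := ∑ i, riemannCoeff g i k i j x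

/-- The scalar curvature `k(x)` of `g` at `x`, the `g`-trace of the Ricci curvature. -/
def scalarCurvature (x : Euc m) : ℝ := ∑ j, ∑ k, (gram g x)⁻¹ j k * ricci g j k x

/-- The curve `γ` is a geodesic of `g` on the open set of times `s`, i.e.
`γ''^k + ∑_{i,j} Γ^k_{ij}(γ) γ'^i γ'^j = 0` there. -/
def IsGeodesicOn (γ : ℝ → Euc m) (s : Set ℝ) : Prop :=
  ∀ t ∈ s, DifferentiableAt ℝ γ t ∧
    HasDerivAt (deriv γ)
      (WithLp.toLp 2 fun k ↦
        -∑ i, ∑ j, christoffel g k i j (γ t) * deriv γ t i * deriv γ t j) t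

/-- `exp_x(v)` is defined and equal to `y`: the geodesic with initial point `x` and initial
velocity `v` exists up to time `1` and is then at `y`. -/
def IsExp (x v y : Euc m) : Prop :=
  ∃ (γ : ℝ → Euc m) (δ : ℝ), 0 < δ ∧ IsGeodesicOn g γ (Ioo (-δ) (1 + δ)) ∧
    γ 0 = x ∧ deriv γ 0 = v ∧ γ 1 = y

/-- The exponential map at `x` is defined on the open ball of radius `ε` about `0` in the tangent
space with the norm of `g`, and is a diffeomorphism from this ball onto an open set. -/
def ExpIsDiffeoOnBall (x : Euc m) (ε : ℝ) : Prop :=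
  ∃ Φ : OpenPartialHomeomorph (Euc m) (Euc m),
    Φ.source = {v | metricNorm g x v < ε} ∧
    ContDiffOn ℝ ∞ Φ Φ.source ∧ ContDiffOn ℝ ∞ Φ.symm Φ.target ∧
    ∀ v ∈ Φ.source, IsExp g x v (Φ v)

/-- Bounded geometry: the injectivity radius is bounded below by a positive number, and the
curvature tensor is bounded. -/
def HasBoundedGeometry : Prop :=
  (∃ ε : ℝ, 0 < ε ∧ ∀ x, ExpIsDiffeoOnBall g x ε) ∧
  ∃ C : ℝ, ∀ x u v w z : Euc m,
    |metricInner g x (curvature g x u v w) z|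
      ≤ C * metricNorm g x u * metricNorm g x v * metricNorm g x w * metricNorm g x z

end Curvature

section Coarse

/-- A control function: non-decreasing and tending to infinity. -/
def IsControlFunction (F : ℝ≥0 → ℝ≥0) : Prop :=
  Monotone F ∧ Tendsto F atTop atTop

/-- `X` is uniformly contractible with contractibility radius `R`. -/
def UniformlyContractibleWith (X : Type*) [MetricSpace X] (R : ℝ≥0 → ℝ≥0) : Prop :=
  Monotone R ∧ (∀ r, r ≤ R r) ∧
  ∀ (x : X) (r : ℝ≥0),
    ∃ H : C(Metric.closedBall x (r : ℝ) × unitInterval, Metric.closedBall x (R r : ℝ)),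
      ∀ y : Metric.closedBall x (r : ℝ), (H (y, 0) : X) = y ∧ (H (y, 1) : X) = x

/-- `X` is uniformly contractible. -/
def UniformlyContractible (X : Type*) [MetricSpace X] : Prop :=
  ∃ R : ℝ≥0 → ℝ≥0, UniformlyContractibleWith X R

/-- `X` has asymptotic dimension at most `n` with diameter control `D`: for each `r > 0` there is
a cover by sets of diameter at most `D r` such that each ball of radius `r` meets at most `n + 1`
members of the cover. -/
def AsdimLEWith (X : Type*) [MetricSpace X] (n : ℕ) (D : ℝ≥0 → ℝ≥0) : Prop :=
  Monotone D ∧ (∀ r, r ≤ D r) ∧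
  ∀ r : ℝ≥0, 0 < r → ∃ 𝒞 : Set (Set X), ⋃₀ 𝒞 = univ ∧
    (∀ U ∈ 𝒞, ∀ y ∈ U, ∀ z ∈ U, dist y z ≤ D r) ∧
    ∀ x : X, {U ∈ 𝒞 | (U ∩ Metric.closedBall x (r : ℝ)).Nonempty}.encard ≤ n + 1

end Coarse

end ScalarDecay

end

noncomputable section

namespace ScalarDecay

/-! ### Conformally flat metrics -/

section

variable {m : ℕ}

/-! Let `F = exp (h (log (1 + |x|²)))` with `h` smooth, increasing and slow, and take the
conformally flat metric `F² / (1 + |x|²) · δ`. For `h = 0` it is a capped half-cylinder over a round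
sphere `S^{m-1}`; in general the cross sections of the end are spheres of radius about `F`, and `F`
may tend to infinity as slowly as desired.

Curvature. The first two derivatives of `h` are at most `1/32`, so the conformal formula for the
scalar curvature is dominated by the curvature of the cross sections, which is positive since `m ≥
3`: `exp_neg_le_scalarCurvature` gives `k ≥ e^{-2h}`. As `log (1 + |x|²)` is 2-Lipschitz, it is at
most `3r` on a ball of large radius `r`. A profile with `e^{4h(3r)} ≤ max 1 (G r)`
(`exists_isProfile`) thus gives `G · inf k ≥ √G` for large `r`.

Bounded geometry. The derivatives of `ψ = log (F / √(1 + |x|²))` are controlled at the scale of the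
metric (`isTame_logFactor`). After rescaling, the geodesic equation is a small perturbation of `y''
= 0`, uniformly in the base point, and its time-one map is a diffeomorphism by a contraction
argument in a space of curves (`exists_diffeo_time_one`).

Uniform contractibility. Where `F` is large compared with `r`, a ball of radius `r` subtends a small
angle, and Euclidean segments between its centre and its points stay within distance `64 r`. Since
`F → ∞`, the other centres form a bounded set. So `F → ∞` is what is needed here, and its rate
affects only the contractibility function.

Asymptotic dimension. Up to constants depending only on `m`, the distance is the sum of the
differences of a radial and a spherical coordinate (`rdist_le` and the Lipschitz bounds before it).
The size of the spherical coordinate is about `F`, which the radial coordinate controls, so the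
spherical coordinate carries only `m - 1` further parameters up to a sign. Once spheres are replaced
by octahedra, these are honest coordinates, and a coloured grid of boxes gives the cover
(`asdimLEWith_of_coordinates`) with constants that do not involve `h`. -/

set_option synthInstance.maxHeartbeats 200000 in
/-- The conformally flat metric `e^{2ψ} δ` on `ℝ^m`. -/
def conformalMetric (ψ : Euc m → ℝ) (hψ : ContDiff ℝ ∞ ψ) : SmoothMetric m where
  inner x := Real.exp (2 * ψ x) • (riemannianMetricVectorSpace (Euc m)).inner x
  symm x v w := by
    exact congrArg (Real.exp (2 * ψ x) * ·) ((riemannianMetricVectorSpace (Euc m)).symm x v w)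
  pos x v hv := mul_pos (Real.exp_pos _) ((riemannianMetricVectorSpace (Euc m)).pos x v hv)
  isVonNBounded x := by
    change Bornology.IsVonNBounded ℝ {v : Euc m | Real.exp (2 * ψ x) * inner ℝ v v < 1}
    refine (NormedSpace.isVonNBounded_ball ℝ (Euc m) (Real.exp (-ψ x))).subset fun v hv ↦ ?_
    simp only [Metric.mem_ball, dist_zero_right, Set.mem_ofPred_eq] at hv ⊢
    rw [real_inner_self_eq_norm_sq, two_mul, Real.exp_add] at hv
    have h2 : Real.exp (ψ x) * ‖v‖ < 1 := by
      by_contra! h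
      nlinarith
    rw [Real.exp_neg, ← one_div, lt_div_iff₀ (Real.exp_pos _), mul_comm]
    exact h2
  contMDiff := by
    have h : ContMDiff 𝓘(ℝ, Euc m) 𝓘(ℝ, ℝ) ∞ fun x ↦ Real.exp (2 * ψ x) := by
      rw [contMDiff_iff_contDiff]
      fun_prop
    have : ∀ x : Euc m, ContinuousAdd (TangentSpace 𝓘(ℝ, Euc m) x →L[ℝ] ℝ) :=
      fun x ↦ inferInstanceAs (ContinuousAdd (Euc m →L[ℝ] ℝ))
    exact h.smul_section ((riemannianMetricVectorSpace (Euc m)).contMDiff.of_le le_top)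

variable {ψ : Euc m → ℝ} {hψ : ContDiff ℝ ∞ ψ}

theorem metricInner_conformal (x v w : Euc m) :
    metricInner (conformalMetric ψ hψ) x v w = Real.exp (2 * ψ x) * inner ℝ v w := rfl

theorem metricNorm_conformal (x v : Euc m) :
    metricNorm (conformalMetric ψ hψ) x v = Real.exp (ψ x) * ‖v‖ := by
  rw [metricNorm, metricInner_conformal, real_inner_self_eq_norm_sq, two_mul, Real.exp_add,
    show Real.exp (ψ x) * Real.exp (ψ x) * ‖v‖ ^ 2 = (Real.exp (ψ x) * ‖v‖) ^ 2 by ring,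
    Real.sqrt_sq (by positivity)]

/-! ### Estimating the Riemannian distance from above and below -/

section Length

open MeasureTheory

/-- The length of a path for a smooth metric, in terms of the norms of its velocity vectors. -/
def pathLength (g : SmoothMetric m) (γ : ℝ → Euc m) (a b : ℝ) : ENNReal :=
  ∫⁻ t in Icc a b, ENNReal.ofReal (metricNorm g (γ t) (deriv γ t))

theorem pathELength_eq_pathLength (g : SmoothMetric m) (γ : ℝ → Euc m) (a b : ℝ) :
    (letI : RiemannianBundle (fun x : Euc m ↦ TangentSpace 𝓘(ℝ, Euc m) x) :=
      ⟨g.toRiemannianMetric⟩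
    Manifold.pathELength 𝓘(ℝ, Euc m) γ a b) = pathLength g γ a b := by
  let : RiemannianBundle (fun x : Euc m ↦ TangentSpace 𝓘(ℝ, Euc m) x) :=
    ⟨g.toRiemannianMetric⟩
  have key : ∀ (x : Euc m) (v : TangentSpace 𝓘(ℝ, Euc m) x),
      ‖v‖ₑ = ENNReal.ofReal (metricNorm g x v) := by
    intro x v
    rw [← ofReal_norm, norm_eq_sqrt_real_inner]
    rfl
  rw [Manifold.pathELength_eq_lintegral_mfderiv_Icc, pathLength]
  simp_rw [key, mfderiv_eq_fderiv]
  rfl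

/-- The Riemannian distance, as a function on `ℝ^m`. -/
def rdist (g : SmoothMetric m) (x y : Euc m) : ℝ := dist (α := RiemannianSpace g) x y

theorem rdist_nonneg (g : SmoothMetric m) (x y : Euc m) : 0 ≤ rdist g x y :=
  dist_nonneg (α := RiemannianSpace g)

theorem rdist_comm (g : SmoothMetric m) (x y : Euc m) : rdist g x y = rdist g y x :=
  dist_comm (α := RiemannianSpace g) x y

theorem rdist_self (g : SmoothMetric m) (x : Euc m) : rdist g x x = 0 :=
  dist_self (α := RiemannianSpace g) x

theorem rdist_triangle (g : SmoothMetric m) (x y z : Euc m) :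
    rdist g x z ≤ rdist g x y + rdist g y z :=
  dist_triangle (α := RiemannianSpace g) x y z

theorem ofReal_rdist (g : SmoothMetric m) (x y : Euc m) :
    ENNReal.ofReal (rdist g x y) = edist (α := RiemannianSpace g) x y :=
  (edist_dist (α := RiemannianSpace g) x y).symm

theorem rdist_le_pathLength (g : SmoothMetric m) {γ : ℝ → Euc m} {a b : ℝ} (hab : a ≤ b)
    (hγ : ContDiffOn ℝ 1 γ (Icc a b)) :
    ENNReal.ofReal (rdist g (γ a) (γ b)) ≤ pathLength g γ a b := by
  rw [ofReal_rdist, ← pathELength_eq_pathLength]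
  let : RiemannianBundle (fun x : Euc m ↦ TangentSpace 𝓘(ℝ, Euc m) x) :=
    ⟨g.toRiemannianMetric⟩
  exact Manifold.riemannianEDist_le_pathELength (contMDiffOn_iff_contDiffOn.2 hγ) rfl rfl hab

theorem exists_pathLength_lt (g : SmoothMetric m) {x y : Euc m} {r : ENNReal}
    (hr : ENNReal.ofReal (rdist g x y) < r) :
    ∃ γ : ℝ → Euc m, γ 0 = x ∧ γ 1 = y ∧ ContDiff ℝ 1 γ ∧ pathLength g γ 0 1 < r := by
  let : RiemannianBundle (fun x : Euc m ↦ TangentSpace 𝓘(ℝ, Euc m) x) :=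
    ⟨g.toRiemannianMetric⟩
  have hr' : Manifold.riemannianEDist 𝓘(ℝ, Euc m) x y < r := (ofReal_rdist g x y).symm.trans_lt hr
  obtain ⟨γ, h0, h1, h2, h3, -, -⟩ :=
    Manifold.exists_lt_locally_constant_of_riemannianEDist_lt hr' zero_lt_one
  exact ⟨γ, h0, h1, contMDiff_iff_contDiff.1 h2, by rwa [← pathELength_eq_pathLength]⟩

/-- The length integrand is dominated by `σ'`, whose integral is known. All upper bounds for
distances use this with explicit paths. -/
theorem rdist_conformal_le {γ : ℝ → Euc m} {σ σ' : ℝ → ℝ} {a b : ℝ} (hab : a ≤ b)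
    (hγ : ContDiffOn ℝ 1 γ (Icc a b)) (hσ : ∀ t ∈ Icc a b, HasDerivAt σ (σ' t) t)
    (h : ∀ t ∈ Icc a b, Real.exp (ψ (γ t)) * ‖deriv γ t‖ ≤ σ' t)
    (hc : ContinuousOn σ' (Icc a b)) :
    rdist (conformalMetric ψ hψ) (γ a) (γ b) ≤ σ b - σ a := by
  have hI : IntegrableOn σ' (Icc a b) := hc.integrableOn_Icc
  have hintegral : ∫ t in Icc a b, σ' t = σ b - σ a := by
    rw [integral_Icc_eq_integral_Ioc, ← intervalIntegral.integral_of_le hab]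
    apply intervalIntegral.integral_eq_sub_of_hasDerivAt
    · rwa [uIcc_of_le hab]
    · exact (hc.mono (by rw [uIcc_of_le hab])).intervalIntegrable
  have h0 : ∀ t ∈ Icc a b, 0 ≤ σ' t := fun t ht ↦ le_trans (by positivity) (h t ht)
  have hnn : 0 ≤ σ b - σ a := by
    rw [← hintegral]
    exact setIntegral_nonneg measurableSet_Icc h0
  have hle := rdist_le_pathLength (conformalMetric ψ hψ) hab hγ
  refine (ENNReal.ofReal_le_ofReal_iff hnn).1 (hle.trans ?_)
  rw [pathLength, ← hintegral, ofReal_integral_eq_lintegral_ofReal hI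
    ((ae_restrict_iff' measurableSet_Icc).2 (Eventually.of_forall h0))]
  refine setLIntegral_mono' measurableSet_Icc fun t ht ↦ ENNReal.ofReal_le_ofReal ?_
  rw [metricNorm_conformal]
  exact h t ht

/-- A vector of unit `g`-length at `x` has Euclidean norm `e^{-ψ(x)}`, so the hypothesis says that
the differential of `p` has norm at most `K` with respect to `g`. All lower bounds for distances
come from here. -/
theorem norm_sub_le_rdist_conformal {E : Type*} [NormedAddCommGroup E] [NormedSpace ℝ E]
    {p : Euc m → E} (hp : ContDiff ℝ 1 p) {K : ℝ} (hK : 0 ≤ K)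
    (h : ∀ x, ‖fderiv ℝ p x‖ ≤ K * Real.exp (ψ x)) (x y : Euc m) :
    ‖p x - p y‖ ≤ K * rdist (conformalMetric ψ hψ) x y := by
  refine le_of_forall_gt fun R hR ↦ ?_
  have hR0 : 0 < R := lt_of_le_of_lt (mul_nonneg hK (rdist_nonneg _ _ _)) hR
  -- The slack is obtained by dividing by `K`, hence the separate case `K = 0`.
  obtain ⟨r, hr, hrR⟩ : ∃ r, rdist (conformalMetric ψ hψ) x y < r ∧
      K * r < R := by
    rcases hK.eq_or_lt with rfl | hK
    · exact ⟨_, lt_add_one _, by simpa using hR0⟩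
    · obtain ⟨r, h1, h2⟩ := exists_between ((lt_div_iff₀' hK).2 hR)
      exact ⟨r, h1, (lt_div_iff₀' hK).1 h2⟩
  obtain ⟨γ, h0, h1, hγ, hl⟩ := exists_pathLength_lt (conformalMetric ψ hψ) (r := ENNReal.ofReal r)
    ((ENNReal.ofReal_lt_ofReal_iff_of_nonneg (rdist_nonneg _ _ _)).2 hr)
  have hb := enorm_sub_le_lintegral_deriv_of_contDiffOn_Icc (f := p ∘ γ) (a := 0) (b := 1)
    (hp.comp hγ).contDiffOn zero_le_one
  have hle : ‖(p ∘ γ) 1 - (p ∘ γ) 0‖ₑ ≤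
      ENNReal.ofReal K * pathLength (conformalMetric ψ hψ) γ 0 1 := by
    refine hb.trans ?_
    rw [pathLength, ← lintegral_const_mul' _ _ ENNReal.ofReal_ne_top]
    refine lintegral_mono fun t ↦ ?_
    rw [← ENNReal.ofReal_mul hK, ← ofReal_norm, metricNorm_conformal]
    refine ENNReal.ofReal_le_ofReal ?_
    have hd : deriv (p ∘ γ) t = fderiv ℝ p (γ t) (deriv γ t) :=
      fderiv_comp_deriv _ (hp.differentiable one_ne_zero _) (hγ.differentiable one_ne_zero _)
    rw [hd, ← mul_assoc]
    exact (ContinuousLinearMap.le_opNorm _ _).trans (by gcongr; exact h _)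
  rw [norm_sub_rev]
  rw [← ofReal_norm, Function.comp, Function.comp, h0, h1] at hle
  have : ENNReal.ofReal ‖p y - p x‖ < ENNReal.ofReal R := by
    refine (hle.trans (mul_le_mul_right hl.le _)).trans_lt ?_
    rw [← ENNReal.ofReal_mul hK]
    exact (ENNReal.ofReal_lt_ofReal_iff hR0).2 hrR
  exact (ENNReal.ofReal_lt_ofReal_iff hR0).1 this

end Length

end

section

variable {m : ℕ}

/-! ### Curvature of conformally flat metrics -/

section Curvature

variable {ψ : Euc m → ℝ} {hψ : ContDiff ℝ ∞ ψ}

/-- The Kronecker symbol. -/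
def kronecker (i j : Fin m) : ℝ := if i = j then 1 else 0

theorem abs_kronecker_le (i j : Fin m) : |kronecker i j| ≤ 1 := by
  unfold kronecker
  split_ifs <;> simp

theorem gram_conformal (x : Euc m) (i j : Fin m) :
    gram (conformalMetric ψ hψ) x i j = Real.exp (2 * ψ x) * kronecker i j := by
  simp [gram, metricInner_conformal, kronecker, EuclideanSpace.inner_single_left,
    PiLp.single_apply]

theorem gram_conformal_eq_smul (x : Euc m) :
    gram (conformalMetric ψ hψ) x = Real.exp (2 * ψ x) • (1 : Matrix (Fin m) (Fin m) ℝ) := by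
  ext i j
  rw [gram_conformal, Matrix.smul_apply, Matrix.one_apply, kronecker, smul_eq_mul]

theorem gram_conformal_inv (x : Euc m) (i j : Fin m) :
    (gram (conformalMetric ψ hψ) x)⁻¹ i j = Real.exp (-(2 * ψ x)) * kronecker i j := by
  have h : (gram (conformalMetric ψ hψ) x)⁻¹ =
      Real.exp (-(2 * ψ x)) • (1 : Matrix (Fin m) (Fin m) ℝ) := by
    refine Matrix.inv_eq_left_inv ?_
    rw [gram_conformal_eq_smul, smul_mul_smul_comm, ← Real.exp_add]
    simp
  rw [h, Matrix.smul_apply, Matrix.one_apply, kronecker, smul_eq_mul]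

theorem sum_kronecker_mul (i : Fin m) (f : Fin m → ℝ) : ∑ j, kronecker i j * f j = f i := by
  simp [kronecker]

theorem kronecker_comm (i j : Fin m) : kronecker i j = kronecker j i := by
  simp [kronecker, eq_comm]

theorem kronecker_self (i : Fin m) : kronecker i i = 1 := by
  simp [kronecker]

theorem partialDeriv_gram_conformal (x : Euc m) (i j k : Fin m) :
    partialDeriv i (fun y ↦ gram (conformalMetric ψ hψ) y j k) x =
      Real.exp (2 * ψ x) * (2 * partialDeriv i ψ x * kronecker j k) := by
  simp only [gram_conformal, partialDeriv]
  have hd : HasFDerivAt ψ (fderiv ℝ ψ x) x := (hψ.differentiable (by simp) x).hasFDerivAt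
  have := ((hd.const_mul 2).exp.mul_const (kronecker j k)).fderiv
  rw [this]
  simp
  ring

theorem christoffel_conformal (k i j : Fin m) (x : Euc m) :
    christoffel (conformalMetric ψ hψ) k i j x =
      kronecker k j * partialDeriv i ψ x + kronecker k i * partialDeriv j ψ x
        - kronecker i j * partialDeriv k ψ x := by
  unfold christoffel
  simp only [gram_conformal_inv, partialDeriv_gram_conformal]
  have : ∀ l, Real.exp (-(2 * ψ x)) * kronecker k l *
      (Real.exp (2 * ψ x) * (2 * partialDeriv i ψ x * kronecker j l) +
        Real.exp (2 * ψ x) * (2 * partialDeriv j ψ x * kronecker i l) -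
        Real.exp (2 * ψ x) * (2 * partialDeriv l ψ x * kronecker i j)) =
      kronecker k l * (2 * partialDeriv i ψ x * kronecker j l +
        2 * partialDeriv j ψ x * kronecker i l - 2 * partialDeriv l ψ x * kronecker i j) := by
    intro l
    have : Real.exp (-(2 * ψ x)) * Real.exp (2 * ψ x) = 1 := by rw [← Real.exp_add]; simp
    linear_combination kronecker k l * (2 * partialDeriv i ψ x * kronecker j l +
        2 * partialDeriv j ψ x * kronecker i l - 2 * partialDeriv l ψ x * kronecker i j) * this
  simp only [this, sum_kronecker_mul]
  rw [kronecker_comm j k, kronecker_comm i k]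
  ring

theorem contDiff_partialDeriv {f : Euc m → ℝ} (hf : ContDiff ℝ ∞ f) (i : Fin m) :
    ContDiff ℝ ∞ (partialDeriv i f) := by
  unfold partialDeriv
  exact (hf.fderiv_right (m := ∞) (by simp)).clm_apply contDiff_const

theorem partialDeriv_christoffel_conformal (p k i j : Fin m) (x : Euc m) :
    partialDeriv p (christoffel (conformalMetric ψ hψ) k i j) x =
      kronecker k j * partialDeriv p (partialDeriv i ψ) x
        + kronecker k i * partialDeriv p (partialDeriv j ψ) x
        - kronecker i j * partialDeriv p (partialDeriv k ψ) x := by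
  have h : christoffel (conformalMetric ψ hψ) k i j = fun x ↦
      kronecker k j * partialDeriv i ψ x + kronecker k i * partialDeriv j ψ x
        - kronecker i j * partialDeriv k ψ x := funext fun x ↦ christoffel_conformal k i j x
  have hd : ∀ i, HasFDerivAt (partialDeriv i ψ) (fderiv ℝ (partialDeriv i ψ) x) x := fun i ↦
    ((contDiff_partialDeriv hψ i).differentiable (by simp) x).hasFDerivAt
  rw [h]
  have := ((((hd i).const_mul (kronecker k j)).add ((hd j).const_mul (kronecker k i))).sub
    ((hd k).const_mul (kronecker i j))).fderiv
  conv_lhs => unfold partialDeriv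
  erw [this]
  rfl

/-- The scalar curvature of `e^{2ψ} δ` is
`-e^{-2ψ} (2 (m - 1) Δψ + (m - 1) (m - 2) |∇ψ|²)`. -/
theorem scalarCurvature_conformal (x : Euc m) :
    scalarCurvature (conformalMetric ψ hψ) x = -Real.exp (-(2 * ψ x)) *
      (2 * (m - 1) * ∑ i, partialDeriv i (partialDeriv i ψ) x
        + (m - 1) * (m - 2) * ∑ i, partialDeriv i ψ x ^ 2) := by
  set N := ∑ i, partialDeriv i ψ x ^ 2 with hN
  set T := ∑ i, partialDeriv i (partialDeriv i ψ) x with hT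
  have h1 : scalarCurvature (conformalMetric ψ hψ) x =
      Real.exp (-(2 * ψ x)) * ∑ j, ricci (conformalMetric ψ hψ) j j x := by
    unfold scalarCurvature
    simp only [gram_conformal_inv, mul_assoc, ← Finset.mul_sum, sum_kronecker_mul]
  have h2 : ∀ j, ricci (conformalMetric ψ hψ) j j x =
      2 * partialDeriv j (partialDeriv j ψ) x - T - m * partialDeriv j (partialDeriv j ψ) x
        + (m - 2) * partialDeriv j ψ x ^ 2 - (m - 2) * N := by
    intro j
    have e1 : ∀ i, riemannCoeff (conformalMetric ψ hψ) i j i j x =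
        2 * (kronecker j i * partialDeriv i (partialDeriv i ψ) x)
          - partialDeriv i (partialDeriv i ψ) x - partialDeriv j (partialDeriv j ψ) x
          + (partialDeriv j ψ x ^ 2 - N + partialDeriv i ψ x ^ 2
            - 2 * (kronecker j i * partialDeriv i ψ x ^ 2) + kronecker j i * N) := by
      intro i
      have hsq : kronecker i j * kronecker i j = kronecker i j := by
        simp [kronecker]
      have hij : ∀ f : Fin m → ℝ, kronecker i j * f j = kronecker i j * f i := by
        intro f
        by_cases h : i = j <;> simp [kronecker, h]
      unfold riemannCoeff
      -- The summation index `p` is isolated in Kronecker symbols and one square, so that the sum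
      -- over `p` collapses to single terms and a multiple of `N`.
      have e2 : ∀ p, christoffel (conformalMetric ψ hψ) i i p x *
            christoffel (conformalMetric ψ hψ) p j j x -
          christoffel (conformalMetric ψ hψ) i j p x *
            christoffel (conformalMetric ψ hψ) p i j x =
          kronecker j p * (2 * partialDeriv p ψ x * partialDeriv j ψ x
              - kronecker i j * partialDeriv i ψ x * partialDeriv p ψ x
              + partialDeriv i ψ x * (kronecker j p * partialDeriv i ψ x
                + kronecker i p * partialDeriv j ψ x - kronecker i j * partialDeriv p ψ x))
            - kronecker i p * (kronecker i j * partialDeriv j ψ x * partialDeriv p ψ x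
              + partialDeriv j ψ x * (kronecker j p * partialDeriv i ψ x
                + kronecker i p * partialDeriv j ψ x - kronecker i j * partialDeriv p ψ x))
            + (kronecker i j - 1) * partialDeriv p ψ x ^ 2 := by
        intro p
        simp only [christoffel_conformal, kronecker_self, kronecker_comm p]
        linear_combination (partialDeriv p ψ x ^ 2) * hsq
      simp only [e2, Finset.sum_add_distrib, Finset.sum_sub_distrib, ← Finset.mul_sum,
        sum_kronecker_mul, ← hN, partialDeriv_christoffel_conformal, kronecker_self,
        kronecker_comm j i]
      linear_combination
        2 * hij (fun k ↦ partialDeriv i (partialDeriv k ψ) x)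
          - 2 * partialDeriv i ψ x * hij (fun k ↦ partialDeriv k ψ x)
    unfold ricci
    simp only [e1, Finset.sum_add_distrib, Finset.sum_sub_distrib, ← Finset.mul_sum,
      ← Finset.sum_mul, sum_kronecker_mul, ← hN, ← hT]
    simp [kronecker]
    ring
  rw [h1]
  simp only [h2, Finset.sum_add_distrib, Finset.sum_sub_distrib, ← Finset.mul_sum, ← hN, ← hT]
  simp
  ring

/-- A Christoffel symbol has three terms, each at most `β`. The two derivatives contribute `2 ·
3β'`, and the `m` pairs of products contribute `2 · (3β)²` each. -/
theorem abs_riemannCoeff_conformal_le {x : Euc m} {β β' : ℝ} (h1 : ∀ i, |partialDeriv i ψ x| ≤ β)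
    (h2 : ∀ i j, |partialDeriv i (partialDeriv j ψ) x| ≤ β') (l k i j : Fin m) :
    |riemannCoeff (conformalMetric ψ hψ) l k i j x| ≤ 6 * β' + 18 * m * β ^ 2 := by
  have hβ : 0 ≤ β := (abs_nonneg _).trans (h1 i)
  have hβ' : 0 ≤ β' := (abs_nonneg _).trans (h2 i i)
  have three : ∀ {a b c p q r B : ℝ}, |a| ≤ 1 → |b| ≤ 1 → |c| ≤ 1 → |p| ≤ B → |q| ≤ B → |r| ≤ B →
      |a * p + b * q - c * r| ≤ 3 * B := by
    intro a b c p q r B ha hb hc hp hq hr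
    have aux : ∀ {a p : ℝ}, |a| ≤ 1 → |p| ≤ B → |a * p| ≤ B := by
      intro a p ha hp
      rw [abs_mul]
      nlinarith [abs_nonneg a, abs_nonneg p]
    calc _ ≤ |a * p| + |b * q| + |c * r| := (abs_sub _ _).trans (by gcongr; exact abs_add_le _ _)
      _ ≤ _ := by linarith [aux ha hp, aux hb hq, aux hc hr]
  have hΓ : ∀ k i j, |christoffel (conformalMetric ψ hψ) k i j x| ≤ 3 * β := by
    intro k i j
    rw [christoffel_conformal]
    exact three (abs_kronecker_le _ _) (abs_kronecker_le _ _) (abs_kronecker_le _ _)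
      (h1 _) (h1 _) (h1 _)
  have hdΓ : ∀ p k i j, |partialDeriv p (christoffel (conformalMetric ψ hψ) k i j) x| ≤ 3 * β' := by
    intro p k i j
    rw [partialDeriv_christoffel_conformal]
    exact three (abs_kronecker_le _ _) (abs_kronecker_le _ _) (abs_kronecker_le _ _)
      (h2 _ _) (h2 _ _) (h2 _ _)
  have hp : ∀ {a b : ℝ}, |a| ≤ 3 * β → |b| ≤ 3 * β → |a * b| ≤ 9 * β ^ 2 := by
    intro a b ha hb
    rw [abs_mul]
    nlinarith [abs_nonneg a, abs_nonneg b]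
  unfold riemannCoeff
  refine (abs_add_le _ _).trans (add_le_add ((abs_sub _ _).trans ?_) ?_)
  · linarith [hdΓ i l j k, hdΓ j l i k]
  · refine (Finset.abs_sum_le_sum_abs _ _).trans ((Finset.sum_le_sum (g := fun _ ↦ 18 * β ^ 2)
      fun p _ ↦ (abs_sub _ _).trans ?_).trans ?_)
    · linarith [hp (hΓ l i p) (hΓ p j k), hp (hΓ l j p) (hΓ p i k)]
    · simp
      apply le_of_eq
      ring

theorem abs_coord_le_norm (v : Euc m) (i : Fin m) : |v i| ≤ ‖v‖ := by
  simpa using PiLp.norm_apply_le v i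

/-- The left side scales as `e^{2ψ}` and the four norms as `e^{4ψ}`, which leaves `e^{-2ψ}`. The
factor `m^4` counts the three sums in the curvature and the one in the inner product. -/
theorem abs_curvature_conformal_le {x : Euc m} {M : ℝ}
    (hM : ∀ l k i j, |riemannCoeff (conformalMetric ψ hψ) l k i j x| ≤ M) (hM0 : 0 ≤ M)
    (u v w z : Euc m) :
    |metricInner (conformalMetric ψ hψ) x (curvature (conformalMetric ψ hψ) x u v w) z|
      ≤ (m ^ 4 * (M * Real.exp (-(2 * ψ x)))) * metricNorm (conformalMetric ψ hψ) x u *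
        metricNorm (conformalMetric ψ hψ) x v * metricNorm (conformalMetric ψ hψ) x w *
        metricNorm (conformalMetric ψ hψ) x z := by
  have hc : ∀ l, |curvature (conformalMetric ψ hψ) x u v w l| ≤
      m ^ 3 * (M * ‖u‖ * ‖v‖ * ‖w‖) := by
    intro l
    have : curvature (conformalMetric ψ hψ) x u v w l =
      ∑ i, ∑ j, ∑ k, riemannCoeff (conformalMetric ψ hψ) l k i j x * u i * v j * w k := rfl
    rw [this]
    have hs : ∀ (f : Fin m → ℝ) (B : ℝ), (∀ i, |f i| ≤ B) → |∑ i, f i| ≤ m * B := by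
      intro f B hf
      refine (Finset.abs_sum_le_sum_abs _ _).trans ((Finset.sum_le_sum fun i _ ↦ hf i).trans ?_)
      simp
    calc _ ≤ m * (m * (m * (M * ‖u‖ * ‖v‖ * ‖w‖))) := by
          refine hs _ _ fun i ↦ hs _ _ fun j ↦ hs _ _ fun k ↦ ?_
          rw [abs_mul, abs_mul, abs_mul]
          gcongr
          · exact hM _ _ _ _
          · exact abs_coord_le_norm _ _
          · exact abs_coord_le_norm _ _
          · exact abs_coord_le_norm _ _
      _ = _ := by ring
  have hin : |inner ℝ (curvature (conformalMetric ψ hψ) x u v w) z| ≤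
      m * (m ^ 3 * (M * ‖u‖ * ‖v‖ * ‖w‖) * ‖z‖) := by
    rw [PiLp.inner_apply]
    refine (Finset.abs_sum_le_sum_abs _ _).trans ((Finset.sum_le_sum (g := fun _ ↦
      m ^ 3 * (M * ‖u‖ * ‖v‖ * ‖w‖) * ‖z‖) fun i _ ↦ ?_).trans (by simp))
    simp only [RCLike.inner_apply, conj_trivial]
    rw [abs_mul, mul_comm]
    gcongr
    · exact hc i
    · exact abs_coord_le_norm _ _
  rw [metricInner_conformal, abs_mul, abs_of_pos (Real.exp_pos _)]
  simp only [metricNorm_conformal]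
  have e : Real.exp (2 * ψ x) = Real.exp (ψ x) ^ 2 := by
    rw [two_mul, Real.exp_add]; ring
  rw [Real.exp_neg, e]
  calc _ ≤ Real.exp (ψ x) ^ 2 * (m * (m ^ 3 * (M * ‖u‖ * ‖v‖ * ‖w‖) * ‖z‖)) := by gcongr
    _ = _ := by
      field_simp

end Curvature

end

section

/-! ### Smooth dependence for nonlinear operators on spaces of curves -/

section Superposition

variable {K : Type} [TopologicalSpace K] [CompactSpace K]
  {A : Type} [NormedAddCommGroup A] [NormedSpace ℝ A]

/-- The superposition operator `γ ↦ f ∘ γ` on spaces of continuous functions. -/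
def superposition {B : Type} [NormedAddCommGroup B] (f : A → B) (hf : Continuous f)
    (γ : C(K, A)) : C(K, B) :=
  (⟨f, hf⟩ : C(A, B)).comp γ

/-- A continuous bilinear map, applied pointwise to continuous functions. -/
def pointwiseBilinear {A B D : Type} [NormedAddCommGroup A] [NormedSpace ℝ A]
    [NormedAddCommGroup B] [NormedSpace ℝ B] [NormedAddCommGroup D] [NormedSpace ℝ D]
    (K : Type) [TopologicalSpace K] [CompactSpace K] (b : D →L[ℝ] A →L[ℝ] B) :
    C(K, D) →L[ℝ] C(K, A) →L[ℝ] C(K, B) :=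
  LinearMap.mkContinuous₂
    (LinearMap.mk₂ ℝ (fun (L : C(K, D)) (η : C(K, A)) ↦
        (⟨fun t ↦ b (L t) (η t), (b.continuous.comp L.continuous).clm_apply η.continuous⟩ :
          C(K, B)))
      (fun _ _ _ ↦ by ext; simp) (fun _ _ _ ↦ by ext; simp)
      (fun _ _ _ ↦ by ext; simp) (fun _ _ _ ↦ by ext; simp)) ‖b‖
    (fun L η ↦ by
      rw [ContinuousMap.norm_le _ (by positivity)]
      intro t
      refine (b.le_opNorm₂ (L t) (η t)).trans ?_
      gcongr
      · exact L.norm_coe_le_norm t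
      · exact η.norm_coe_le_norm t)

variable {B : Type} [NormedAddCommGroup B] [NormedSpace ℝ B]

theorem norm_sub_sub_fderiv_le {f : A → B} (hf : ContDiff ℝ ∞ f) {C : ℝ≥0}
    (hC : LipschitzWith C (fderiv ℝ f)) (a b : A) :
    ‖f b - f a - fderiv ℝ f a (b - a)‖ ≤ C * ‖b - a‖ * ‖b - a‖ := by
  refine Convex.norm_image_sub_le_of_norm_hasFDerivWithin_le' (s := Metric.closedBall a ‖b - a‖)
    (fun z _ ↦ ((hf.differentiable (by simp) z).hasFDerivAt).hasFDerivWithinAt) (fun z hz ↦ ?_)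
    (convex_closedBall _ _) (Metric.mem_closedBall_self (norm_nonneg _))
    (by rw [mem_closedBall_iff_norm])
  rw [← dist_eq_norm]
  exact (hC.dist_le_mul z a).trans (mul_le_mul_of_nonneg_left hz C.2)

-- Compact support makes `fderiv ℝ f` globally Lipschitz, so the pointwise quadratic Taylor
-- remainder is uniform in `t` and becomes a remainder in the sup norm.
set_option synthInstance.maxHeartbeats 400000 in
theorem hasFDerivAt_superposition {f : A → B} (hf : ContDiff ℝ ∞ f) (hs : HasCompactSupport f)
    (γ : C(K, A)) :
    HasFDerivAt (superposition (K := K) f hf.continuous)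
      (pointwiseBilinear K (ContinuousLinearMap.id ℝ (A →L[ℝ] B)) (superposition (fderiv ℝ f)
        (hf.continuous_fderiv (by simp)) γ)) γ := by
  obtain ⟨C, hC⟩ := (hf.fderiv_right (m := ∞) (by simp)).lipschitzWith_of_hasCompactSupport
    (hs.fderiv ℝ) (by simp)
  refine HasFDerivAt.of_isLittleO ?_
  have hb : ∀ γ' : C(K, A), ‖superposition f hf.continuous γ' - superposition f hf.continuous γ -
      (pointwiseBilinear K (ContinuousLinearMap.id ℝ (A →L[ℝ] B)) (superposition (fderiv ℝ f)
        (hf.continuous_fderiv (by simp)) γ)) (γ' - γ)‖ ≤ C * ‖γ' - γ‖ * ‖γ' - γ‖ := by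
    intro γ'
    rw [ContinuousMap.norm_le _ (by positivity)]
    intro t
    refine (norm_sub_sub_fderiv_le hf hC (γ t) (γ' t)).trans ?_
    have : ‖γ' t - γ t‖ ≤ ‖γ' - γ‖ := (γ' - γ).norm_coe_le_norm t
    gcongr
  rw [Asymptotics.isLittleO_iff]
  intro c hc
  have hn : ∀ᶠ γ' in 𝓝 γ, C * ‖γ' - γ‖ < c := by
    have : Tendsto (fun γ' : C(K, A) ↦ C * ‖γ' - γ‖) (𝓝 γ) (𝓝 (C * ‖γ - γ‖)) := by
      apply Continuous.tendsto
      fun_prop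
    rw [sub_self, norm_zero, mul_zero] at this
    exact this.eventually_lt_const hc
  filter_upwards [hn] with γ' h'
  exact (hb γ').trans (by gcongr)

-- The derivative is again a superposition operator, that of `fderiv ℝ f`, followed by a bounded
-- linear map. Since `fderiv ℝ f` takes values in another space, the induction varies the codomain.
set_option synthInstance.maxHeartbeats 400000 in
theorem contDiff_superposition {f : A → B} (hf : ContDiff ℝ ∞ f) (hs : HasCompactSupport f) :
    ContDiff ℝ ∞ (superposition (K := K) f hf.continuous) := by
  rw [contDiff_infty]
  intro n
  induction n generalizing B with
  | zero =>
    exact contDiff_zero.2 (continuous_iff_continuousAt.2 fun γ ↦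
      (hasFDerivAt_superposition hf hs γ).continuousAt)
  | succ n ih =>
    refine contDiff_succ_iff_hasFDerivAt.2 ⟨_, ?_, hasFDerivAt_superposition hf hs⟩
    exact (pointwiseBilinear K (ContinuousLinearMap.id ℝ (A →L[ℝ] B))).contDiff.comp
      (ih (hf.fderiv_right (m := ∞) (by simp)) (hs.fderiv ℝ))

end Superposition

/-- A smooth Lipschitz perturbation of the identity is a diffeomorphism. -/
theorem exists_homeomorph_id_add {V : Type*} [NormedAddCommGroup V] [NormedSpace ℝ V]
    [CompleteSpace V] {P : V → V} (hP : ContDiff ℝ ∞ P) {c : ℝ≥0} (hc : c < 1)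
    (hL : LipschitzWith c P) :
    ∃ e : V ≃ₜ V, (∀ x, e x = x + P x) ∧ ContDiff ℝ ∞ e.symm := by
  have ha : ApproximatesLinearOn (fun x ↦ x + P x)
      ((ContinuousLinearEquiv.refl ℝ V : V ≃L[ℝ] V) : V →L[ℝ] V) univ c := by
    apply LipschitzOnWith.approximatesLinearOn
    rw [lipschitzOnWith_univ]
    convert hL using 1
    ext x
    simp
  have hN : Subsingleton V ∨
      c < ‖((ContinuousLinearEquiv.refl ℝ V).symm : V →L[ℝ] V)‖₊⁻¹ := by
    rcases subsingleton_or_nontrivial V with h | h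
    · exact Or.inl h
    · right
      have : ‖((ContinuousLinearEquiv.refl ℝ V).symm : V →L[ℝ] V)‖₊ = 1 := by
        simp [ContinuousLinearEquiv.refl_symm]
      rw [this]
      simpa using hc
  let e : V ≃ₜ V := ha.toHomeomorph _ hN
  have he : ∀ x, e x = x + P x := fun x ↦ rfl
  have hd : ∀ a, ∃ L : V ≃L[ℝ] V, HasFDerivAt e (L : V →L[ℝ] V) a := by
    intro a
    have hn : ‖-fderiv ℝ P a‖ < 1 := by
      rw [norm_neg]
      exact (norm_fderiv_le_of_lipschitz ℝ hL).trans_lt (by exact_mod_cast hc)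
    -- The derivative `1 + P'` is invertible by the Neumann series.
    refine ⟨ContinuousLinearEquiv.ofUnit (Units.oneSub _ hn), ?_⟩
    have := (hasFDerivAt_id a).add (hP.differentiable (by simp) a).hasFDerivAt
    have h1 : ((ContinuousLinearEquiv.ofUnit (Units.oneSub _ hn) : V ≃L[ℝ] V) : V →L[ℝ] V) =
        ContinuousLinearMap.id ℝ V + fderiv ℝ P a := by
      ext x
      change (1 - -fderiv ℝ P a) x = _
      simp
    rw [h1]
    exact this
  choose L hL' using hd
  refine ⟨e, he, e.contDiff_symm hL' ?_⟩
  exact contDiff_id.add hP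

/-! ### The time-one map of a small second order equation -/

section Integration

variable {E : Type} [NormedAddCommGroup E]

/-- The time interval `[-1, 2]`. -/
abbrev TimeInterval : Type := Icc (-1 : ℝ) 2

/-- The extension of a function on `[-1, 2]` that is constant on the two sides. -/
def extendTime (u : C(TimeInterval, E)) (t : ℝ) : E := u (projIcc (-1) 2 (by norm_num) t)

theorem continuous_extendTime (u : C(TimeInterval, E)) : Continuous (extendTime u) :=
  u.continuous.comp continuous_projIcc

theorem norm_extendTime_le (u : C(TimeInterval, E)) (t : ℝ) : ‖extendTime u t‖ ≤ ‖u‖ :=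
  u.norm_coe_le_norm _

variable [NormedSpace ℝ E]

theorem norm_integral_extendTime_le (u : C(TimeInterval, E)) (t : TimeInterval) :
    ‖∫ s in (0 : ℝ)..t, extendTime u s‖ ≤ 2 * ‖u‖ := by
  refine (intervalIntegral.norm_integral_le_of_norm_le_const
    (fun s _ ↦ norm_extendTime_le u s)).trans ?_
  have : |(t : ℝ) - 0| ≤ 2 := by
    rw [abs_le]
    constructor <;> linarith [t.2.1, t.2.2]
  nlinarith [norm_nonneg u]

variable [CompleteSpace E]

theorem hasDerivAt_integral_extendTime (u : C(TimeInterval, E)) (t : ℝ) :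
    HasDerivAt (fun t ↦ ∫ s in (0 : ℝ)..t, extendTime u s) (extendTime u t) t :=
  (continuous_extendTime u).integral_hasStrictDerivAt 0 t |>.hasDerivAt

/-- The operator `u ↦ (t ↦ ∫₀ᵗ u)` on `C([-1, 2], E)`. -/
def integrateTime (E : Type) [NormedAddCommGroup E] [NormedSpace ℝ E] [CompleteSpace E] :
    C(TimeInterval, E) →L[ℝ] C(TimeInterval, E) :=
  LinearMap.mkContinuous
    { toFun := fun u ↦ ⟨fun t ↦ ∫ s in (0 : ℝ)..t, extendTime u s,
        (continuous_iff_continuousAt.2 fun t ↦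
          (hasDerivAt_integral_extendTime u t).continuousAt).comp continuous_subtype_val⟩
      map_add' := fun u v ↦ by
        ext t
        exact intervalIntegral.integral_add ((continuous_extendTime u).intervalIntegrable _ _)
          ((continuous_extendTime v).intervalIntegrable _ _)
      map_smul' := fun c u ↦ by
        ext t
        exact intervalIntegral.integral_smul c (extendTime u) } 2
    (fun u ↦ by
      rw [ContinuousMap.norm_le _ (by positivity)]
      exact norm_integral_extendTime_le u)

theorem integrateTime_apply (u : C(TimeInterval, E)) (t : TimeInterval) :
    integrateTime E u t = ∫ s in (0 : ℝ)..t, extendTime u s := rfl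

theorem norm_integrateTime_le (u : C(TimeInterval, E)) : ‖integrateTime E u‖ ≤ 2 * ‖u‖ := by
  rw [ContinuousMap.norm_le _ (by positivity)]
  exact norm_integral_extendTime_le u

/-- The map sending a velocity curve to the pair of its position and velocity curves. -/
def phaseCurve (E : Type) [NormedAddCommGroup E] [NormedSpace ℝ E] [CompleteSpace E] :
    C(TimeInterval, E) →L[ℝ] C(TimeInterval, E × E) :=
  LinearMap.mkContinuous
    { toFun := fun u ↦ (integrateTime E u).prodMk u
      map_add' := fun u v ↦ by ext t <;> simp
      map_smul' := fun c u ↦ by ext t <;> simp } 2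
    (fun u ↦ by
      rw [ContinuousMap.norm_le _ (by positivity)]
      intro t
      refine max_le ?_ ?_
      · exact norm_integral_extendTime_le u t
      · exact (u.norm_coe_le_norm t).trans (by nlinarith [norm_nonneg u]))

theorem norm_phaseCurve_le (u : C(TimeInterval, E)) : ‖phaseCurve E u‖ ≤ 2 * ‖u‖ := by
  rw [ContinuousMap.norm_le _ (by positivity)]
  intro t
  refine max_le ?_ ?_
  · exact norm_integral_extendTime_le u t
  · exact (u.norm_coe_le_norm t).trans (by nlinarith [norm_nonneg u])

theorem dist_superposition_le {K : Type} [TopologicalSpace K] [CompactSpace K] {A B : Type}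
    [NormedAddCommGroup A] [NormedAddCommGroup B] {f : A → B} {q : ℝ≥0} (hf : LipschitzWith q f)
    (γ γ' : C(K, A)) :
    ‖superposition f hf.continuous γ - superposition f hf.continuous γ'‖ ≤ q * ‖γ - γ'‖ := by
  rw [ContinuousMap.norm_le _ (by positivity)]
  intro t
  refine (hf.norm_sub_le _ _).trans ?_
  gcongr
  exact (γ - γ').norm_coe_le_norm t

/-- The solution operator of `y'' = -Q(y, y')`, `y(0) = 0`, `y'(0) = ν`, for a small smooth
compactly supported `Q`: the map `ν ↦ y(1)` is a diffeomorphism. -/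
theorem exists_diffeo_time_one {Q : E × E → E} (hQ : ContDiff ℝ ∞ Q) (hs : HasCompactSupport Q)
    (hL : LipschitzWith (1 / 16) Q) {M : ℝ} (hM : ∀ z, ‖Q z‖ ≤ M) :
    ∃ e : E ≃ₜ E, ContDiff ℝ ∞ e ∧ ContDiff ℝ ∞ e.symm ∧ ∀ ν, ∃ y u : ℝ → E,
      y 0 = 0 ∧ u 0 = ν ∧ y 1 = e ν ∧ (∀ t, HasDerivAt y (u t) t) ∧
      (∀ t ∈ Ioo (-1 : ℝ) 2, HasDerivAt u (-Q (y t, u t)) t) ∧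
      ∀ t ∈ Ioo (-1 : ℝ) 2, ‖u t‖ ≤ ‖ν‖ + 2 * M ∧ ‖y t‖ ≤ 2 * (‖ν‖ + 2 * M) := by
  -- The unknown is the velocity `u = y'`, and the problem reads `u + ∫ Q(∫ u, u) = ν`. The map
  -- `phaseCurve` has norm at most 2, so `S` has Lipschitz constant `2/16`; one more integration
  -- makes it `1/4` for `P`.
  let S : C(TimeInterval, E) → C(TimeInterval, E) := fun u ↦
    superposition Q hQ.continuous (phaseCurve E u)
  have hSdiff : ContDiff ℝ ∞ S := (contDiff_superposition hQ hs).comp (phaseCurve E).contDiff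
  have hSlip : ∀ u v, ‖S u - S v‖ ≤ 1 / 8 * ‖u - v‖ := by
    intro u v
    refine (dist_superposition_le hL _ _).trans ?_
    rw [← map_sub]
    have := norm_phaseCurve_le (u - v)
    push_cast
    linarith
  have hSM : ∀ u, ‖S u‖ ≤ M := fun u ↦
    (ContinuousMap.norm_le _ ((norm_nonneg _).trans (hM 0))).2 fun t ↦ hM _
  let P : C(TimeInterval, E) → C(TimeInterval, E) := fun u ↦ integrateTime E (S u)
  have hPdiff : ContDiff ℝ ∞ P := (integrateTime E).contDiff.comp hSdiff
  have hPlip : ∀ u v, ‖P u - P v‖ ≤ 1 / 4 * ‖u - v‖ := by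
    intro u v
    change ‖integrateTime E (S u) - integrateTime E (S v)‖ ≤ _
    rw [← map_sub]
    linarith [norm_integrateTime_le (S u - S v), hSlip u v]
  obtain ⟨e₁, he₁, hs₁⟩ := exists_homeomorph_id_add hPdiff (c := 1 / 4)
    (by rw [← NNReal.coe_lt_coe]; norm_num) (LipschitzWith.of_dist_le_mul fun u v ↦ by
      rw [dist_eq_norm, dist_eq_norm]
      exact_mod_cast hPlip u v)
  let cst : E →L[ℝ] C(TimeInterval, E) := ContinuousLinearMap.const ℝ TimeInterval
  let U : E → C(TimeInterval, E) := fun ν ↦ e₁.symm (cst ν)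
  have hUdiff : ContDiff ℝ ∞ U := hs₁.comp cst.contDiff
  have hU : ∀ ν, U ν = cst ν - P (U ν) := by
    intro ν
    have := he₁ (U ν)
    rw [show e₁ (U ν) = cst ν from e₁.apply_symm_apply _] at this
    rw [this, add_sub_cancel_right]
  have hcst : ∀ ν, ‖cst ν‖ ≤ ‖ν‖ := fun ν ↦
    (ContinuousMap.norm_le _ (norm_nonneg _)).2 fun t ↦ le_rfl
  -- The inverse of `id + P` is Lipschitz with constant `1 / (1 - 1/4)`.
  have hUlip : ∀ ν ν', ‖U ν - U ν'‖ ≤ 4 / 3 * ‖ν - ν'‖ := by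
    intro ν ν'
    have h1 : U ν - U ν' = cst (ν - ν') - (P (U ν) - P (U ν')) := by
      rw [map_sub]
      nth_rewrite 1 [hU ν]
      nth_rewrite 1 [hU ν']
      abel
    have h2 := norm_sub_le (cst (ν - ν')) (P (U ν) - P (U ν'))
    rw [← h1] at h2
    linarith [hcst (ν - ν'), hPlip (U ν) (U ν')]
  let one : TimeInterval := ⟨1, by norm_num, by norm_num⟩
  -- The time-one position is `∫₀¹ U ν = ν + R ν`, and `R` has Lipschitz constant `2 · 1/4 · 4/3 =
  -- 2/3 < 1`, so `id + R` is a diffeomorphism.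
  let R : E → E := fun ν ↦ -(integrateTime E (P (U ν)) one)
  have hRdiff : ContDiff ℝ ∞ R :=
    (((ContinuousMap.evalCLM ℝ one).comp (integrateTime E)).contDiff.comp
      (hPdiff.comp hUdiff)).neg
  have hRlip : ∀ ν ν', ‖R ν - R ν'‖ ≤ 2 / 3 * ‖ν - ν'‖ := by
    intro ν ν'
    have h1 : R ν - R ν' = -(integrateTime E (P (U ν) - P (U ν')) one) := by
      rw [map_sub, ContinuousMap.sub_apply, neg_sub']
    rw [h1, norm_neg]
    have h2 := (integrateTime E (P (U ν) - P (U ν'))).norm_coe_le_norm one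
    linarith [norm_integrateTime_le (P (U ν) - P (U ν')), hPlip (U ν) (U ν'), hUlip ν ν']
  obtain ⟨e, he, hse⟩ := exists_homeomorph_id_add hRdiff (c := 2 / 3)
    (by rw [← NNReal.coe_lt_coe]; norm_num) (LipschitzWith.of_dist_le_mul fun u v ↦ by
      rw [dist_eq_norm, dist_eq_norm]
      exact_mod_cast hRlip u v)
  refine ⟨e, ?_, hse, fun ν ↦ ⟨fun t ↦ ∫ s in (0 : ℝ)..t, extendTime (U ν) s, extendTime (U ν),
    by simp, ?_, ?_, hasDerivAt_integral_extendTime _, ?_, ?_⟩⟩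
  · rw [show (e : E → E) = fun ν ↦ ν + R ν from funext he]
    exact contDiff_id.add hRdiff
  · have h0 : extendTime (U ν) 0 = U ν ⟨0, by norm_num, by norm_num⟩ := by
      rw [extendTime, projIcc_of_mem _ (by norm_num : (0 : ℝ) ∈ Icc (-1 : ℝ) 2)]
    rw [h0, hU]
    change ν - ∫ s in (0 : ℝ)..0, _ = ν
    rw [intervalIntegral.integral_same, sub_zero]
  · rw [he]
    have h1 : integrateTime E (U ν) one = ν - integrateTime E (P (U ν)) one := by
      nth_rewrite 1 [hU]
      rw [map_sub, ContinuousMap.sub_apply]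
      congr 1
      rw [integrateTime_apply]
      change ∫ s in (0 : ℝ)..1, ν = ν
      simp
    rw [integrateTime_apply] at h1
    rw [sub_eq_add_neg] at h1
    exact h1
  · intro t ht
    have ht' : t ∈ Icc (-1 : ℝ) 2 := ⟨ht.1.le, ht.2.le⟩
    have h1 : extendTime (S (U ν)) t =
        Q (∫ s in (0 : ℝ)..t, extendTime (U ν) s, extendTime (U ν) t) := by
      rw [extendTime, extendTime, projIcc_of_mem _ ht']
      rfl
    rw [← h1]
    have h2 := (hasDerivAt_integral_extendTime (S (U ν)) t).const_sub ν
    refine h2.congr_of_eventuallyEq ?_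
    filter_upwards [Ioo_mem_nhds ht.1 ht.2] with s hs'
    rw [extendTime, projIcc_of_mem _ ⟨hs'.1.le, hs'.2.le⟩]
    nth_rewrite 1 [hU]
    rfl
  · intro t ht
    have hn : ‖U ν‖ ≤ ‖ν‖ + 2 * M := by
      rw [hU]
      refine (norm_sub_le _ _).trans (add_le_add (hcst ν) ?_)
      exact (norm_integrateTime_le _).trans (by linarith [hSM (U ν)])
    refine ⟨(norm_extendTime_le _ _).trans hn, ?_⟩
    refine (norm_integral_extendTime_le (U ν) ⟨t, ht.1.le, ht.2.le⟩).trans ?_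
    gcongr

end Integration

end

section

/-! ### The exponential map of a tame conformally flat metric -/

section Exponential

variable {m : ℕ}

/-- The quadratic expression of the geodesic equation of a conformally flat metric. -/
def geodesicForm (a u : Euc m) : Euc m := (2 * inner ℝ a u) • u - ‖u‖ ^ 2 • a

theorem contDiff_geodesicForm {V : Type*} [NormedAddCommGroup V] [NormedSpace ℝ V]
    {f g : V → Euc m} (hf : ContDiff ℝ ∞ f) (hg : ContDiff ℝ ∞ g) :
    ContDiff ℝ ∞ (fun z ↦ geodesicForm (f z) (g z)) := by
  unfold geodesicForm
  exact ((contDiff_const.mul (hf.inner ℝ hg)).smul hg).sub ((hg.norm_sq ℝ).smul hf)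

theorem norm_geodesicForm_le (a u : Euc m) : ‖geodesicForm a u‖ ≤ 3 * ‖a‖ * ‖u‖ ^ 2 := by
  unfold geodesicForm
  refine (norm_sub_le _ _).trans ?_
  rw [norm_smul, norm_smul, norm_mul, Real.norm_eq_abs, Real.norm_eq_abs, Real.norm_eq_abs]
  have := abs_real_inner_le_norm a u
  rw [abs_two, abs_of_nonneg (sq_nonneg ‖u‖)]
  nlinarith [norm_nonneg u, norm_nonneg a]

theorem norm_geodesicForm_sub_le {a a' u u' : Euc m} {α : ℝ} (ha' : ‖a'‖ ≤ α)
    (hu : ‖u‖ ≤ 4) (hu' : ‖u'‖ ≤ 4) :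
    ‖geodesicForm a u - geodesicForm a' u'‖ ≤ 48 * ‖a - a'‖ + 24 * α * ‖u - u'‖ := by
  have e : geodesicForm a u - geodesicForm a' u' =
      (2 * inner ℝ (a - a') u) • u + (2 * inner ℝ a' (u - u')) • u
        + (2 * inner ℝ a' u') • (u - u') - (‖u‖ ^ 2 • (a - a') + (‖u‖ ^ 2 - ‖u'‖ ^ 2) • a') := by
    unfold geodesicForm
    simp only [inner_sub_left, inner_sub_right]
    module
  have hα : 0 ≤ α := (norm_nonneg _).trans ha'
  have b1 : ‖(2 * inner ℝ (a - a') u) • u‖ ≤ 32 * ‖a - a'‖ := by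
    rw [norm_smul, norm_mul, Real.norm_eq_abs, Real.norm_eq_abs, abs_two]
    have h1 : |inner ℝ (a - a') u| ≤ ‖a - a'‖ * 4 :=
      (abs_real_inner_le_norm _ _).trans (by gcongr)
    calc _ ≤ 2 * (‖a - a'‖ * 4) * 4 := by gcongr
      _ = _ := by ring
  have b2 : ‖(2 * inner ℝ a' (u - u')) • u‖ ≤ 8 * α * ‖u - u'‖ := by
    rw [norm_smul, norm_mul, Real.norm_eq_abs, Real.norm_eq_abs, abs_two]
    have h1 : |inner ℝ a' (u - u')| ≤ α * ‖u - u'‖ :=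
      (abs_real_inner_le_norm _ _).trans (by gcongr)
    calc _ ≤ 2 * (α * ‖u - u'‖) * 4 := by gcongr
      _ = _ := by ring
  have b3 : ‖(2 * inner ℝ a' u') • (u - u')‖ ≤ 8 * α * ‖u - u'‖ := by
    rw [norm_smul, norm_mul, Real.norm_eq_abs, Real.norm_eq_abs, abs_two]
    have h1 : |inner ℝ a' u'| ≤ α * 4 :=
      (abs_real_inner_le_norm _ _).trans (by gcongr)
    calc _ ≤ 2 * (α * 4) * ‖u - u'‖ := by gcongr
      _ = _ := by ring
  have b4 : ‖‖u‖ ^ 2 • (a - a')‖ ≤ 16 * ‖a - a'‖ := by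
    rw [norm_smul, Real.norm_eq_abs, abs_of_nonneg (sq_nonneg _)]
    gcongr
    nlinarith [norm_nonneg u]
  have b5 : ‖(‖u‖ ^ 2 - ‖u'‖ ^ 2) • a'‖ ≤ 8 * α * ‖u - u'‖ := by
    rw [norm_smul, Real.norm_eq_abs]
    have h1 : |‖u‖ ^ 2 - ‖u'‖ ^ 2| ≤ 8 * ‖u - u'‖ := by
      rw [sq_sub_sq, abs_mul, abs_of_nonneg (by positivity : 0 ≤ ‖u‖ + ‖u'‖)]
      gcongr
      · linarith
      · exact abs_norm_sub_norm_le _ _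
    calc _ ≤ 8 * ‖u - u'‖ * α := by gcongr
      _ = _ := by ring
  rw [e]
  refine (norm_sub_le _ _).trans ?_
  have t1 := norm_add₃_le (a := (2 * inner ℝ (a - a') u) • u)
    (b := (2 * inner ℝ a' (u - u')) • u) (c := (2 * inner ℝ a' u') • (u - u'))
  have t2 := norm_add_le (‖u‖ ^ 2 • (a - a')) ((‖u‖ ^ 2 - ‖u'‖ ^ 2) • a')
  linarith

/-- A Lipschitz bound for a function that is cut off by a bump function. -/
theorem lipschitzWith_bump_smul {V W : Type*} [NormedAddCommGroup V] [NormedSpace ℝ V]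
    [NormedAddCommGroup W] [NormedSpace ℝ W] [HasContDiffBump V]
    (χ : ContDiffBump (0 : V)) {R : ℝ} (hR : χ.rOut < R) {k : ℝ≥0} (hk : LipschitzWith k χ)
    {q : V → W} (hq : Differentiable ℝ q) {S l : ℝ≥0} (hS : ∀ z ∈ Metric.ball (0 : V) R, ‖q z‖ ≤ S)
    (hl : ∀ z ∈ Metric.ball (0 : V) R, ∀ z' ∈ Metric.ball (0 : V) R, ‖q z - q z'‖ ≤ l * ‖z - z'‖) :
    LipschitzWith (k * S + l) (fun z ↦ χ z • q z) := by
  have hd : Differentiable ℝ (fun z ↦ χ z • q z) :=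
    (χ.contDiff.differentiable (n := 1) (by simp)).smul hq
  -- The bound on `q` is only local, so the derivative is estimated pointwise: in the ball by the
  -- product rule for differences, outside it by zero, as the support of `χ` lies strictly inside.
  refine lipschitzWith_of_nnnorm_fderiv_le (𝕜 := ℝ) hd fun z ↦ ?_
  by_cases hz : z ∈ Metric.ball (0 : V) R
  · have hL : LipschitzOnWith (k * S + l) (fun z ↦ χ z • q z) (Metric.ball (0 : V) R) := by
      refine LipschitzOnWith.of_dist_le_mul fun z hz z' hz' ↦ ?_
      rw [dist_eq_norm, dist_eq_norm]
      have e : χ z • q z - χ z' • q z' = (χ z - χ z') • q z + χ z' • (q z - q z') := by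
        module
      rw [e]
      refine (norm_add_le _ _).trans ?_
      rw [norm_smul, norm_smul]
      have h1 : ‖χ z - χ z'‖ ≤ k * ‖z - z'‖ := hk.norm_sub_le z z'
      have h2 : ‖χ z'‖ ≤ 1 := by
        rw [Real.norm_eq_abs, abs_of_nonneg χ.nonneg]
        exact χ.le_one
      calc _ ≤ k * ‖z - z'‖ * S + 1 * (l * ‖z - z'‖) := by
            gcongr
            · exact hS z hz
            · exact hl z hz z' hz'
        _ = _ := by push_cast; ring
    exact norm_fderiv_le_of_lipschitzOn ℝ (Metric.isOpen_ball.mem_nhds hz) hL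
  · have hz' : z ∉ tsupport (fun z ↦ χ z • q z) := by
      intro h
      have := tsupport_smul_subset_left χ q h
      rw [χ.tsupport_eq, mem_closedBall_zero_iff] at this
      rw [mem_ball_zero_iff] at hz
      linarith
    have : fderiv ℝ (fun z ↦ χ z • q z) z = 0 := by
      by_contra h
      exact hz' (support_fderiv_subset ℝ h)
    rw [this]
    simp

/-- Uniform control of the conformal factor `e^{2ψ}` at the scale of the metric. -/
def IsTame (ψ : Euc m → ℝ) (τ C : ℝ) : Prop :=
  ∀ x y : Euc m, ‖y - x‖ ≤ τ * Real.exp (-ψ x) →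
    ‖gradient ψ y‖ ≤ C * Real.exp (ψ x) ∧
      ‖fderiv ℝ (gradient ψ) y‖ ≤ C * Real.exp (ψ x) ^ 2

theorem gradient_apply (ψ : Euc m → ℝ) (x : Euc m) (i : Fin m) :
    gradient ψ x i = partialDeriv i ψ x := by
  rw [partialDeriv, ← InnerProductSpace.toDual_symm_apply (𝕜 := ℝ), ← gradient,
    EuclideanSpace.inner_single_right]
  simp

theorem contDiff_gradient {ψ : Euc m → ℝ} (hψ : ContDiff ℝ ∞ ψ) : ContDiff ℝ ∞ (gradient ψ) :=
  (InnerProductSpace.toDual ℝ (Euc m)).symm.contDiff.comp (hψ.fderiv_right (m := ∞) (by simp))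

theorem geodesicForm_gradient_apply {ψ : Euc m → ℝ} {hψ : ContDiff ℝ ∞ ψ} (x u : Euc m)
    (k : Fin m) : geodesicForm (gradient ψ x) u k =
      ∑ i, ∑ j, christoffel (conformalMetric ψ hψ) k i j x * u i * u j := by
  have h1 : ∀ i j, christoffel (conformalMetric ψ hψ) k i j x * u i * u j =
      kronecker k j * (partialDeriv i ψ x * u i * u j)
        + kronecker k i * (u i * (partialDeriv j ψ x * u j))
        - kronecker i j * (partialDeriv k ψ x * u i * u j) := by
    intro i j
    rw [christoffel_conformal]
    ring
  have h2 : (inner ℝ (gradient ψ x) u : ℝ) = ∑ i, partialDeriv i ψ x * u i := by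
    rw [PiLp.inner_apply]
    simp only [gradient_apply, RCLike.inner_apply, conj_trivial, mul_comm]
  have h3 : ‖u‖ ^ 2 = ∑ i, u i * u i := by
    rw [EuclideanSpace.norm_sq_eq]
    simp [sq]
  simp only [h1, Finset.sum_add_distrib, Finset.sum_sub_distrib, sum_kronecker_mul,
    ← Finset.mul_sum, ← Finset.sum_mul]
  simp only [geodesicForm, PiLp.sub_apply, PiLp.smul_apply, smul_eq_mul, gradient_apply, h2, h3]
  simp only [mul_assoc, ← Finset.mul_sum]
  ring

/-- Cutting `q` off makes it compactly supported and globally Lipschitz without affecting the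
relevant solutions: with `‖ν‖ ≤ 1/2` and `M = 1/16` the velocity is at most `5/8` and the position
at most `5/4`, inside the ball of radius 2 where `χ = 1`. -/
theorem exists_diffeo_of_bounds {E : Type} [NormedAddCommGroup E] [NormedSpace ℝ E]
    [CompleteSpace E] [HasContDiffBump (E × E)] [FiniteDimensional ℝ E]
    (χ : ContDiffBump (0 : E × E)) (hχi : χ.rIn = 2)
    (hχo : χ.rOut = 3) {k : ℝ≥0} (hk : LipschitzWith k χ) {S l : ℝ≥0}
    (hS : S ≤ 1 / 16) (hkl : k * S + l ≤ 1 / 16) {q : E × E → E} (hq : ContDiff ℝ ∞ q)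
    (hqS : ∀ z ∈ Metric.ball (0 : E × E) 4, ‖q z‖ ≤ S)
    (hqL : ∀ z ∈ Metric.ball (0 : E × E) 4, ∀ z' ∈ Metric.ball (0 : E × E) 4,
      ‖q z - q z'‖ ≤ l * ‖z - z'‖) :
    ∃ e : E ≃ₜ E, ContDiff ℝ ∞ e ∧ ContDiff ℝ ∞ e.symm ∧
      ∀ ν : E, ‖ν‖ ≤ 1 / 2 → ∃ y u : ℝ → E, y 0 = 0 ∧ u 0 = ν ∧ y 1 = e ν ∧
        (∀ t, HasDerivAt y (u t) t) ∧
        ∀ t ∈ Ioo (-1 : ℝ) 2, HasDerivAt u (-q (y t, u t)) t := by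
  have hL : LipschitzWith (1 / 16) (fun z ↦ χ z • q z) :=
    (lipschitzWith_bump_smul χ (R := 4) (by rw [hχo]; norm_num) hk
      (hq.differentiable (by simp)) hqS hqL).weaken hkl
  have hM : ∀ z, ‖χ z • q z‖ ≤ 1 / 16 := by
    intro z
    rw [norm_smul, Real.norm_of_nonneg χ.nonneg]
    by_cases hz : z ∈ Metric.ball (0 : E × E) 4
    · have h1 : (S : ℝ) ≤ 1 / 16 := by exact_mod_cast hS
      calc _ ≤ 1 * (1 / 16 : ℝ) := by
            gcongr
            · exact χ.le_one
            · exact (hqS z hz).trans h1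
        _ = _ := by ring
    · rw [χ.zero_of_le_dist]
      · norm_num
      · rw [Metric.mem_ball, not_lt] at hz
        rw [hχo]
        exact (show (3 : ℝ) ≤ 4 by norm_num).trans hz
  have hcs : HasCompactSupport (fun z ↦ χ z • q z) := χ.hasCompactSupport.smul_right
  have hcd : ContDiff ℝ ∞ (fun z ↦ χ z • q z) := (χ.contDiff (n := ⊤)).smul hq
  obtain ⟨e, he, hes, hsol⟩ := exists_diffeo_time_one hcd hcs hL hM
  refine ⟨e, he, hes, fun ν hν ↦ ?_⟩
  obtain ⟨y, u, hy0, hu0, hy1, hy, hu, hb⟩ := hsol ν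
  refine ⟨y, u, hy0, hu0, hy1, hy, fun t ht ↦ ?_⟩
  have hχ : χ (y t, u t) = 1 := by
    apply χ.one_of_mem_closedBall
    obtain ⟨b1, b2⟩ := hb t ht
    rw [mem_closedBall_zero_iff, hχi]
    refine max_le ?_ ?_
    · change ‖y t‖ ≤ 2
      linarith
    · change ‖u t‖ ≤ 2
      linarith
  have h1 := hu t ht
  rwa [hχ, one_smul] at h1

theorem exists_diffeo_of_geodesicForm (χ : ContDiffBump (0 : Euc m × Euc m)) (hχi : χ.rIn = 2)
    (hχo : χ.rOut = 3) {k : ℝ≥0} (hk : LipschitzWith k χ) {α : ℝ≥0}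
    (hα : (48 * k + 72) * (α : ℝ) ≤ 1 / 16) {a : Euc m → Euc m} (hadiff : ContDiff ℝ ∞ a)
    (ha1 : ∀ y, ‖y‖ < 4 → ‖a y‖ ≤ α)
    (ha2 : ∀ y ∈ Metric.ball (0 : Euc m) 4, ∀ y' ∈ Metric.ball (0 : Euc m) 4,
      ‖a y - a y'‖ ≤ α * ‖y - y'‖) :
    ∃ e : Euc m ≃ₜ Euc m, ContDiff ℝ ∞ e ∧ ContDiff ℝ ∞ e.symm ∧
      ∀ ν : Euc m, ‖ν‖ ≤ 1 / 2 → ∃ y u : ℝ → Euc m, y 0 = 0 ∧ u 0 = ν ∧ y 1 = e ν ∧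
        (∀ t, HasDerivAt y (u t) t) ∧
        ∀ t ∈ Ioo (-1 : ℝ) 2, HasDerivAt u (-geodesicForm (a (y t)) (u t)) t := by
  let q : Euc m × Euc m → Euc m := fun z ↦ geodesicForm (a z.1) z.2
  have hq : ContDiff ℝ ∞ q := contDiff_geodesicForm hadiff.fst' contDiff_snd
  have hball : ∀ z ∈ Metric.ball (0 : Euc m × Euc m) 4, ‖z.1‖ < 4 ∧ ‖z.2‖ < 4 := by
    intro z hz
    rw [mem_ball_zero_iff] at hz
    exact ⟨(norm_fst_le z).trans_lt hz, (norm_snd_le z).trans_lt hz⟩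
  have hqS : ∀ z ∈ Metric.ball (0 : Euc m × Euc m) 4, ‖q z‖ ≤ (48 * α : ℝ≥0) := by
    intro z hz
    obtain ⟨h1, h2⟩ := hball z hz
    refine (norm_geodesicForm_le _ _).trans ?_
    push_cast
    calc _ ≤ 3 * (α : ℝ) * 4 ^ 2 := by
          gcongr
          exact ha1 _ h1
      _ = _ := by ring
  have hqL : ∀ z ∈ Metric.ball (0 : Euc m × Euc m) 4, ∀ z' ∈ Metric.ball (0 : Euc m × Euc m) 4,
      ‖q z - q z'‖ ≤ (72 * α : ℝ≥0) * ‖z - z'‖ := by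
    intro z hz z' hz'
    obtain ⟨h1, h2⟩ := hball z hz
    obtain ⟨h1', h2'⟩ := hball z' hz'
    refine (norm_geodesicForm_sub_le (ha1 _ h1') h2.le h2'.le).trans ?_
    have e1 := ha2 z.1 (by simpa using h1) z'.1 (by simpa using h1')
    have e2 : ‖z.1 - z'.1‖ ≤ ‖z - z'‖ := norm_fst_le (z - z')
    have e3 : ‖z.2 - z'.2‖ ≤ ‖z - z'‖ := norm_snd_le (z - z')
    push_cast
    calc _ ≤ 48 * (α * ‖z - z'‖) + 24 * α * ‖z - z'‖ := by
          gcongr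
          exact e1.trans (by gcongr)
      _ = _ := by ring
  have h0 : 0 ≤ (k : ℝ) * α := by positivity
  have h0' : 0 ≤ (α : ℝ) := α.2
  refine exists_diffeo_of_bounds χ hχi hχo hk (S := 48 * α) (l := 72 * α) ?_ ?_ hq hqS hqL
  · rw [← NNReal.coe_le_coe]
    push_cast
    linarith
  · rw [← NNReal.coe_le_coe]
    push_cast
    linarith

/-- In the variable `y = (γ - x) / κ` with `κ = η e^{-ψ(x)}`, geodesics solve `y'' = -geodesicForm
(a y) y'`, where `a y = κ ∇ψ(x + κ y)`. Tameness bounds `a` and its derivative by `η C` on the ball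
of radius 4, so one small `η` serves every `x`. -/
theorem exists_expIsDiffeoOnBall_conformal {ψ : Euc m → ℝ} {hψ : ContDiff ℝ ∞ ψ} {τ C : ℝ}
    (hτ : 0 < τ) (hC : 0 < C) (h : IsTame ψ τ C) :
    ∃ ε : ℝ, 0 < ε ∧ ∀ x, ExpIsDiffeoOnBall (conformalMetric ψ hψ) x ε := by
  let χ : ContDiffBump (0 : Euc m × Euc m) := ⟨2, 3, by norm_num, by norm_num⟩
  obtain ⟨k, hk⟩ := (χ.contDiff (n := ⊤)).lipschitzWith_of_hasCompactSupport χ.hasCompactSupport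
    (by simp)
  obtain ⟨η, hη0, hη1, hητ, hηC⟩ : ∃ η : ℝ, 0 < η ∧ η ≤ 1 ∧ 4 * η ≤ τ ∧
      (48 * k + 72) * (η * C) ≤ 1 / 16 := by
    refine ⟨min 1 (min (τ / 4) (1 / (16 * C * (48 * k + 72)))), by positivity, min_le_left _ _,
      ?_, ?_⟩
    · have : min 1 (min (τ / 4) (1 / (16 * C * (48 * k + 72)))) ≤ τ / 4 :=
        (min_le_right _ _).trans (min_le_left _ _)
      linarith
    · have : min 1 (min (τ / 4) (1 / (16 * C * (48 * k + 72)))) ≤ 1 / (16 * C * (48 * k + 72)) :=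
        (min_le_right _ _).trans (min_le_right _ _)
      rw [le_div_iff₀ (by positivity)] at this
      linarith
  refine ⟨η / 2, by positivity, fun x ↦ ?_⟩
  set κ : ℝ := η * Real.exp (-ψ x) with hκ
  have hκ0 : 0 < κ := by positivity
  have hκψ : κ * Real.exp (ψ x) = η := by
    rw [hκ, mul_assoc, ← Real.exp_add]
    simp
  let α : ℝ≥0 := ⟨η * C, by positivity⟩
  have hα : (α : ℝ) = η * C := rfl
  let a : Euc m → Euc m := fun y ↦ κ • gradient ψ (x + κ • y)
  have hadiff : ContDiff ℝ ∞ a := by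
    have := contDiff_gradient hψ
    fun_prop
  have hnear : ∀ y : Euc m, ‖y‖ < 4 → ‖x + κ • y - x‖ ≤ τ * Real.exp (-ψ x) := by
    intro y hy
    rw [add_sub_cancel_left, norm_smul, Real.norm_of_nonneg hκ0.le, hκ]
    have := Real.exp_pos (-ψ x)
    nlinarith
  have ha1 : ∀ y, ‖y‖ < 4 → ‖a y‖ ≤ α := by
    intro y hy
    have := (h x _ (hnear y hy)).1
    rw [norm_smul, Real.norm_of_nonneg hκ0.le, hα]
    calc _ ≤ κ * (C * Real.exp (ψ x)) := by gcongr
      _ = κ * Real.exp (ψ x) * C := by ring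
      _ = _ := by rw [hκψ]
  have ha2 : ∀ y ∈ Metric.ball (0 : Euc m) 4, ∀ y' ∈ Metric.ball (0 : Euc m) 4,
      ‖a y - a y'‖ ≤ α * ‖y - y'‖ := by
    intro y hy y' hy'
    refine (convex_ball (0 : Euc m) 4).norm_image_sub_le_of_norm_hasFDerivWithin_le
      (f' := fun y ↦ (κ ^ 2) • fderiv ℝ (gradient ψ) (x + κ • y)) (fun z hz ↦ ?_) (fun z hz ↦ ?_)
      hy' hy
    · have h1 : HasFDerivAt (gradient ψ) (fderiv ℝ (gradient ψ) (x + κ • z)) (x + κ • z) :=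
        ((contDiff_gradient hψ).differentiable (by simp) _).hasFDerivAt
      have h2 : HasFDerivAt (fun y : Euc m ↦ x + κ • y) (κ • ContinuousLinearMap.id ℝ (Euc m)) z :=
        ((hasFDerivAt_id z).const_smul κ).const_add x
      have h3 := ((h1.comp z h2).const_smul κ).hasFDerivWithinAt (s := Metric.ball (0 : Euc m) 4)
      have h4 : (κ ^ 2) • fderiv ℝ (gradient ψ) (x + κ • z) =
          κ • (fderiv ℝ (gradient ψ) (x + κ • z)).comp
            (κ • ContinuousLinearMap.id ℝ (Euc m)) := by
        rw [ContinuousLinearMap.comp_smul, ContinuousLinearMap.comp_id, smul_smul, sq]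
      rw [h4]
      exact h3
    · rw [norm_smul, Real.norm_of_nonneg (sq_nonneg κ), hα]
      have := (h x _ (hnear z (by simpa using hz))).2
      calc _ ≤ κ ^ 2 * (C * Real.exp (ψ x) ^ 2) := by gcongr
        _ = (κ * Real.exp (ψ x)) ^ 2 * C := by ring
        -- The second derivative gains `η²`, and `η² ≤ η` because `η ≤ 1`.
        _ ≤ _ := by
          rw [hκψ]
          gcongr
          nlinarith
  obtain ⟨e, he, hes, hsol⟩ := exists_diffeo_of_geodesicForm χ rfl rfl hk (α := α) hηC hadiff ha1 ha2
  let H : Euc m ≃ₜ Euc m := (Homeomorph.smulOfNeZero κ⁻¹ (inv_ne_zero hκ0.ne')).trans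
    (e.trans ((Homeomorph.smulOfNeZero κ hκ0.ne').trans (Homeomorph.addLeft x)))
  have hH : ∀ v, H v = x + κ • e (κ⁻¹ • v) := fun v ↦ rfl
  have hHs : ∀ y, H.symm y = κ⁻¹⁻¹ • e.symm (κ⁻¹ • (-x + y)) := fun y ↦ rfl
  have hopen : IsOpen {v : Euc m | metricNorm (conformalMetric ψ hψ) x v < η / 2} := by
    simp only [metricNorm_conformal]
    exact isOpen_lt (by fun_prop) continuous_const
  refine ⟨H.toOpenPartialHomeomorph.restrOpen _ hopen, ?_, ?_, ?_, ?_⟩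
  · simp
  · have : ContDiff ℝ ∞ H := by
      rw [show (H : Euc m → Euc m) = _ from funext hH]
      fun_prop
    exact this.contDiffOn
  · have : ContDiff ℝ ∞ H.symm := by
      rw [show (H.symm : Euc m → Euc m) = _ from funext hHs]
      fun_prop
    exact this.contDiffOn
  · intro v hv
    have hv' : metricNorm (conformalMetric ψ hψ) x v < η / 2 := by simpa using hv
    rw [metricNorm_conformal] at hv'
    -- As `κ e^{ψ(x)} = η`, the `g`-radius `η / 2` is the Euclidean radius `κ / 2`.
    have hν : ‖κ⁻¹ • v‖ ≤ 1 / 2 := by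
      rw [norm_smul, Real.norm_of_nonneg (by positivity), inv_mul_le_iff₀ hκ0]
      have : Real.exp (ψ x) * ‖v‖ ≤ Real.exp (ψ x) * (κ * (1 / 2)) := by
        rw [← mul_assoc, mul_comm _ κ, hκψ]
        linarith
      exact le_of_mul_le_mul_left this (Real.exp_pos _)
    obtain ⟨y, u, hy0, hu0, hy1, hy, hu⟩ := hsol (κ⁻¹ • v) hν
    have hγ : ∀ t, HasDerivAt (fun t ↦ x + κ • y t) (κ • u t) t := fun t ↦
      ((hy t).const_smul κ).const_add x
    have hdγ : deriv (fun t ↦ x + κ • y t) = fun t ↦ κ • u t := funext fun t ↦ (hγ t).deriv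
    refine ⟨fun t ↦ x + κ • y t, 1, one_pos, ?_, ?_, ?_, ?_⟩
    · intro t ht
      have ht' : t ∈ Ioo (-1 : ℝ) 2 := ⟨ht.1, by linarith [ht.2]⟩
      refine ⟨(hγ t).differentiableAt, ?_⟩
      rw [hdγ]
      have h1 := (hu t ht').const_smul κ
      refine h1.congr_deriv ?_
      ext k
      have h2 := geodesicForm_gradient_apply (hψ := hψ) (x + κ • y t) (κ • u t) k
      change κ * -(geodesicForm (a (y t)) (u t)) k = -_
      simp only [mul_neg, neg_inj]
      rw [← h2]
      simp only [a, geodesicForm, PiLp.sub_apply, PiLp.smul_apply, smul_eq_mul, inner_smul_left,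
        inner_smul_right, norm_smul, Real.norm_of_nonneg hκ0.le, conj_trivial]
      ring
    · simp [hy0]
    · rw [hdγ]
      simp [hu0, hκ0.ne']
    · change x + κ • y 1 = H v
      rw [hH, hy1]

end Exponential

end

/-! ### Growth profiles and the conformal factor -/

section

/-- The growth profiles of the conformal factor: smooth functions that increase slowly. -/
structure IsProfile (h : ℝ → ℝ) : Prop where
  contDiff : ContDiff ℝ ∞ h
  eq_zero : ∀ t ≤ 0, h t = 0
  deriv_nonneg : ∀ t, 0 ≤ deriv h t
  deriv_le : ∀ t, deriv h t ≤ 1 / 32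
  abs_deriv_deriv_le : ∀ t, |deriv (deriv h) t| ≤ 1 / 32
  tendsto : Tendsto h atTop atTop

namespace IsProfile

variable {h : ℝ → ℝ}

theorem differentiable (hh : IsProfile h) : Differentiable ℝ h := hh.contDiff.differentiable
    (by simp)

theorem hasDerivAt (hh : IsProfile h) (t : ℝ) : HasDerivAt h (deriv h t) t :=
    (hh.differentiable t).hasDerivAt

theorem hasDerivAt_deriv (hh : IsProfile h) (t : ℝ) : HasDerivAt (deriv h) (deriv
    (deriv h) t) t := by
  have : ContDiff ℝ ∞ (deriv h) := hh.contDiff.iterate_deriv 1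
  exact (this.differentiable (by simp) t).hasDerivAt

theorem monotone (hh : IsProfile h) :
    Monotone h := monotone_of_deriv_nonneg hh.differentiable hh.deriv_nonneg

theorem nonneg (hh : IsProfile h) (t : ℝ) : 0 ≤ h t := by
  rcases le_total t 0 with ht | ht
  · exact (hh.eq_zero t ht).ge
  · exact (hh.eq_zero 0 le_rfl).ge.trans (hh.monotone ht)

theorem le_self (hh : IsProfile h) {t : ℝ} (ht : 0 ≤ t) : h t ≤ t / 32 := by
  have hm : Antitone fun t ↦ h t - t / 32 := by
    refine antitone_of_hasDerivAt_nonpos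
      (fun t ↦ (hh.hasDerivAt t).sub ((hasDerivAt_id t).div_const 32)) fun t ↦ ?_
    simpa using hh.deriv_le t
  have := hm ht
  simp only [hh.eq_zero 0 le_rfl] at this
  linarith

end IsProfile

section LogFactor

variable {m : ℕ}

/-- The function `√(1 + |x|²)`. -/
def bracket (x : Euc m) : ℝ := Real.sqrt (1 + ‖x‖ ^ 2)

theorem bracket_sq (x : Euc m) : bracket x ^ 2 = 1 + ‖x‖ ^ 2 := Real.sq_sqrt (by positivity)

theorem bracket_pos (x : Euc m) : 0 < bracket x := Real.sqrt_pos.2 (by positivity)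

theorem one_le_bracket (x : Euc m) : 1 ≤ bracket x := by
  rw [bracket, Real.one_le_sqrt]
  nlinarith [norm_nonneg x]

theorem norm_le_bracket (x : Euc m) : ‖x‖ ≤ bracket x :=
  Real.le_sqrt_of_sq_le (by linarith)

theorem bracket_le_add (x y : Euc m) : bracket x ≤ bracket y + ‖x - y‖ := by
  have h1 : ‖x‖ ≤ ‖y‖ + ‖x - y‖ := by
    calc ‖x‖ = ‖y + (x - y)‖ := by rw [add_sub_cancel]
      _ ≤ _ := norm_add_le _ _
  refine Real.sqrt_le_iff.2 ⟨add_nonneg (bracket_pos y).le (norm_nonneg _), ?_⟩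
  have h2 := norm_le_bracket y
  have h3 := bracket_sq y
  nlinarith [norm_nonneg x, norm_nonneg y, norm_nonneg (x - y)]

/-- The function `log (1 + |x|²)`. -/
def logBracket (x : Euc m) : ℝ := Real.log (1 + ‖x‖ ^ 2)

theorem logBracket_nonneg (x : Euc m) : 0 ≤ logBracket x :=
  Real.log_nonneg (by nlinarith [norm_nonneg x])

theorem exp_half_logBracket (x : Euc m) : Real.exp (logBracket x / 2) = bracket x := by
  rw [bracket, Real.sqrt_eq_rpow, Real.rpow_def_of_pos (by positivity), logBracket]
  ring_nf

theorem contDiff_logBracket : ContDiff ℝ ∞ (logBracket (m := m)) :=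
  (contDiff_const.add (contDiff_norm_sq ℝ)).log fun x ↦ by positivity

theorem hasFDerivAt_logBracket (x : Euc m) :
    HasFDerivAt logBracket ((2 / bracket x ^ 2) • innerSL ℝ x) x := by
  have h1 : HasFDerivAt (fun x : Euc m ↦ 1 + ‖x‖ ^ 2) (2 • innerSL ℝ x) x :=
    ((hasStrictFDerivAt_norm_sq x).hasFDerivAt).const_add 1
  have h2 := h1.log (by positivity)
  refine h2.congr_fderiv ?_
  ext v
  simp [bracket_sq]
  ring

theorem logBracket_le_of_norm_le {x y : Euc m} (h : ‖x‖ ≤ ‖y‖) : logBracket x ≤ logBracket y :=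
  Real.log_le_log (by positivity) (by gcongr)

theorem norm_le_of_logBracket_le {x : Euc m} {T : ℝ} (h : logBracket x ≤ T) :
    ‖x‖ ≤ Real.exp (T / 2) := by
  refine (norm_le_bracket x).trans ?_
  rw [← exp_half_logBracket]
  gcongr

end LogFactor

section Factor

variable {m : ℕ} {h : ℝ → ℝ}

/-- The logarithm `ψ` of the conformal factor. -/
def logFactor (h : ℝ → ℝ) (x : Euc m) : ℝ := h (logBracket x) - logBracket x / 2

/-- The radius `F` of the spherical cross sections. -/
def radius (h : ℝ → ℝ) (x : Euc m) : ℝ := Real.exp (h (logBracket x))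

theorem radius_pos (h : ℝ → ℝ) (x : Euc m) : 0 < radius h x := Real.exp_pos _

theorem exp_logFactor (h : ℝ → ℝ) (x : Euc m) :
    Real.exp (logFactor h x) = radius h x / bracket x := by
  rw [logFactor, Real.exp_sub, exp_half_logBracket, radius]

theorem one_le_radius (hh : IsProfile h) (x : Euc m) : 1 ≤ radius h x := Real.one_le_exp
    (hh.nonneg _)

theorem contDiff_logFactor (hh : IsProfile h) : ContDiff ℝ ∞ (logFactor (m := m) h) :=
  (hh.contDiff.comp contDiff_logBracket).sub (contDiff_logBracket.div_const 2)

theorem gradient_logFactor (hh : IsProfile h) (x : Euc m) :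
    gradient (logFactor h) x = ((2 * deriv h (logBracket x) - 1) / bracket x ^ 2) • x := by
  have h1 := ((hh.hasDerivAt (logBracket x)).comp_hasFDerivAt x (hasFDerivAt_logBracket x)).sub
    ((hasFDerivAt_logBracket x).mul_const (2⁻¹ : ℝ))
  have h2 : HasFDerivAt (logFactor h) (innerSL ℝ
      (((2 * deriv h (logBracket x) - 1) / bracket x ^ 2) • x)) x := by
    refine (h1.congr_fderiv ?_)
    ext v
    simp
    ring
  rw [gradient, h2.fderiv]
  exact (InnerProductSpace.toDual ℝ (Euc m)).symm_apply_apply _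

theorem hasFDerivAt_gradient_logFactor (hh : IsProfile h) (x : Euc m) :
    HasFDerivAt (gradient (logFactor h))
      (((2 * deriv h (logBracket x) - 1) / bracket x ^ 2) • ContinuousLinearMap.id ℝ (Euc m) +
        ((2 * (2 * deriv (deriv h) (logBracket x) - (2 * deriv h (logBracket x) - 1)) /
          bracket x ^ 4) • innerSL ℝ x).smulRight x) x := by
  have e : gradient (logFactor (m := m) h) = fun x ↦
      ((2 * deriv h (logBracket x) - 1) * (1 + ‖x‖ ^ 2)⁻¹) • x := by
    ext1 x
    rw [gradient_logFactor hh, bracket_sq, div_eq_mul_inv]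
  rw [e]
  have h1 : HasFDerivAt (fun x : Euc m ↦ 1 + ‖x‖ ^ 2) (2 • innerSL ℝ x) x :=
    ((hasStrictFDerivAt_norm_sq x).hasFDerivAt).const_add 1
  have h2 := (((((hh.hasDerivAt_deriv (logBracket x)).comp_hasFDerivAt x
    (hasFDerivAt_logBracket x)).const_mul 2).sub_const 1).mul
      ((hasDerivAt_inv (by positivity)).comp_hasFDerivAt x h1)).smul (hasFDerivAt_id x)
  refine h2.congr_fderiv ?_
  ext v
  have hb : bracket x ^ 4 = (bracket x ^ 2) ^ 2 := by ring
  have : 1 + ‖x‖ ^ 2 ≠ 0 := by positivity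
  simp [hb, bracket_sq]
  field_simp
  ring

end Factor

end

section

theorem partialDeriv_partialDeriv_eq {m : ℕ} {ψ : Euc m → ℝ} (hψ : ContDiff ℝ ∞ ψ) (x : Euc m)
    (i j : Fin m) : partialDeriv i (partialDeriv j ψ) x =
      fderiv ℝ (gradient ψ) x (EuclideanSpace.single i 1) j := by
  have e : partialDeriv j ψ = fun y ↦ gradient ψ y j := funext fun y ↦ (gradient_apply ψ y j).symm
  have hd : HasFDerivAt (gradient ψ) (fderiv ℝ (gradient ψ) x) x :=
    ((contDiff_gradient hψ).differentiable (by simp) x).hasFDerivAt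
  have h3 : HasFDerivAt (fun y ↦ gradient ψ y j) ((EuclideanSpace.proj j : Euc m →L[ℝ] ℝ).comp
      (fderiv ℝ (gradient ψ) x)) x :=
    ((EuclideanSpace.proj j : Euc m →L[ℝ] ℝ).hasFDerivAt).comp x hd
  rw [e, partialDeriv, h3.fderiv]
  rfl

/-! ### Bounded geometry and positive scalar curvature -/

section Geometry

variable {m : ℕ} {h : ℝ → ℝ}

theorem abs_two_mul_deriv_sub_one_le (hh : IsProfile h) (t : ℝ) : |2 * deriv h t - 1| ≤ 1 := by
  rw [abs_le]
  constructor <;> linarith [hh.deriv_nonneg t, hh.deriv_le t]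

theorem norm_gradient_logFactor_le (hh : IsProfile h) (x : Euc m) : ‖gradient
    (logFactor h) x‖ ≤ 1 / bracket x := by
  rw [gradient_logFactor hh, norm_smul, Real.norm_eq_abs, abs_div, abs_of_pos
    (pow_pos (bracket_pos x) 2)]
  have h1 := bracket_pos x
  calc _ ≤ 1 / bracket x ^ 2 * bracket x := by
        gcongr
        · exact abs_two_mul_deriv_sub_one_le hh _
        · exact norm_le_bracket x
    _ = _ := by field_simp

theorem norm_fderiv_gradient_logFactor_le (hh : IsProfile h) (x : Euc m) :
    ‖fderiv ℝ (gradient (logFactor h)) x‖ ≤ 4 / bracket x ^ 2 := by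
  rw [(hasFDerivAt_gradient_logFactor hh x).fderiv]
  have hb := bracket_pos x
  have h1 := abs_two_mul_deriv_sub_one_le hh (logBracket x)
  have h2 := hh.abs_deriv_deriv_le (logBracket x)
  refine (norm_add_le _ _).trans ?_
  have b1 : ‖((2 * deriv h (logBracket x) - 1) / bracket x ^ 2) •
      ContinuousLinearMap.id ℝ (Euc m)‖ ≤ 1 / bracket x ^ 2 := by
    rw [norm_smul, Real.norm_eq_abs, abs_div, abs_of_pos (pow_pos hb 2)]
    calc _ ≤ 1 / bracket x ^ 2 * 1 := by
          gcongr
          exact ContinuousLinearMap.norm_id_le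
      _ = _ := mul_one _
  have b2 : ‖(((2 * (2 * deriv (deriv h) (logBracket x) - (2 * deriv h (logBracket x) - 1)) /
          bracket x ^ 4) • innerSL ℝ x).smulRight x)‖ ≤ 3 / bracket x ^ 2 := by
    rw [ContinuousLinearMap.norm_smulRight_apply, norm_smul, innerSL_apply_norm, Real.norm_eq_abs,
      abs_div, abs_of_pos (pow_pos hb 4)]
    have h3 : |2 * (2 * deriv (deriv h) (logBracket x) - (2 * deriv h (logBracket x) - 1))| ≤ 3 := by
      rw [abs_le] at h1 h2 ⊢
      constructor <;> linarith
    calc _ ≤ 3 / bracket x ^ 4 * bracket x * bracket x := by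
          gcongr
          · exact norm_le_bracket x
          · exact norm_le_bracket x
      _ = _ := by field_simp
  calc _ ≤ 1 / bracket x ^ 2 + 3 / bracket x ^ 2 := add_le_add b1 b2
    _ = _ := by ring

/-- Holds because `F ≥ 1`. It turns bounds by powers of `1 / bracket x` into bounds at the scale of
the metric. -/
theorem one_div_bracket_le (hh : IsProfile h) (x : Euc m) : 1 / bracket x ≤ Real.exp
    (logFactor h x) := by
  rw [exp_logFactor]
  have := bracket_pos x
  gcongr
  exact one_le_radius hh x

/-- The scale `e^{-ψ(x)}` is at most `bracket x`, so moving by half of it decreases `bracket` at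
most by a factor 2. The constant is `16 = 4 · 2²`, from the second derivative. -/
theorem isTame_logFactor (hh : IsProfile h) : IsTame (logFactor (m := m) h) (1 / 2) 16 := by
  intro x y hxy
  have hx := bracket_pos x
  have h1 : bracket x ≤ 2 * bracket y := by
    have h2 : Real.exp (-logFactor h x) ≤ bracket x := by
      rw [Real.exp_neg, inv_le_comm₀ (Real.exp_pos _) hx, ← one_div]
      exact one_div_bracket_le hh x
    have h3 := bracket_le_add x y
    rw [norm_sub_rev] at h3
    linarith
  have h2 : 1 / bracket y ≤ 2 * Real.exp (logFactor h x) := by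
    refine le_trans ?_ (mul_le_mul_of_nonneg_left (one_div_bracket_le hh x) zero_le_two)
    rw [mul_one_div, div_le_div_iff₀ (bracket_pos y) hx]
    linarith
  have hE := Real.exp_pos (logFactor h x)
  constructor
  · refine (norm_gradient_logFactor_le hh y).trans ?_
    linarith
  · refine (norm_fderiv_gradient_logFactor_le hh y).trans ?_
    calc 4 / bracket y ^ 2 = 4 * (1 / bracket y) ^ 2 := by ring
      _ ≤ 4 * (2 * Real.exp (logFactor h x)) ^ 2 := by
        have := bracket_pos y
        gcongr
      _ = _ := by ring

/-- The metric with growth profile `h`. -/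
def profileMetric (m : ℕ) {h : ℝ → ℝ} (hh : IsProfile h) : SmoothMetric m :=
  conformalMetric (logFactor h) (contDiff_logFactor hh)

/-- The curvature coefficients are `O(1 / bracket x ^ 2)`, while `e^{-2ψ} = bracket x ^ 2 / F²` with
`F ≥ 1`, so the product is bounded. -/
theorem hasBoundedGeometry_profileMetric (hh : IsProfile h) : HasBoundedGeometry
    (profileMetric m hh) := by
  refine ⟨exists_expIsDiffeoOnBall_conformal (by norm_num) (by norm_num) (isTame_logFactor hh),
    m ^ 4 * (24 + 18 * m), fun x u v w z ↦ ?_⟩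
  have hb := bracket_pos x
  have hR := abs_riemannCoeff_conformal_le (hψ := contDiff_logFactor hh) (x := x)
    (β := 1 / bracket x) (β' := 4 / bracket x ^ 2)
    (fun i ↦ by
      rw [← gradient_apply]
      exact (abs_coord_le_norm _ _).trans (norm_gradient_logFactor_le hh x))
    (fun i j ↦ by
      rw [partialDeriv_partialDeriv_eq (contDiff_logFactor hh)]
      refine (abs_coord_le_norm _ _).trans ((ContinuousLinearMap.le_opNorm _ _).trans ?_)
      simpa using norm_fderiv_gradient_logFactor_le hh x)
  have h1 := abs_curvature_conformal_le hR (by positivity) u v w z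
  refine h1.trans ?_
  have h2 : (6 * (4 / bracket x ^ 2) + 18 * m * (1 / bracket x) ^ 2) *
      Real.exp (-(2 * logFactor h x)) ≤ 24 + 18 * m := by
    have e1 : Real.exp (-(2 * logFactor h x)) = bracket x ^ 2 / radius h x ^ 2 := by
      rw [Real.exp_neg, two_mul, Real.exp_add, exp_logFactor]
      field_simp
    have e2 : 1 / radius h x ^ 2 ≤ 1 := by
      rw [div_le_one (pow_pos (radius_pos h x) 2)]
      exact one_le_pow₀ (one_le_radius hh x)
    have e3 : (6 * (4 / bracket x ^ 2) + 18 * m * (1 / bracket x) ^ 2) *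
        (bracket x ^ 2 / radius h x ^ 2) = (24 + 18 * m) * (1 / radius h x ^ 2) := by
      field_simp
      ring
    rw [e1, e3]
    exact mul_le_of_le_one_right (by positivity) e2
  have hn : ∀ v, 0 ≤ metricNorm (profileMetric m hh) x v := fun v ↦ Real.sqrt_nonneg _
  have := hn u
  have := hn v
  have := hn w
  have := hn z
  unfold profileMetric at *
  gcongr

/-- With `s = |x|²`, the curvature is `e^{-2h}` times a quotient over `1 + s`. The coefficient of
`s` contains `(m - 2)(1 - 4h'²) - 8h''`, which is at least `1/2` since `m ≥ 3` and `h'`, `h''` are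
small; the constant term handles the region near the origin. -/
theorem exp_neg_le_scalarCurvature (hh : IsProfile h) (hm : 3 ≤ m) (x : Euc m) :
    Real.exp (-(2 * h (logBracket x))) ≤ scalarCurvature (profileMetric m hh) x := by
  rw [profileMetric, scalarCurvature_conformal]
  set d := deriv h (logBracket x) with hd
  set d' := deriv (deriv h) (logBracket x) with hd'
  set s := ‖x‖ ^ 2 with hs
  have hs0 : 0 ≤ s := sq_nonneg _
  have hb : bracket x ^ 2 = 1 + s := bracket_sq x
  have h3 : s = ∑ i, x i * x i := by
    rw [hs, EuclideanSpace.norm_sq_eq]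
    simp [sq]
  have e1 : ∑ i, partialDeriv i (logFactor h) x ^ 2 = ((2 * d - 1) / (1 + s)) ^ 2 * s := by
    rw [h3, Finset.mul_sum]
    refine Finset.sum_congr rfl fun i _ ↦ ?_
    rw [← h3, ← gradient_apply, gradient_logFactor hh, PiLp.smul_apply, smul_eq_mul, hb]
    ring
  have e2 : ∑ i, partialDeriv i (partialDeriv i (logFactor h)) x =
      m * ((2 * d - 1) / (1 + s)) + 2 * (2 * d' - (2 * d - 1)) / (1 + s) ^ 2 * s := by
    have : ∀ i, partialDeriv i (partialDeriv i (logFactor h)) x =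
        (2 * d - 1) / (1 + s) + 2 * (2 * d' - (2 * d - 1)) / (1 + s) ^ 2 * (x i * x i) := by
      intro i
      rw [partialDeriv_partialDeriv_eq (contDiff_logFactor hh),
        (hasFDerivAt_gradient_logFactor hh x).fderiv]
      have hb4 : bracket x ^ 4 = (1 + s) ^ 2 := by rw [← hb]; ring
      simp only [add_apply, smul_apply,
        ContinuousLinearMap.smulRight_apply, ContinuousLinearMap.id_apply, PiLp.add_apply,
        PiLp.smul_apply, smul_eq_mul, innerSL_apply_apply, EuclideanSpace.inner_single_right,
        PiLp.single_apply, hb, hb4, ← hd, ← hd']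
      simp
      ring
    simp only [this, Finset.sum_add_distrib, ← Finset.mul_sum, ← h3]
    simp
  rw [e1, e2]
  have e3 : Real.exp (-(2 * logFactor h x)) =
      Real.exp (-(2 * h (logBracket x))) * (1 + s) := by
    have : -(2 * logFactor h x) = -(2 * h (logBracket x)) + logBracket x := by
      rw [logFactor]; ring
    rw [this, Real.exp_add, logBracket, Real.exp_log (by positivity)]
  rw [e3]
  have hE := Real.exp_pos (-(2 * h (logBracket x)))
  have hm' : (3 : ℝ) ≤ m := by exact_mod_cast hm
  have d0 : 0 ≤ d := hh.deriv_nonneg _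
  have d1 : d ≤ 1 / 32 := hh.deriv_le _
  have d2 := abs_le.1 (hh.abs_deriv_deriv_le (logBracket x))
  rw [← hd'] at d2
  have key : -(Real.exp (-(2 * h (logBracket x))) * (1 + s)) *
      (2 * (m - 1) * (m * ((2 * d - 1) / (1 + s)) +
        2 * (2 * d' - (2 * d - 1)) / (1 + s) ^ 2 * s) +
          (m - 1) * (m - 2) * (((2 * d - 1) / (1 + s)) ^ 2 * s)) =
      Real.exp (-(2 * h (logBracket x))) * ((m - 1) * (2 * m * (1 - 2 * d) +
        s * ((m - 2) * (1 - 2 * d) * (1 + 2 * d) - 8 * d')) / (1 + s)) := by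
    have : 1 + s ≠ 0 := by positivity
    field_simp
    ring
  rw [key]
  refine le_mul_of_one_le_right hE.le ?_
  rw [one_le_div (by positivity)]
  have k1 : (1 : ℝ) / 2 ≤ (m - 2) * (1 - 2 * d) * (1 + 2 * d) - 8 * d' := by
    have : (3 : ℝ) / 4 ≤ (1 - 2 * d) * (1 + 2 * d) := by nlinarith
    nlinarith
  have k2 : (1 : ℝ) ≤ 2 * m * (1 - 2 * d) := by nlinarith
  have k3 : (1 + s) / 2 ≤ 2 * m * (1 - 2 * d) +
      s * ((m - 2) * (1 - 2 * d) * (1 + 2 * d) - 8 * d') := by nlinarith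
  nlinarith

end Geometry

end

section

/-! ### Lipschitz functions for the profile metric -/

section Coordinates

/-- The radial coordinate `½ ∫₀ᵗ e^h` as a function of `t = log (1 + |x|²)`. -/
def radialPrimitive (h : ℝ → ℝ) (t : ℝ) : ℝ := ∫ τ in (0 : ℝ)..t, Real.exp (h τ) / 2

/-- The radial coordinate. -/
def radialCoord {m : ℕ} (h : ℝ → ℝ) (x : Euc m) : ℝ := radialPrimitive h (logBracket x)

/-- The vector `v / √(A + |v|²)`. -/
def squash {m : ℕ} (A : ℝ) (v : Euc m) : Euc m := (Real.sqrt (A + ‖v‖ ^ 2))⁻¹ • v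

/-- The position relative to `c`, normalized by the radius of the cross sections. -/
def sphereCoord {m : ℕ} (h : ℝ → ℝ) (c x : Euc m) : Euc m :=
  radius h x • squash (1 + ‖c‖ ^ 2) (x - c)

variable {m : ℕ}

theorem hasFDerivAt_squash {A : ℝ} (hA : 0 < A) (v : Euc m) :
    HasFDerivAt (squash A) ((Real.sqrt (A + ‖v‖ ^ 2))⁻¹ • ContinuousLinearMap.id ℝ (Euc m)
      - (((Real.sqrt (A + ‖v‖ ^ 2))⁻¹ ^ 3) • innerSL ℝ v).smulRight v) v := by
  have h1 : HasFDerivAt (fun v : Euc m ↦ A + ‖v‖ ^ 2) (2 • innerSL ℝ v) v :=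
    ((hasStrictFDerivAt_norm_sq v).hasFDerivAt).const_add A
  have h2 := h1.sqrt (by positivity)
  have hp : 0 < Real.sqrt (A + ‖v‖ ^ 2) := Real.sqrt_pos.2 (by positivity)
  have h3 := ((hasDerivAt_inv hp.ne').comp_hasFDerivAt v h2).smul (hasFDerivAt_id v)
  refine h3.congr_fderiv ?_
  ext w
  simp
  field_simp
  ring

theorem norm_squash_le {A : ℝ} (hA : 0 < A) (v : Euc m) : ‖squash A v‖ ≤ 1 := by
  have hp : 0 < Real.sqrt (A + ‖v‖ ^ 2) := Real.sqrt_pos.2 (by positivity)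
  rw [squash, norm_smul, Real.norm_of_nonneg (by positivity), inv_mul_le_iff₀ hp, mul_one]
  exact Real.le_sqrt_of_sq_le (by linarith)

theorem norm_fderiv_squash_le {A : ℝ} (hA : 0 < A) (v : Euc m) :
    ‖fderiv ℝ (squash A) v‖ ≤ 2 * (Real.sqrt (A + ‖v‖ ^ 2))⁻¹ := by
  have hp : 0 < Real.sqrt (A + ‖v‖ ^ 2) := Real.sqrt_pos.2 (by positivity)
  have hv : ‖v‖ ≤ Real.sqrt (A + ‖v‖ ^ 2) := Real.le_sqrt_of_sq_le (by linarith)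
  rw [(hasFDerivAt_squash hA v).fderiv]
  refine (norm_sub_le _ _).trans ?_
  rw [ContinuousLinearMap.norm_smulRight_apply, norm_smul, norm_smul, innerSL_apply_norm,
    Real.norm_of_nonneg (by positivity), Real.norm_of_nonneg (by positivity)]
  set r := Real.sqrt (A + ‖v‖ ^ 2)
  calc _ ≤ r⁻¹ * 1 + r⁻¹ ^ 3 * r * r := by
        gcongr
        exact ContinuousLinearMap.norm_id_le
    _ = _ := by
      field_simp
      ring

theorem contDiff_squash {A : ℝ} (hA : 0 < A) : ContDiff ℝ ∞ (squash (m := m) A) := by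
  unfold squash
  refine ContDiff.smul (ContDiff.inv (ContDiff.sqrt (contDiff_const.add (contDiff_norm_sq ℝ))
    fun v ↦ by positivity) fun v ↦ (Real.sqrt_pos.2 (by positivity)).ne') contDiff_id

theorem norm_smul_innerSL_le (x : Euc m) : ‖(2 / bracket x ^ 2) • innerSL ℝ x‖ ≤ 2 / bracket x := by
  have hb := bracket_pos x
  rw [norm_smul, innerSL_apply_norm, Real.norm_of_nonneg (by positivity)]
  calc _ ≤ 2 / bracket x ^ 2 * bracket x := by
        gcongr
        exact norm_le_bracket x
    _ = _ := by field_simp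

variable {h : ℝ → ℝ}

theorem hasDerivAt_radialPrimitive (hh : IsProfile h) (t : ℝ) :
    HasDerivAt (radialPrimitive h) (Real.exp (h t) / 2) t := by
  have hc : Continuous fun τ ↦ Real.exp (h τ) / 2 := by
    have := hh.contDiff.continuous
    fun_prop
  exact (hc.integral_hasStrictDerivAt 0 t).hasDerivAt

theorem hasFDerivAt_radius (hh : IsProfile h) (x : Euc m) : HasFDerivAt (radius h)
    ((radius h x * deriv h (logBracket x)) • (2 / bracket x ^ 2) • innerSL ℝ x) x := by
  have := ((hh.hasDerivAt (logBracket x)).comp_hasFDerivAt x (hasFDerivAt_logBracket x)).exp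
  rw [mul_smul]
  exact this

theorem contDiff_radius (hh : IsProfile h) : ContDiff ℝ ∞ (radius (m := m) h) :=
  (hh.contDiff.comp contDiff_logBracket).exp

theorem norm_fderiv_radius_le (hh : IsProfile h) (x : Euc m) :
    ‖fderiv ℝ (radius h) x‖ ≤ 1 / 16 * (radius h x / bracket x) := by
  rw [(hasFDerivAt_radius hh x).fderiv, norm_smul, norm_mul,
    Real.norm_of_nonneg (radius_pos h x).le, Real.norm_of_nonneg (hh.deriv_nonneg _)]
  have hb := bracket_pos x
  have hr := radius_pos h x
  calc _ ≤ radius h x * (1 / 32) * (2 / bracket x) := by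
        gcongr
        · exact hh.deriv_le _
        · exact norm_smul_innerSL_le x
    _ = _ := by ring

theorem abs_logBracket_sub_le (hh : IsProfile h) (x y : Euc m) :
    |logBracket x - logBracket y| ≤ 2 * rdist (profileMetric m hh) x y := by
  refine norm_sub_le_rdist_conformal (contDiff_logBracket.of_le (by simp)) zero_le_two
    (fun x ↦ ?_) x y
  rw [(hasFDerivAt_logBracket x).fderiv]
  refine (norm_smul_innerSL_le x).trans ?_
  rw [← mul_one_div]
  gcongr
  exact one_div_bracket_le hh x

/-- The small Lipschitz constant comes from `h' ≤ 1/32`: over a distance small compared with `F`,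
the radius of the cross section hardly changes. -/
theorem abs_radius_sub_le (hh : IsProfile h) (x y : Euc m) :
    |radius h x - radius h y| ≤ 1 / 16 * rdist (profileMetric m hh) x y := by
  refine norm_sub_le_rdist_conformal ((contDiff_radius hh).of_le (by simp)) (by norm_num)
    (fun x ↦ ?_) x y
  rw [exp_logFactor]
  exact norm_fderiv_radius_le hh x

theorem abs_radialCoord_sub_le (hh : IsProfile h) (x y : Euc m) :
    |radialCoord h x - radialCoord h y| ≤ rdist (profileMetric m hh) x y := by
  have hd : ∀ x : Euc m, HasFDerivAt (radialCoord h)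
      ((radius h x / 2) • (2 / bracket x ^ 2) • innerSL ℝ x) x := fun x ↦
    (hasDerivAt_radialPrimitive hh (logBracket x)).comp_hasFDerivAt x (hasFDerivAt_logBracket x)
  have hc : ContDiff ℝ 1 (radialCoord (m := m) h) := by
    have h1 : ContDiff ℝ 1 (radialPrimitive h) := by
      rw [contDiff_one_iff_deriv]
      refine ⟨fun t ↦ (hasDerivAt_radialPrimitive hh t).differentiableAt, ?_⟩
      rw [show deriv (radialPrimitive h) = _ from
        funext fun t ↦ (hasDerivAt_radialPrimitive hh t).deriv]
      have := hh.contDiff.continuous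
      fun_prop
    exact h1.comp (contDiff_logBracket.of_le (by simp))
  rw [← one_mul (rdist _ _ _)]
  refine norm_sub_le_rdist_conformal hc zero_le_one (fun x ↦ ?_) x y
  rw [(hd x).fderiv, norm_smul, one_mul, exp_logFactor,
    Real.norm_of_nonneg (by have := radius_pos h x; positivity)]
  have hb := bracket_pos x
  have hr := radius_pos h x
  calc _ ≤ radius h x / 2 * (2 / bracket x) := by
        gcongr
        exact norm_smul_innerSL_le x
    _ = _ := by ring

/-- The constant is uniform in `c`. The centre `c = 0` gives the spherical coordinate used for the
asymptotic dimension; the centre `c = x` gives a function that vanishes at `x` and detects angular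
displacement from it. -/
theorem norm_sphereCoord_sub_le (hh : IsProfile h) (c x y : Euc m) :
    ‖sphereCoord h c x - sphereCoord h c y‖ ≤ 4 * rdist (profileMetric m hh) x y := by
  have hA : 0 < 1 + ‖c‖ ^ 2 := by positivity
  have hs : ContDiff ℝ ∞ (fun x ↦ squash (1 + ‖c‖ ^ 2) (x - c)) :=
    (contDiff_squash hA).comp (contDiff_id.sub contDiff_const)
  refine norm_sub_le_rdist_conformal (((contDiff_radius hh).smul hs).of_le (by simp)) (by norm_num)
    (fun x ↦ ?_) x y
  have hd1 : HasFDerivAt (fun x ↦ squash (1 + ‖c‖ ^ 2) (x - c))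
      (fderiv ℝ (squash (1 + ‖c‖ ^ 2)) (x - c)) x := by
    have h1 := ((contDiff_squash hA).differentiable (by simp) (x - c)).hasFDerivAt
    have h2 := h1.comp x ((hasFDerivAt_id x).sub_const c)
    exact h2
  have hd2 := ((contDiff_radius hh).differentiable (by simp) x).hasFDerivAt.smul hd1
  have hb := bracket_pos x
  have hr := radius_pos h x
  -- Since `‖x‖² ≤ 2‖c‖² + 2‖x - c‖²`, the root dominates a fixed multiple of `bracket x`, whatever
  -- `c` is.
  have hD : (Real.sqrt (1 + ‖c‖ ^ 2 + ‖x - c‖ ^ 2))⁻¹ ≤ 3 / 2 / bracket x := by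
    have hp : 0 < Real.sqrt (1 + ‖c‖ ^ 2 + ‖x - c‖ ^ 2) := Real.sqrt_pos.2 (by positivity)
    rw [inv_eq_one_div, div_le_div_iff₀ hp hb, one_mul]
    refine Real.sqrt_le_iff.2 ⟨by positivity, ?_⟩
    rw [mul_pow, Real.sq_sqrt (by positivity)]
    have h1 : ‖x‖ ≤ ‖c‖ + ‖x - c‖ := by
      calc ‖x‖ = ‖c + (x - c)‖ := by rw [add_sub_cancel]
        _ ≤ _ := norm_add_le _ _
    nlinarith [sq_nonneg (‖c‖ - ‖x - c‖), norm_nonneg x, norm_nonneg c, norm_nonneg (x - c)]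
  rw [show fderiv ℝ (radius h • fun x ↦ squash (1 + ‖c‖ ^ 2) (x - c)) x = _ from hd2.fderiv]
  refine (norm_add_le _ _).trans ?_
  rw [norm_smul, ContinuousLinearMap.norm_smulRight_apply, Real.norm_of_nonneg hr.le,
    exp_logFactor]
  calc _ ≤ radius h x * (2 * (3 / 2 / bracket x)) + 1 / 16 * (radius h x / bracket x) * 1 := by
        gcongr
        · exact (norm_fderiv_squash_le hA _).trans (by gcongr)
        · exact norm_fderiv_radius_le hh x
        · exact norm_squash_le hA _
    _ = (3 + 1 / 16) * (radius h x / bracket x) := by ring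
    _ ≤ _ := by
      gcongr
      norm_num

end Coordinates

end

section

/-! ### Upper bounds for the distance by explicit paths -/

section UpperBounds

variable {m : ℕ}

theorem radius_le_of_norm_le {h : ℝ → ℝ} (hh : IsProfile h) {x y : Euc m} (hxy : ‖x‖ ≤ ‖y‖) :
    radius h x ≤ radius h y :=
  Real.exp_le_exp.2 (hh.monotone (logBracket_le_of_norm_le hxy))

theorem logBracket_eq_of_norm_eq {x y : Euc m} (hxy : ‖x‖ = ‖y‖) : logBracket x = logBracket y := by
  rw [logBracket, logBracket, hxy]

theorem bracket_eq_of_norm_eq {x y : Euc m} (hxy : ‖x‖ = ‖y‖) : bracket x = bracket y := by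
  rw [bracket, bracket, hxy]

theorem radius_eq_of_norm_eq (h : ℝ → ℝ) {x y : Euc m} (hxy : ‖x‖ = ‖y‖) :
    radius h x = radius h y := by
  rw [radius, radius, logBracket_eq_of_norm_eq hxy]

theorem radialCoord_eq_of_norm_eq (h : ℝ → ℝ) {x y : Euc m} (hxy : ‖x‖ = ‖y‖) :
    radialCoord h x = radialCoord h y := by
  rw [radialCoord, radialCoord, logBracket_eq_of_norm_eq hxy]

theorem sphereCoord_zero (h : ℝ → ℝ) (x : Euc m) :
    sphereCoord h 0 x = (radius h x / bracket x) • x := by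
  simp [sphereCoord, squash, bracket, smul_smul, div_eq_mul_inv]

theorem norm_sphereCoord_zero (h : ℝ → ℝ) (x : Euc m) :
    ‖sphereCoord h 0 x‖ = radius h x / bracket x * ‖x‖ := by
  rw [sphereCoord_zero, norm_smul, Real.norm_of_nonneg
    (div_nonneg (radius_pos h x).le (bracket_pos x).le)]

theorem norm_sphereCoord_zero_sub (h : ℝ → ℝ) {x y : Euc m} (hxy : ‖x‖ = ‖y‖) :
    ‖sphereCoord h 0 x - sphereCoord h 0 y‖ = radius h y / bracket y * ‖y - x‖ := by
  rw [sphereCoord_zero, sphereCoord_zero, radius_eq_of_norm_eq h hxy, bracket_eq_of_norm_eq hxy,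
    ← smul_sub, norm_smul, Real.norm_of_nonneg (div_nonneg (radius_pos h y).le (bracket_pos y).le),
    norm_sub_rev]

theorem exists_orthogonal_pair {m : ℕ} (hm : 3 ≤ m) (x y : Euc m) {r : ℝ} (hr : 0 ≤ r) :
    ∃ z : Euc m, ‖z‖ = r ∧ inner ℝ x z = 0 ∧ inner ℝ z y = 0 := by
  have hlt : Submodule.span ℝ {x, y} ≠ ⊤ := by
    intro htop
    have h1 := finrank_span_finset_le_card (R := ℝ) ({x, y} : Finset (Euc m))
    have h2 : ({x, y} : Finset (Euc m)).card ≤ 2 := Finset.card_le_two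
    rw [Finset.coe_insert, Finset.coe_singleton, Set.finrank, htop, finrank_top,
      finrank_euclideanSpace_fin] at h1
    omega
  have hne : (Submodule.span ℝ {x, y})ᗮ ≠ ⊥ := by
    rwa [Ne, Submodule.orthogonal_eq_bot_iff]
  obtain ⟨v, hv, hv0⟩ := Submodule.exists_mem_ne_zero_of_ne_bot hne
  have hx : inner ℝ x v = 0 := (Submodule.mem_orthogonal _ _).1 hv x
    (Submodule.subset_span (by simp))
  have hy : inner ℝ y v = 0 := (Submodule.mem_orthogonal _ _).1 hv y
    (Submodule.subset_span (by simp))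
  refine ⟨(r / ‖v‖) • v, ?_, ?_, ?_⟩
  · rw [norm_smul, Real.norm_of_nonneg (by positivity), div_mul_cancel₀ _ (norm_ne_zero_iff.2 hv0)]
  · rw [inner_smul_right, hx, mul_zero]
  · rw [real_inner_comm, inner_smul_right, hy, mul_zero]

variable {h : ℝ → ℝ}

theorem rdist_le_of_segment (hh : IsProfile h) {x y : Euc m} {M : ℝ}
    (hM : ∀ t ∈ Icc (0 : ℝ) 1, radius h (x + t • (y - x)) / bracket (x + t • (y - x)) ≤ M) :
    rdist (profileMetric m hh) x y ≤ M * ‖y - x‖ := by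
  have hd : ∀ t : ℝ, HasDerivAt (fun t : ℝ ↦ x + t • (y - x)) (y - x) t := fun t ↦ by
    simpa using ((hasDerivAt_id t).smul_const (y - x)).const_add x
  have := rdist_conformal_le (ψ := logFactor h) (hψ := contDiff_logFactor hh)
    (γ := fun t : ℝ ↦ x + t • (y - x)) (σ := fun t ↦ M * ‖y - x‖ * t)
    (σ' := fun t ↦ M * ‖y - x‖) zero_le_one
    (ContDiff.contDiffOn (by fun_prop))
    (fun t _ ↦ by simpa using (hasDerivAt_id t).const_mul (M * ‖y - x‖))
    (fun t ht ↦ by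
      rw [(hd t).deriv, exp_logFactor]
      gcongr
      exact hM t ht) continuousOn_const
  simpa [profileMetric] using this

/-- On a ray the length element is `F / bracket`, while the radial coordinate has derivative `F r /
bracket²`. These are comparable only away from the origin: for `r ≥ 1` one has `bracket ≤ 2r`. -/
theorem rdist_radial_le (hh : IsProfile h) {e : Euc m} (he : ‖e‖ = 1) {a b : ℝ} (ha : 1 ≤ a)
    (hab : a ≤ b) :
    rdist (profileMetric m hh) (a • e) (b • e) ≤
      2 * (radialCoord h (b • e) - radialCoord h (a • e)) := by
  have hlog : ∀ t : ℝ, logBracket (t • e) = Real.log (1 + t ^ 2) := by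
    intro t
    rw [logBracket, norm_smul, he, mul_one, Real.norm_eq_abs, sq_abs]
  have hd : ∀ t : ℝ, HasDerivAt (fun t : ℝ ↦ t • e) e t := fun t ↦ by
    simpa using (hasDerivAt_id t).smul_const e
  have hl : ∀ t : ℝ, HasDerivAt (fun t : ℝ ↦ Real.log (1 + t ^ 2)) (2 * t / (1 + t ^ 2)) t := by
    intro t
    have h1 : HasDerivAt (fun t : ℝ ↦ 1 + t ^ 2) (2 * t) t := by
      simpa using (hasDerivAt_pow 2 t).const_add 1
    exact h1.log (by positivity)
  have hσ : ∀ t : ℝ, HasDerivAt (fun t ↦ 2 * radialCoord h (t • e))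
      (2 * (Real.exp (h (Real.log (1 + t ^ 2))) / 2 * (2 * t / (1 + t ^ 2)))) t := by
    intro t
    have h2 := ((hasDerivAt_radialPrimitive hh (Real.log (1 + t ^ 2))).comp t (hl t)).const_mul 2
    have e1 : (fun t ↦ 2 * radialCoord h (t • e)) =
        fun t ↦ 2 * (radialPrimitive h ∘ fun t ↦ Real.log (1 + t ^ 2)) t := by
      ext t
      rw [radialCoord, hlog]
      rfl
    rw [e1]
    exact h2
  have := rdist_conformal_le (ψ := logFactor h) (hψ := contDiff_logFactor hh)
    (γ := fun t : ℝ ↦ t • e) (σ := fun t ↦ 2 * radialCoord h (t • e)) hab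
    (ContDiff.contDiffOn (by fun_prop)) (fun t _ ↦ hσ t) (fun t ht ↦ by
      have ht1 : 1 ≤ t := ha.trans ht.1
      have hb := bracket_pos (t • e)
      rw [(hd t).deriv, he, mul_one, exp_logFactor, radius, hlog]
      have h1 : bracket (t • e) ^ 2 = 1 + t ^ 2 := by
        rw [bracket_sq, norm_smul, he, mul_one, Real.norm_eq_abs, sq_abs]
      rw [← h1]
      have h2 : bracket (t • e) ≤ 2 * t := by
        refine Real.sqrt_le_iff.2 ⟨by linarith, ?_⟩
        rw [norm_smul, he, mul_one, Real.norm_eq_abs, sq_abs]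
        nlinarith
      calc _ ≤ Real.exp (h (Real.log (bracket (t • e) ^ 2))) * (2 * t / bracket (t • e) ^ 2) := by
            rw [div_eq_mul_inv]
            gcongr
            rw [inv_eq_one_div, div_le_div_iff₀ hb (by positivity)]
            nlinarith
        _ = _ := by ring)
    (Continuous.continuousOn (by
      have hc := hh.contDiff.continuous
      have hlc : Continuous fun t : ℝ ↦ Real.log (1 + t ^ 2) :=
        continuous_iff_continuousAt.2 fun t ↦ (hl t).continuousAt
      have hdc : Continuous fun t : ℝ ↦ 2 * t / (1 + t ^ 2) :=
        Continuous.div (by fun_prop) (by fun_prop) fun t ↦ by positivity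
      fun_prop))
  simpa [mul_sub, profileMetric] using this

/-- If the angle is not obtuse, the chord stays outside radius `‖y‖ / √2`, so along it `bracket`
drops at most by the factor `3/2 ≥ √2`, while `F` is largest at the ends. -/
theorem rdist_le_of_inner_nonneg (hh : IsProfile h) {x y : Euc m} (hxy : ‖x‖ = ‖y‖)
    (hi : 0 ≤ inner ℝ x y) :
    rdist (profileMetric m hh) x y ≤ 3 / 2 * (radius h y / bracket y) * ‖y - x‖ := by
  refine rdist_le_of_segment hh fun t ht ↦ ?_
  set z := x + t • (y - x) with hz
  have hz' : z = (1 - t) • x + t • y := by rw [hz]; module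
  have hn : ‖z‖ ^ 2 = (1 - t) ^ 2 * ‖y‖ ^ 2 + 2 * ((1 - t) * t * inner ℝ x y) + t ^ 2 * ‖y‖ ^ 2 := by
    rw [hz', norm_add_sq_real, norm_smul, norm_smul, inner_smul_left, inner_smul_right, mul_pow,
      mul_pow, hxy, Real.norm_eq_abs, Real.norm_eq_abs, sq_abs, sq_abs]
    simp only [conj_trivial]
    ring
  have ht0 := ht.1
  have ht1 : 0 ≤ 1 - t := by linarith [ht.2]
  have hlow : ‖y‖ ^ 2 / 2 ≤ ‖z‖ ^ 2 := by
    have : 0 ≤ (1 - t) * t * inner ℝ x y := by positivity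
    nlinarith [sq_nonneg ‖y‖, mul_nonneg (sq_nonneg (2 * t - 1)) (sq_nonneg ‖y‖)]
  have hup : ‖z‖ ≤ ‖y‖ := by
    rw [hz']
    refine (norm_add_le _ _).trans ?_
    rw [norm_smul, norm_smul, Real.norm_of_nonneg ht1, Real.norm_of_nonneg ht0, hxy]
    apply le_of_eq
    ring
  have hby := bracket_pos y
  have hbz := bracket_pos z
  have hb : bracket y ≤ 3 / 2 * bracket z := by
    have h1 := bracket_sq y
    have h2 := bracket_sq z
    nlinarith
  have hr := radius_le_of_norm_le hh hup
  have hry := radius_pos h y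
  rw [mul_div_assoc', div_le_div_iff₀ hbz hby]
  calc _ ≤ radius h y * (3 / 2 * bracket z) := by gcongr
    _ = _ := by ring

/-- A chord with an obtuse angle may pass near the origin, where the conformal factor is large. A
detour through a vector `z` orthogonal to both ends, which exists as `m ≥ 3`, uses two chords of
right angle, neither longer than `‖y - x‖`. -/
theorem rdist_le_of_norm_eq (hh : IsProfile h) (hm : 3 ≤ m) {x y : Euc m} (hxy : ‖x‖ = ‖y‖) :
    rdist (profileMetric m hh) x y ≤ 3 * ‖sphereCoord h 0 x - sphereCoord h 0 y‖ := by
  rw [norm_sphereCoord_zero_sub h hxy]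
  have hc : 0 < radius h y / bracket y := div_pos (radius_pos h y) (bracket_pos y)
  rcases le_or_gt 0 (inner ℝ x y : ℝ) with hi | hi
  · refine (rdist_le_of_inner_nonneg hh hxy hi).trans ?_
    have : 0 ≤ radius h y / bracket y * ‖y - x‖ := by positivity
    linarith
  · obtain ⟨z, hz, hxz, hzy⟩ := exists_orthogonal_pair hm x y (norm_nonneg y)
    have h1 := rdist_le_of_inner_nonneg hh (hxy.trans hz.symm) hxz.ge
    have h2 := rdist_le_of_inner_nonneg hh hz hzy.ge
    rw [radius_eq_of_norm_eq h hz, bracket_eq_of_norm_eq hz] at h1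
    have n1 : ‖z - x‖ ≤ ‖y - x‖ := by
      rw [← sq_le_sq₀ (norm_nonneg _) (norm_nonneg _), norm_sub_sq_real, norm_sub_sq_real,
        real_inner_comm, hxz, real_inner_comm, hz]
      linarith
    have n2 : ‖y - z‖ ≤ ‖y - x‖ := by
      rw [← sq_le_sq₀ (norm_nonneg _) (norm_nonneg _), norm_sub_sq_real, norm_sub_sq_real,
        real_inner_comm, hzy, real_inner_comm, hz, hxy]
      linarith
    refine (rdist_triangle _ x z y).trans ?_
    calc _ ≤ 3 / 2 * (radius h y / bracket y) * ‖y - x‖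
          + 3 / 2 * (radius h y / bracket y) * ‖y - x‖ := by
          refine add_le_add (h1.trans ?_) (h2.trans ?_) <;> gcongr
      _ = _ := by ring

/-- The path runs radially from `x` to the point `z` on the sphere through `y`, then near that
sphere. The spherical coordinates of `x` and `z` are parallel, so they differ only by the difference
of the norms, whence the factor `3 · 2`. -/
theorem rdist_le_of_one_le_norm (hh : IsProfile h) (hm : 3 ≤ m) {x y : Euc m} (hx : 1 ≤ ‖x‖)
    (hy : 1 ≤ ‖y‖) :
    rdist (profileMetric m hh) x y ≤ 2 * |radialCoord h x - radialCoord h y|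
      + 6 * ‖sphereCoord h 0 x - sphereCoord h 0 y‖ := by
  have hx0 : ‖x‖ ≠ 0 := by linarith
  set e := ‖x‖⁻¹ • x with he
  have he1 : ‖e‖ = 1 := by
    rw [he, norm_smul, Real.norm_of_nonneg (by positivity), inv_mul_cancel₀ hx0]
  have hxe : x = ‖x‖ • e := by rw [he, smul_smul, mul_inv_cancel₀ hx0, one_smul]
  set z := ‖y‖ • e with hz
  have hzn : ‖z‖ = ‖y‖ := by rw [hz, norm_smul, he1, mul_one, norm_norm]
  have h1 : rdist (profileMetric m hh) x z ≤ 2 * |radialCoord h x - radialCoord h y| := by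
    rw [← radialCoord_eq_of_norm_eq h hzn]
    rcases le_total ‖x‖ ‖y‖ with hxy | hxy
    · have := rdist_radial_le hh he1 hx hxy
      rw [← hxe, ← hz] at this
      rw [abs_sub_comm]
      exact this.trans (by gcongr; exact le_abs_self _)
    · have := rdist_radial_le hh he1 hy hxy
      rw [← hxe, ← hz] at this
      rw [rdist_comm]
      exact this.trans (by gcongr; exact le_abs_self _)
  have h2 := rdist_le_of_norm_eq hh hm hzn
  have h3 : ‖sphereCoord h 0 z - sphereCoord h 0 y‖ ≤
      2 * ‖sphereCoord h 0 x - sphereCoord h 0 y‖ := by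
    have e1 : sphereCoord h 0 z = ‖sphereCoord h 0 y‖ • e := by
      rw [sphereCoord_zero, norm_sphereCoord_zero, radius_eq_of_norm_eq h hzn,
        bracket_eq_of_norm_eq hzn, hz, smul_smul]
    have e2 : sphereCoord h 0 x = ‖sphereCoord h 0 x‖ • e := by
      rw [norm_sphereCoord_zero, sphereCoord_zero]
      nth_rewrite 3 [hxe]
      rw [smul_smul]
    have e3 : ‖sphereCoord h 0 z - sphereCoord h 0 x‖ ≤
        ‖sphereCoord h 0 x - sphereCoord h 0 y‖ := by
      rw [e1]
      nth_rewrite 1 [e2]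
      rw [← sub_smul, norm_smul, he1, mul_one, Real.norm_eq_abs, abs_sub_comm]
      exact abs_norm_sub_norm_le _ _
    have e4 := norm_sub_le_norm_sub_add_norm_sub (sphereCoord h 0 z) (sphereCoord h 0 x)
      (sphereCoord h 0 y)
    linarith
  refine (rdist_triangle _ x z y).trans ?_
  linarith

theorem rdist_le_of_norm_le_one (hh : IsProfile h) {x y : Euc m} (hx : ‖x‖ ≤ 1) (hy : ‖y‖ ≤ 1) :
    rdist (profileMetric m hh) x y ≤ 4 := by
  have h2 : ‖y - x‖ ≤ 2 := (norm_sub_le _ _).trans (by linarith)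
  have := rdist_le_of_segment hh (x := x) (y := y) (M := 2) (fun t ht ↦ by
    have hz : ‖x + t • (y - x)‖ ≤ 1 := by
      have : x + t • (y - x) = (1 - t) • x + t • y := by module
      rw [this]
      refine (norm_add_le _ _).trans ?_
      rw [norm_smul, norm_smul, Real.norm_of_nonneg ht.1,
        Real.norm_of_nonneg (by linarith [ht.2] : (0 : ℝ) ≤ 1 - t)]
      nlinarith [ht.1, ht.2]
    set z := x + t • (y - x)
    rw [div_le_iff₀ (bracket_pos z)]
    have h3 : radius h z ≤ bracket z := by
      rw [radius, ← exp_half_logBracket]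
      gcongr
      have := hh.le_self (logBracket_nonneg z)
      linarith [logBracket_nonneg z]
    linarith [bracket_pos z])
  linarith

/-- Points of the unit ball are first moved to the unit sphere, at distance at most 4. This changes
the coordinate differences by at most `8` and `32`, and `216 = 2 · 8 + 6 · 32 + 4 + 4`. -/
theorem rdist_le (hh : IsProfile h) (hm : 3 ≤ m) (x y : Euc m) :
    rdist (profileMetric m hh) x y ≤ 2 * |radialCoord h x - radialCoord h y|
      + 6 * ‖sphereCoord h 0 x - sphereCoord h 0 y‖ + 216 := by
  have hnear : ∀ x : Euc m, ∃ x' : Euc m, 1 ≤ ‖x'‖ ∧ rdist (profileMetric m hh) x x' ≤ 4 := by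
    intro x
    rcases le_total 1 ‖x‖ with hx | hx
    · refine ⟨x, hx, ?_⟩
      rw [rdist_self]
      norm_num
    · refine ⟨EuclideanSpace.single ⟨0, by omega⟩ 1, by simp, ?_⟩
      exact rdist_le_of_norm_le_one hh hx (by simp)
  obtain ⟨x', hx', hxx⟩ := hnear x
  obtain ⟨y', hy', hyy⟩ := hnear y
  have h0 := rdist_le_of_one_le_norm hh hm hx' hy'
  have a1 := abs_radialCoord_sub_le hh x x'
  have a2 := abs_radialCoord_sub_le hh y y'
  have b1 := norm_sphereCoord_sub_le hh 0 x x'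
  have b2 := norm_sphereCoord_sub_le hh 0 y y'
  have a3 : |radialCoord h x' - radialCoord h y'| ≤ |radialCoord h x - radialCoord h y| + 8 := by
    rw [abs_le] at a1 a2
    have := abs_le.1 (le_refl |radialCoord h x - radialCoord h y|)
    rw [abs_le]
    constructor <;> linarith
  have b3 : ‖sphereCoord h 0 x' - sphereCoord h 0 y'‖ ≤
      ‖sphereCoord h 0 x - sphereCoord h 0 y‖ + 32 := by
    have e : sphereCoord h 0 x' - sphereCoord h 0 y' =
        (sphereCoord h 0 x - sphereCoord h 0 y) - (sphereCoord h 0 x - sphereCoord h 0 x')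
          + (sphereCoord h 0 y - sphereCoord h 0 y') := by abel
    rw [e]
    refine (norm_add_le _ _).trans ?_
    have := norm_sub_le (sphereCoord h 0 x - sphereCoord h 0 y)
      (sphereCoord h 0 x - sphereCoord h 0 x')
    linarith
  have t1 := rdist_triangle (profileMetric m hh) x x' y
  have t2 := rdist_triangle (profileMetric m hh) x' y' y
  rw [rdist_comm _ y' y] at t2
  linarith

end UpperBounds

end

/-! ### Completeness, uniform contractibility and decay of the scalar curvature -/

section

variable {m : ℕ}

section Topology

/-- The Riemannian distance induces the topology of `ℝ^m`. -/
def homeomorphEuc (g : SmoothMetric m) : RiemannianSpace g ≃ₜ Euc m where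
  toFun x := x
  invFun x := x
  left_inv _ := rfl
  right_inv _ := rfl
  -- By construction the topology of the Riemannian distance is definitionally the Euclidean one.
  continuous_toFun := continuous_id (X := Euc m)
  continuous_invFun := continuous_id (X := Euc m)

end Topology

variable {h : ℝ → ℝ}

theorem radius_le_bracket (hh : IsProfile h) (x : Euc m) : radius h x ≤ bracket x := by
  rw [radius, ← exp_half_logBracket]
  gcongr
  linarith [logBracket_nonneg x, hh.le_self (logBracket_nonneg x)]

theorem rdist_le_norm_sub (hh : IsProfile h) (x y : Euc m) : rdist
    (profileMetric m hh) x y ≤ ‖y - x‖ := by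
  rw [← one_mul ‖y - x‖]
  refine rdist_le_of_segment hh fun t _ ↦ ?_
  rw [div_le_one (bracket_pos _)]
  exact radius_le_bracket hh _

theorem logBracket_le_of_rdist_le (hh : IsProfile h) {x y : Euc m} {r : ℝ}
    (hr : rdist (profileMetric m hh) x y ≤ r) : logBracket y ≤ logBracket x + 2 * r := by
  have h1 := abs_logBracket_sub_le hh x y
  rw [abs_le] at h1
  linarith

/-- The function `logBracket` is Lipschitz and proper, so a Cauchy sequence stays in a compact set.
-/
theorem completeSpace_profileMetric (hh : IsProfile h) : CompleteSpace (RiemannianSpace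
    (profileMetric m hh)) := by
  refine Metric.complete_of_cauchySeq_tendsto fun u hu ↦ ?_
  obtain ⟨R, hR0, hR⟩ := cauchySeq_bdd hu
  let E := homeomorphEuc (profileMetric m hh)
  have hmem : ∀ n, E (u n) ∈ Metric.closedBall (0 : Euc m)
      (Real.exp ((logBracket (E (u 0)) + 2 * R) / 2)) := by
    intro n
    rw [mem_closedBall_zero_iff]
    exact norm_le_of_logBracket_le (logBracket_le_of_rdist_le hh (hR 0 n).le)
  have hK := (isCompact_closedBall (0 : Euc m)
    (Real.exp ((logBracket (E (u 0)) + 2 * R) / 2))).image E.symm.continuous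
  obtain ⟨x, -, hx⟩ := cauchySeq_tendsto_of_isComplete hK.isComplete
    (fun n ↦ ⟨E (u n), hmem n, E.symm_apply_apply _⟩) hu
  exact ⟨x, hx⟩

/-- The coordinate centred at `x` vanishes at `x`, so `F(y) θ ≤ 4r`, and `F(y) ≥ F(x) / 2` gives `θ
≤ 8r / F(x) ≤ 1/4`. Solving `‖y - x‖² = θ² (bracket x ^ 2 + ‖y - x‖²)` then yields the bound. -/
theorem norm_sub_le_of_rdist_le (hh : IsProfile h) {x y : Euc m} {r : ℝ} (hr : rdist
    (profileMetric m hh) x y ≤ r)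
    (hF : 32 * r ≤ radius h x) : ‖y - x‖ ≤ 16 * r / radius h x * bracket x := by
  have hr0 : 0 ≤ r := (rdist_nonneg _ _ _).trans hr
  have hFx := radius_pos h x
  have hFy : radius h x / 2 ≤ radius h y := by
    have := abs_le.1 (abs_radius_sub_le hh x y)
    linarith
  have h1 := norm_sphereCoord_sub_le hh x x y
  have h2 : sphereCoord h x x = 0 := by simp [sphereCoord, squash]
  rw [h2, zero_sub, norm_neg, sphereCoord, norm_smul, Real.norm_of_nonneg (radius_pos h y).le] at h1
  set θ := ‖squash (1 + ‖x‖ ^ 2) (y - x)‖ with hθ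
  have hθ0 : 0 ≤ θ := norm_nonneg _
  have h3 : θ ≤ 8 * r / radius h x := by
    rw [le_div_iff₀ hFx]
    nlinarith
  have h4 : θ ≤ 1 / 4 := by
    refine h3.trans ?_
    rw [div_le_iff₀ hFx]
    linarith
  have hp : 0 < Real.sqrt (1 + ‖x‖ ^ 2 + ‖y - x‖ ^ 2) := Real.sqrt_pos.2 (by positivity)
  have h5 : ‖y - x‖ = θ * Real.sqrt (1 + ‖x‖ ^ 2 + ‖y - x‖ ^ 2) := by
    rw [hθ, squash, norm_smul, Real.norm_of_nonneg (by positivity)]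
    field_simp
  have h6 : ‖y - x‖ ^ 2 = θ ^ 2 * (bracket x ^ 2 + ‖y - x‖ ^ 2) := by
    nth_rewrite 1 [h5]
    rw [mul_pow, Real.sq_sqrt (by positivity), bracket_sq]
  have hb := bracket_pos x
  have h7 : ‖y - x‖ ≤ 2 * θ * bracket x := by
    rw [← sq_le_sq₀ (norm_nonneg _) (by positivity)]
    have h8 : θ ^ 2 * ‖y - x‖ ^ 2 ≤ 1 / 16 * ‖y - x‖ ^ 2 := by
      gcongr
      nlinarith
    have h9 : 0 ≤ θ ^ 2 * bracket x ^ 2 := by positivity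
    have h10 : (2 * θ * bracket x) ^ 2 = 4 * (θ ^ 2 * bracket x ^ 2) := by ring
    rw [h10]
    linarith
  calc _ ≤ 2 * (8 * r / radius h x) * bracket x := h7.trans (by gcongr)
    _ = _ := by ring

/-- The segment has Euclidean length at most `bracket x / 2`, so along it `bracket` stays above half
its value at `x`. By monotonicity in the norm, `F` is bounded by its larger end value, at most `2
F(x)`. So the conformal factor is at most 4 times its value at `x`, and `64 = 4 · 16`. -/
theorem rdist_segment_le_of_radius_ge (hh : IsProfile h) {x y : Euc m} {r : ℝ}
    (hr : rdist (profileMetric m hh) x y ≤ r) (hF : 32 * r ≤ radius h x) {t : ℝ}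
    (ht : t ∈ Icc (0 : ℝ) 1) : rdist (profileMetric m hh) x (x + t • (y - x)) ≤ 64 * r := by
  have hr0 : 0 ≤ r := (rdist_nonneg _ _ _).trans hr
  have hFx := radius_pos h x
  have hb := bracket_pos x
  have hn := norm_sub_le_of_rdist_le hh hr hF
  have hn2 : ‖y - x‖ ≤ bracket x / 2 := by
    refine hn.trans ?_
    have : 16 * r / radius h x ≤ 1 / 2 := by
      rw [div_le_iff₀ hFx]
      linarith
    nlinarith
  have hn3 : ∀ s ∈ Icc (0 : ℝ) 1, ‖s • (y - x)‖ ≤ ‖y - x‖ := by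
    intro s hs
    rw [norm_smul, Real.norm_of_nonneg hs.1]
    exact mul_le_of_le_one_left (norm_nonneg _) hs.2
  have key := rdist_le_of_segment hh (x := x) (y := x + t • (y - x))
    (M := 4 * radius h x / bracket x) (fun s hs ↦ by
      have e : x + s • (x + t • (y - x) - x) = x + (s * t) • (y - x) := by module
      have hst : s * t ∈ Icc (0 : ℝ) 1 :=
        ⟨mul_nonneg hs.1 ht.1, mul_le_one₀ hs.2 ht.1 ht.2⟩
      rw [e]
      set z := x + (s * t) • (y - x) with hz
      have hzx : ‖x - z‖ ≤ bracket x / 2 := by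
        rw [hz, norm_sub_rev, add_sub_cancel_left]
        exact (hn3 _ hst).trans hn2
      have hbz : bracket x ≤ 2 * bracket z := by linarith [bracket_le_add x z]
      have hFz : radius h z ≤ 2 * radius h x := by
        have hmax : ‖z‖ ≤ max ‖x‖ ‖y‖ := by
          have : z = (1 - s * t) • x + (s * t) • y := by rw [hz]; module
          rw [this]
          refine (norm_add_le _ _).trans ?_
          rw [norm_smul, norm_smul, Real.norm_of_nonneg hst.1,
            Real.norm_of_nonneg (by linarith [hst.2] : (0 : ℝ) ≤ 1 - s * t)]
          nlinarith [le_max_left ‖x‖ ‖y‖, le_max_right ‖x‖ ‖y‖, hst.1, hst.2]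
        have hy := abs_le.1 (abs_radius_sub_le hh x y)
        rcases le_max_iff.1 hmax with h1 | h1
        · linarith [radius_le_of_norm_le hh h1]
        · linarith [radius_le_of_norm_le hh h1]
      rw [div_le_div_iff₀ (bracket_pos z) hb]
      calc _ ≤ (2 * radius h x) * (2 * bracket z) := by gcongr
        _ = _ := by ring)
  refine key.trans ?_
  rw [add_sub_cancel_left]
  calc _ ≤ 4 * radius h x / bracket x * (16 * r / radius h x * bracket x) := by
        gcongr
        exact (hn3 t ht).trans hn
    _ = _ := by
      field_simp
      ring

/-- Since `F → ∞`, the points with `F < 32 r` form a bounded set, and there the metric is compared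
with the Euclidean one. -/
theorem exists_rdist_segment_le (hh : IsProfile h) (r : ℝ) : ∃ M, ∀ x y : Euc m,
    rdist (profileMetric m hh) x y ≤ r → ∀ t ∈ Icc (0 : ℝ) 1,
      rdist (profileMetric m hh) x (x + t • (y - x)) ≤ M := by
  obtain ⟨T, hT⟩ := (tendsto_atTop.1 (Real.tendsto_exp_atTop.comp hh.tendsto)
    (32 * r)).exists_forall_of_atTop
  refine ⟨max (64 * r) (2 * Real.exp ((max T 0 + 2 * r) / 2)), fun x y hxy t ht ↦ ?_⟩
  have hr0 : 0 ≤ r := (rdist_nonneg _ _ _).trans hxy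
  by_cases hx : T ≤ logBracket x
  · exact (rdist_segment_le_of_radius_ge hh hxy (hT _ hx) ht).trans (le_max_left _ _)
  · refine le_trans ?_ (le_max_right _ _)
    have hxT : logBracket x ≤ max T 0 := (not_le.1 hx).le.trans (le_max_left _ _)
    have nx : ‖x‖ ≤ Real.exp ((max T 0 + 2 * r) / 2) :=
      norm_le_of_logBracket_le (by linarith)
    have ny : ‖y‖ ≤ Real.exp ((max T 0 + 2 * r) / 2) :=
      norm_le_of_logBracket_le (by linarith [logBracket_le_of_rdist_le hh hxy])
    refine (rdist_le_norm_sub hh _ _).trans ?_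
    rw [add_sub_cancel_left, norm_smul, Real.norm_of_nonneg ht.1]
    refine (mul_le_of_le_one_left (norm_nonneg _) ht.2).trans ((norm_sub_le _ _).trans ?_)
    linarith

theorem uniformlyContractible_profileMetric (hh : IsProfile h) :
    UniformlyContractible (RiemannianSpace (profileMetric m hh)) := by
  -- The contractibility function is a supremum over all segments that occur, so that it is monotone
  -- by construction.
  let S : ℝ → Set ℝ := fun r ↦ {d | ∃ x y : Euc m, rdist (profileMetric m hh) x y ≤ r ∧
    ∃ t ∈ Icc (0 : ℝ) 1, d = rdist (profileMetric m hh) x (x + t • (y - x))}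
  have hbdd : ∀ r, BddAbove (S r) := by
    intro r
    obtain ⟨M, hM⟩ := exists_rdist_segment_le (m := m) hh r
    refine ⟨M, ?_⟩
    rintro d ⟨x, y, hxy, t, ht, rfl⟩
    exact hM x y hxy t ht
  have hne : ∀ r : ℝ≥0, (S r).Nonempty := fun r ↦ ⟨_, 0, 0, by
    rw [rdist_self]
    exact r.2, 0, by simp, rfl⟩
  refine ⟨fun r ↦ r + (sSup (S r)).toNNReal, ?_, fun r ↦ le_self_add, fun x r ↦ ?_⟩
  · intro r r' hr
    refine add_le_add hr (Real.toNNReal_le_toNNReal (csSup_le_csSup (hbdd _) (hne r) ?_))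
    rintro d ⟨x, y, hxy, t, ht, rfl⟩
    exact ⟨x, y, hxy.trans (by exact_mod_cast hr), t, ht, rfl⟩
  · let E := homeomorphEuc (profileMetric m hh)
    let f : Metric.closedBall x (r : ℝ) × unitInterval → RiemannianSpace (profileMetric m hh) :=
      fun p ↦ E.symm (E x + (1 - (p.2 : ℝ)) • (E p.1 - E x))
    have hf : Continuous f := by
      refine E.symm.continuous.comp ?_
      have h1 : Continuous fun p : Metric.closedBall x (r : ℝ) × unitInterval ↦ E p.1 :=
        E.continuous.comp (continuous_subtype_val.comp continuous_fst)
      have h2 : Continuous fun p : Metric.closedBall x (r : ℝ) × unitInterval ↦ (p.2 : ℝ) :=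
        continuous_subtype_val.comp continuous_snd
      fun_prop
    have hmem : ∀ p, f p ∈ Metric.closedBall x
        ((r + (sSup (S r)).toNNReal : ℝ≥0) : ℝ) := by
      rintro ⟨⟨y, hy⟩, t⟩
      rw [Metric.mem_closedBall, dist_comm] at hy ⊢
      have h1 : rdist (profileMetric m hh) (E x) (E x + (1 - (t : ℝ)) • (E y - E x)) ≤
          sSup (S r) :=
        le_csSup (hbdd r) ⟨E x, E y, hy, 1 - t,
          ⟨by linarith [t.2.2], by linarith [t.2.1]⟩, rfl⟩
      refine h1.trans ((Real.le_coe_toNNReal _).trans ?_)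
      push_cast
      linarith [r.2]
    refine ⟨⟨fun p ↦ ⟨f p, hmem p⟩, hf.subtype_mk _⟩, fun y ↦ ⟨?_, ?_⟩⟩
    · change E.symm (E x + (1 - (0 : ℝ)) • (E y - E x)) = y
      simp
    · change E.symm (E x + (1 - (1 : ℝ)) • (E y - E x)) = x
      simp

theorem tendsto_mul_iInf_scalarCurvature (hh : IsProfile h) (hm : 3 ≤ m) {G : ℝ≥0 → ℝ≥0}
    (hG : Tendsto G atTop atTop)
    (hhG : ∀ r : ℝ≥0, Real.exp (4 * h (3 * r)) ≤ max 1 (G r : ℝ))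
    (x₀ : RiemannianSpace (profileMetric m hh)) :
    Tendsto (fun r : ℝ≥0 ↦ (G r : ℝ) *
      ⨅ x : Metric.closedBall x₀ (r : ℝ), scalarCurvature (profileMetric m hh) x.1)
      atTop atTop := by
  have hG' : Tendsto (fun r ↦ (G r : ℝ)) atTop atTop := NNReal.tendsto_coe_atTop.2 hG
  refine tendsto_atTop_mono' atTop ?_ (Real.tendsto_sqrt_atTop.comp hG')
  filter_upwards [hG'.eventually_ge_atTop 1,
    -- For `r ≥ logBracket x₀` the bound `logBracket x₀ + 2r` on the ball is at most `3r`.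
    (NNReal.tendsto_coe_atTop.2 tendsto_id).eventually_ge_atTop (logBracket (m := m) x₀)]
    with r h1 h2
  have hne : Nonempty (Metric.closedBall x₀ (r : ℝ)) := ⟨x₀, Metric.mem_closedBall_self r.2⟩
  have hinf : Real.exp (-(2 * h (3 * r))) ≤
      ⨅ x : Metric.closedBall x₀ (r : ℝ), scalarCurvature (profileMetric m hh) x.1 := by
    refine le_ciInf fun x ↦ le_trans ?_ (exp_neg_le_scalarCurvature hh hm x.1)
    have hx : rdist (profileMetric m hh) x₀ x.1 ≤ r := by
      have := x.2
      rw [Metric.mem_closedBall, dist_comm] at this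
      exact this
    have h3 := logBracket_le_of_rdist_le hh hx
    have h4 : h (logBracket (m := m) x.1) ≤ h (3 * r) := hh.monotone (by
      have : logBracket (m := m) x₀ ≤ r := h2
      linarith)
    gcongr
  have h5 := hhG r
  rw [max_eq_right h1] at h5
  have h6 : Real.exp (2 * h (3 * r)) ≤ √(G r : ℝ) := by
    refine Real.le_sqrt_of_sq_le ?_
    rw [sq, ← Real.exp_add]
    convert h5 using 2
    ring
  change √(G r : ℝ) ≤ _
  have hG0 : (0 : ℝ) ≤ G r := (G r).2
  calc √(G r : ℝ) = √(G r : ℝ) * (Real.exp (2 * h (3 * r)) * Real.exp (-(2 * h (3 * r)))) := by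
        rw [← Real.exp_add]
        simp
    _ ≤ √(G r : ℝ) * (√(G r : ℝ) * Real.exp (-(2 * h (3 * r)))) := by gcongr
    _ = (G r : ℝ) * Real.exp (-(2 * h (3 * r))) := by
        rw [← mul_assoc, Real.mul_self_sqrt hG0]
    _ ≤ _ := by gcongr

end

section

/-! ### Coloured grids and asymptotic dimension -/

section Colours

/-- The point `t` lies in a gap of the intervals of colour `c` and size `ℓ`. -/
def InGap (n : ℕ) (ℓ : ℝ) (c : Fin (n + 1)) (t : ℝ) : Prop :=
  ((n + 1 : ℕ) : ℤ) ∣ ⌊t / ℓ⌋ - (c : ℤ)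

/-- The index of the interval of colour `c` and size `ℓ` that contains `t`. -/
def blockIndex (n : ℕ) (ℓ : ℝ) (c : Fin (n + 1)) (t : ℝ) : ℤ :=
  (⌊t / ℓ⌋ - (c : ℤ)) / ((n + 1 : ℕ) : ℤ)

variable {n : ℕ} {ℓ : ℝ} {c : Fin (n + 1)} {s t : ℝ}

theorem InGap.unique {c' : Fin (n + 1)} (h : InGap n ℓ c t) (h' : InGap n ℓ c' t) : c = c' := by
  have h1 := dvd_sub h h'
  have h2 : (⌊t / ℓ⌋ - (c : ℤ)) - (⌊t / ℓ⌋ - (c' : ℤ)) = (c' : ℤ) - c := by ring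
  rw [h2] at h1
  have h3 := Int.eq_zero_of_abs_lt_dvd h1 (by
    rw [abs_lt]
    have := c.2
    have := c'.2
    constructor <;> push_cast <;> omega)
  ext
  omega

/-- Each block begins with a gap cell of length `ℓ`. If `t` lies in a later block than `s` but
outside its gap, that whole cell separates them. -/
theorem lt_sub_of_blockIndex_lt (hℓ : 0 < ℓ) (ht : ¬InGap n ℓ c t)
    (h : blockIndex n ℓ c s < blockIndex n ℓ c t) : ℓ < t - s := by
  unfold InGap at ht
  unfold blockIndex at h
  set N : ℤ := ((n + 1 : ℕ) : ℤ) with hN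
  have hN0 : 0 < N := by rw [hN]; positivity
  set a := ⌊s / ℓ⌋ - (c : ℤ) with ha
  set b := ⌊t / ℓ⌋ - (c : ℤ) with hb
  have ea := Int.mul_ediv_add_emod a N
  have eb := Int.mul_ediv_add_emod b N
  have ra := Int.emod_lt_of_pos a hN0
  have rb := Int.emod_nonneg b hN0.ne'
  have rb' : b % N ≠ 0 := fun h0 ↦ ht (Int.dvd_of_emod_eq_zero h0)
  have hmul : N * (a / N) + N ≤ N * (b / N) := by nlinarith
  have hab : a + 2 ≤ b := by omega
  have h1 : ⌊s / ℓ⌋ + 2 ≤ ⌊t / ℓ⌋ := by omega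
  have h2 := Int.lt_floor_add_one (s / ℓ)
  have h3 := Int.floor_le (t / ℓ)
  have h4 : (⌊s / ℓ⌋ : ℝ) + 2 ≤ ⌊t / ℓ⌋ := by exact_mod_cast h1
  have h5 : s / ℓ + 1 < t / ℓ := by linarith
  rw [div_add_one hℓ.ne', div_lt_div_iff_of_pos_right hℓ] at h5
  linarith

theorem blockIndex_eq_of_abs_sub_lt (hℓ : 0 < ℓ) (hs : ¬InGap n ℓ c s) (ht : ¬InGap n ℓ c t)
    (h : |s - t| < ℓ) : blockIndex n ℓ c s = blockIndex n ℓ c t := by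
  rw [abs_lt] at h
  rcases lt_trichotomy (blockIndex n ℓ c s) (blockIndex n ℓ c t) with h1 | h1 | h1
  · linarith [lt_sub_of_blockIndex_lt hℓ ht h1]
  · exact h1
  · linarith [lt_sub_of_blockIndex_lt hℓ hs h1]

theorem abs_sub_le_of_blockIndex_eq (hℓ : 0 < ℓ)
    (h : blockIndex n ℓ c s = blockIndex n ℓ c t) : |s - t| ≤ (n + 1) * ℓ := by
  unfold blockIndex at h
  set N : ℤ := ((n + 1 : ℕ) : ℤ) with hN
  have hN0 : 0 < N := by rw [hN]; positivity
  set a := ⌊s / ℓ⌋ - (c : ℤ) with ha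
  set b := ⌊t / ℓ⌋ - (c : ℤ) with hb
  have ea := Int.mul_ediv_add_emod a N
  have eb := Int.mul_ediv_add_emod b N
  have ra := Int.emod_lt_of_pos a hN0
  have rb := Int.emod_lt_of_pos b hN0
  have ra' := Int.emod_nonneg a hN0.ne'
  have rb' := Int.emod_nonneg b hN0.ne'
  rw [h] at ea
  have h1 : ⌊s / ℓ⌋ - ⌊t / ℓ⌋ ≤ n := by omega
  have h2 : ⌊t / ℓ⌋ - ⌊s / ℓ⌋ ≤ n := by omega
  have h1' : (⌊s / ℓ⌋ : ℝ) - ⌊t / ℓ⌋ ≤ n := by exact_mod_cast h1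
  have h2' : (⌊t / ℓ⌋ : ℝ) - ⌊s / ℓ⌋ ≤ n := by exact_mod_cast h2
  have s1 := Int.lt_floor_add_one (s / ℓ)
  have s2 := Int.floor_le (s / ℓ)
  have t1 := Int.lt_floor_add_one (t / ℓ)
  have t2 := Int.floor_le (t / ℓ)
  have h3 : |s / ℓ - t / ℓ| ≤ n + 1 := by
    rw [abs_le]
    constructor <;> linarith
  rw [← sub_div, abs_div, abs_of_pos hℓ, div_le_iff₀ hℓ] at h3
  exact h3

/-- Each of the `n` coordinates lies in a gap for at most one of the `n + 1` colours. -/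
theorem exists_colour {ι : Type*} [Fintype ι] (hι : Fintype.card ι = n) (ℓ : ℝ) (p : ι → ℝ) :
    ∃ c : Fin (n + 1), ∀ i, ¬InGap n ℓ c (p i) := by
  by_contra! hcon
  choose f hf using hcon
  have hinj : Function.Injective f := fun c c' hcc ↦ (hf c).unique (hcc ▸ hf c')
  have := Fintype.card_le_of_injective f hinj
  rw [Fintype.card_fin, hι] at this
  omega

end Colours

/-- A metric space with `n` Lipschitz coordinates, in which the boxes of the coordinates consist
of at most two pieces of linearly controlled diameter, has asymptotic dimension at most `n` with
linear control. -/
theorem asdimLEWith_of_coordinates {X : Type*} [MetricSpace X] {n : ℕ} {K a b : ℝ≥0} (hK : 0 < K)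
    (p : Fin n → X → ℝ) (hp : ∀ i x y, |p i x - p i y| ≤ K * dist x y) (half : X → Bool)
    (hd : ∀ ℓ : ℝ, 0 < ℓ → ∀ x y, half x = half y → (∀ i, |p i x - p i y| ≤ (n + 1) * ℓ) →
      dist x y ≤ a * ℓ + b) :
    AsdimLEWith X n (fun r ↦ (6 * K * a + 2) * r + 2 * b) := by
  classical
  refine ⟨fun r r' hr ↦ by dsimp only; gcongr, fun r ↦ ?_, fun r hr ↦ ?_⟩
  · rw [← NNReal.coe_le_coe]
    push_cast
    have : (0 : ℝ) ≤ K * a * r := by positivity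
    nlinarith [b.2, r.2]
  -- Points at distance at most `2r` have coordinates that differ by at most `2Kr < ℓ`, so they
  -- cannot lie in different boxes of one colour.
  set ℓ : ℝ := 3 * K * r with hℓ
  have hℓ0 : 0 < ℓ := by positivity
  set D : ℝ := (((6 * K * a + 2) * r + 2 * b : ℝ≥0) : ℝ) with hD
  have hDeq : D = 2 * (a * ℓ + b) + 2 * r := by
    rw [hD, hℓ]
    push_cast
    ring
  have hDle : a * ℓ + b ≤ D := by
    have : 0 ≤ a * ℓ + b := by positivity
    rw [hDeq]
    linarith [r.2]
  let B : Fin (n + 1) → (Fin n → ℤ) → Set X := fun c k ↦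
    {x | ∀ i, ¬InGap n ℓ c (p i x) ∧ blockIndex n ℓ c (p i x) = k i}
  let ok : Fin (n + 1) → (Fin n → ℤ) → Prop := fun c k ↦ ∀ x ∈ B c k, ∀ y ∈ B c k, dist x y ≤ D
  -- A box of diameter at most `D` is kept whole, so that both values of the Boolean give the same
  -- member of the cover; any other box is cut into its two halves.
  let V : Fin (n + 1) × (Fin n → ℤ) × Bool → Set X := fun q ↦
    if ok q.1 q.2.1 then B q.1 q.2.1 else B q.1 q.2.1 ∩ {x | half x = q.2.2}
  have hVB : ∀ c k e, V (c, k, e) ⊆ B c k := by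
    intro c k e
    change (if ok c k then B c k else B c k ∩ {x | half x = e}) ⊆ B c k
    split_ifs
    · exact subset_rfl
    · exact inter_subset_left
  have hBd : ∀ c k, ∀ x ∈ B c k, ∀ y ∈ B c k, half x = half y → dist x y ≤ a * ℓ + b :=
    fun c k x hx y hy hxy ↦ hd ℓ hℓ0 x y hxy fun i ↦
      abs_sub_le_of_blockIndex_eq hℓ0 ((hx i).2.trans (hy i).2.symm)
  refine ⟨range V, ?_, ?_, ?_⟩
  · refine eq_univ_of_forall fun x ↦ ?_
    obtain ⟨c, hc⟩ := exists_colour (Fintype.card_fin n) ℓ (fun i ↦ p i x)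
    have hx : x ∈ B c (fun i ↦ blockIndex n ℓ c (p i x)) := fun i ↦ ⟨hc i, rfl⟩
    refine ⟨V (c, fun i ↦ blockIndex n ℓ c (p i x), half x), mem_range_self _, ?_⟩
    change x ∈ if ok c _ then B c _ else B c _ ∩ {y | half y = half x}
    split_ifs
    · exact hx
    · exact ⟨hx, rfl⟩
  · rintro _ ⟨⟨c, k, e⟩, rfl⟩ y hy z hz
    by_cases hok : ok c k
    · exact hok y (hVB _ _ _ hy) z (hVB _ _ _ hz)
    · have hV : V (c, k, e) = B c k ∩ {x | half x = e} := if_neg hok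
      rw [hV] at hy hz
      exact (hBd c k y hy.1 z hz.1 (hy.2.trans hz.2.symm)).trans hDle
  · intro x
    have huniq : ∀ c k e k' e' y z, y ∈ V (c, k, e) → z ∈ V (c, k', e') → dist y z ≤ 2 * r →
        V (c, k, e) = V (c, k', e') := by
      intro c k e k' e' y z hy hz hyz
      have hyB := hVB _ _ _ hy
      have hzB := hVB _ _ _ hz
      have hkk : k = k' := by
        ext i
        rw [← (hyB i).2, ← (hzB i).2]
        refine blockIndex_eq_of_abs_sub_lt hℓ0 (hyB i).1 (hzB i).1 ((hp i y z).trans_lt ?_)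
        have hK' : (0 : ℝ) < K := hK
        have hr' : (0 : ℝ) < r := hr
        calc (K : ℝ) * dist y z ≤ K * (2 * r) := by gcongr
          _ < ℓ := by rw [hℓ]; nlinarith [mul_pos hK' hr']
      subst hkk
      by_cases hok : ok c k
      · exact (if_pos hok).trans (if_pos hok).symm
      · have hV : ∀ e, V (c, k, e) = B c k ∩ {x | half x = e} := fun e ↦ if_neg hok
        rw [hV] at hy hz
        have hyz' : half y = half z := by
          by_contra hne
          -- If the two halves contained points within `2r` of each other, the box would have
          -- diameter at most `2(aℓ + b) + 2r = D` and would not have been cut.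
          refine hok fun u hu v hv ↦ ?_
          by_cases huv : half u = half v
          · exact (hBd c k u hu v hv huv).trans hDle
          · have hcase : (half u = half y ∧ half v = half z) ∨
                (half u = half z ∧ half v = half y) := by
              revert hne huv
              cases half u <;> cases half v <;> cases half y <;> cases half z <;> simp
            rcases hcase with ⟨h1, h2⟩ | ⟨h1, h2⟩
            · have t1 := hBd c k u hu y hyB h1
              have t2 := hBd c k v hv z hzB h2
              rw [dist_comm] at t2
              have := dist_triangle4 u y z v
              linarith
            · have t1 := hBd c k u hu z hzB h1
              have t2 := hBd c k v hv y hyB h2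
              rw [dist_comm] at t2 hyz
              have := dist_triangle4 u z y v
              linarith
        have : e = e' := hy.2.symm.trans (hyz'.trans hz.2)
        rw [this]
    have hex : ∀ U ∈ {U ∈ range V | (U ∩ Metric.closedBall x (r : ℝ)).Nonempty},
        ∃ c : Fin (n + 1), ∃ k e y, U = V (c, k, e) ∧ y ∈ U ∧ dist y x ≤ r := by
      rintro U ⟨⟨⟨c, k, e⟩, rfl⟩, y, hy, hyx⟩
      exact ⟨c, k, e, y, rfl, hy, hyx⟩
    have : Nonempty X := ⟨x⟩
    choose! col k e y hU hyU hyx using hex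
    have hinj : InjOn col {U ∈ range V | (U ∩ Metric.closedBall x (r : ℝ)).Nonempty} := by
      intro U hU1 U' hU2 hcc
      have h1 : y U ∈ V (col U, k U, e U) := (hU U hU1) ▸ hyU U hU1
      have h2 : y U' ∈ V (col U, k U', e U') := by
        rw [hcc]
        exact (hU U' hU2) ▸ hyU U' hU2
      refine (hU U hU1).trans (Eq.trans ?_ (hU U' hU2).symm)
      rw [← hcc]
      refine huniq _ _ _ _ _ (y U) (y U') h1 h2 ?_
      have := dist_triangle_right (y U) (y U') x
      linarith [hyx U hU1, hyx U' hU2]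
    refine (encard_le_encard_of_injOn (mapsTo_univ _ _) hinj).trans ?_
    rw [encard_univ]
    simp

/-! ### The Lipschitz equivalence between spheres and octahedra -/

section Octahedral

variable {m : ℕ}

/-- The `ℓ¹` norm on `ℝ^m`. -/
def taxicab (x : Euc m) : ℝ := ∑ i, |x i|

theorem taxicab_nonneg (x : Euc m) : 0 ≤ taxicab x := Finset.sum_nonneg fun _ _ ↦ abs_nonneg _

theorem taxicab_le (x : Euc m) : taxicab x ≤ m * ‖x‖ := by
  refine (Finset.sum_le_sum fun i _ ↦ abs_coord_le_norm x i).trans ?_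
  simp

theorem norm_le_taxicab (x : Euc m) : ‖x‖ ≤ taxicab x := by
  rw [← sq_le_sq₀ (norm_nonneg _) (taxicab_nonneg _), EuclideanSpace.norm_sq_eq, taxicab]
  simp only [Real.norm_eq_abs]
  exact Finset.sum_sq_le_sq_sum_of_nonneg fun i _ ↦ abs_nonneg _

theorem abs_taxicab_sub_le (x y : Euc m) : |taxicab x - taxicab y| ≤ m * ‖x - y‖ := by
  rw [taxicab, taxicab, ← Finset.sum_sub_distrib]
  refine (Finset.abs_sum_le_sum_abs _ _).trans (le_trans (Finset.sum_le_sum fun i _ ↦ ?_)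
    (taxicab_le (x - y)))
  exact abs_abs_sub_abs_le _ _

theorem taxicab_smul (c : ℝ) (x : Euc m) : taxicab (c • x) = |c| * taxicab x := by
  simp [taxicab, abs_mul, Finset.mul_sum]

/-- Radial rescaling from one norm to another is Lipschitz. Both the passage to octahedra and its
inverse are of this form, with the two norms exchanged. -/
theorem norm_ratio_smul_sub_le {N₁ N₂ : Euc m → ℝ} {A L₁ L₂ : ℝ}
    (h0 : ∀ x, 0 ≤ N₁ x) (hA : ∀ x, N₁ x ≤ A * N₂ x) (hB : ∀ x, ‖x‖ ≤ N₂ x)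
    (h1 : ∀ x y, |N₁ x - N₁ y| ≤ L₁ * ‖x - y‖) (h2 : ∀ x y, |N₂ x - N₂ y| ≤ L₂ * ‖x - y‖)
    (hA0 : 0 ≤ A) (x y : Euc m) :
    ‖(N₁ x / N₂ x) • x - (N₁ y / N₂ y) • y‖ ≤ (A + A * L₂ + L₁) * ‖x - y‖ := by
  have h20 : ∀ x, 0 ≤ N₂ x := fun x ↦ (norm_nonneg x).trans (hB x)
  have hq : ∀ x, N₁ x / N₂ x ≤ A := fun x ↦ div_le_of_le_mul₀ (h20 x) hA0 (hA x)
  have hq0 : ∀ x, 0 ≤ N₁ x / N₂ x := fun x ↦ div_nonneg (h0 x) (h20 x)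
  have e : (N₁ x / N₂ x) • x - (N₁ y / N₂ y) • y =
      (N₁ x / N₂ x) • (x - y) + (N₁ x / N₂ x - N₁ y / N₂ y) • y := by module
  have b1 : ‖(N₁ x / N₂ x) • (x - y)‖ ≤ A * ‖x - y‖ := by
    rw [norm_smul, Real.norm_of_nonneg (hq0 x)]
    gcongr
    exact hq x
  have hz : ∀ x, N₂ x = 0 → x = 0 := fun x hx ↦
    norm_eq_zero.1 (le_antisymm ((hB x).trans hx.le) (norm_nonneg x))
  have hL₁ : 0 ≤ L₁ * ‖x - y‖ := (abs_nonneg _).trans (h1 x y)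
  have hL₂ : 0 ≤ A * (L₂ * ‖x - y‖) := mul_nonneg hA0 ((abs_nonneg _).trans (h2 x y))
  rcases eq_or_ne (N₂ x) 0 with hx | hx
  · rw [hz x hx, smul_zero, zero_sub, zero_sub, norm_neg, norm_neg, norm_smul,
      Real.norm_of_nonneg (hq0 y)]
    rw [hz x hx, zero_sub, norm_neg] at hL₁ hL₂
    nlinarith [mul_le_mul_of_nonneg_right (hq y) (norm_nonneg y)]
  rcases eq_or_ne (N₂ y) 0 with hy | hy
  · rw [e, hz y hy, smul_zero, add_zero, ← hz y hy]
    linarith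
  have b2 : ‖(N₁ x / N₂ x - N₁ y / N₂ y) • y‖ ≤ (A * L₂ + L₁) * ‖x - y‖ := by
    rw [norm_smul, Real.norm_eq_abs]
    have e2 : (N₁ x / N₂ x - N₁ y / N₂ y) * N₂ y =
        (N₁ x / N₂ x) * (N₂ y - N₂ x) + (N₁ x - N₁ y) := by
      field_simp
      ring
    calc _ ≤ |N₁ x / N₂ x - N₁ y / N₂ y| * N₂ y := by
          gcongr
          exact hB y
      _ = |(N₁ x / N₂ x) * (N₂ y - N₂ x) + (N₁ x - N₁ y)| := by
          rw [← e2, abs_mul, abs_of_nonneg (h20 y)]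
      _ ≤ |(N₁ x / N₂ x) * (N₂ y - N₂ x)| + |N₁ x - N₁ y| := abs_add_le _ _
      _ ≤ A * (L₂ * ‖x - y‖) + L₁ * ‖x - y‖ := by
          rw [abs_mul, abs_of_nonneg (hq0 x), abs_sub_comm (N₂ y)]
          gcongr
          · exact hq x
          · exact h2 x y
          · exact h1 x y
      _ = _ := by ring
  rw [e]
  refine (norm_add_le _ _).trans ?_
  linarith

/-- The map of `ℝ^m` that takes Euclidean spheres to octahedra. -/
def toOctahedral (x : Euc m) : Euc m := (‖x‖ / taxicab x) • x

theorem taxicab_toOctahedral (x : Euc m) : taxicab (toOctahedral x) = ‖x‖ := by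
  rw [toOctahedral, taxicab_smul, abs_of_nonneg (div_nonneg (norm_nonneg x) (taxicab_nonneg x))]
  rcases eq_or_ne (taxicab x) 0 with h | h
  · rw [h, mul_zero]
    linarith [norm_le_taxicab x, norm_nonneg x]
  · field_simp

theorem norm_toOctahedral_sub_le (x y : Euc m) :
    ‖toOctahedral x - toOctahedral y‖ ≤ (m + 2) * ‖x - y‖ := by
  refine (norm_ratio_smul_sub_le (N₁ := fun x ↦ ‖x‖) (N₂ := taxicab) (A := 1) (L₁ := 1) (L₂ := m)
    (fun x ↦ norm_nonneg x) (fun x ↦ by simpa using norm_le_taxicab x) norm_le_taxicab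
    (fun x y ↦ by simpa using abs_norm_sub_norm_le x y) abs_taxicab_sub_le zero_le_one
    x y).trans_eq ?_
  ring

theorem eq_smul_toOctahedral (x : Euc m) :
    (taxicab (toOctahedral x) / ‖toOctahedral x‖) • toOctahedral x = x := by
  rw [taxicab_toOctahedral]
  rcases eq_or_ne x 0 with rfl | hx
  · simp
  · have h1 : ‖x‖ ≠ 0 := norm_ne_zero_iff.2 hx
    have h2 : 0 < taxicab x := ((norm_nonneg x).lt_of_ne' h1).trans_le (norm_le_taxicab x)
    rw [toOctahedral, norm_smul, smul_smul, norm_div, norm_norm, Real.norm_of_nonneg h2.le]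
    rw [show ‖x‖ / (‖x‖ / taxicab x * ‖x‖) * (‖x‖ / taxicab x) = 1 by field_simp, one_smul]

/-- The inverse of `toOctahedral` is the rescaling with the two norms exchanged; the constant is `m
+ m · 1 + m`. -/
theorem norm_sub_le_norm_toOctahedral_sub (x y : Euc m) :
    ‖x - y‖ ≤ 3 * m * ‖toOctahedral x - toOctahedral y‖ := by
  have := norm_ratio_smul_sub_le (N₁ := taxicab) (N₂ := fun x : Euc m ↦ ‖x‖) (A := m) (L₁ := m)
    (L₂ := 1) taxicab_nonneg taxicab_le (fun x ↦ le_rfl) abs_taxicab_sub_le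
    (fun x y ↦ by simpa using abs_norm_sub_norm_le x y) (Nat.cast_nonneg m)
    (toOctahedral x) (toOctahedral y)
  rw [eq_smul_toOctahedral, eq_smul_toOctahedral] at this
  linarith

/-- Two points in the same half space whose other coordinates and `ℓ¹` norms are close. -/
theorem taxicab_sub_le {i₀ : Fin m} {x y : Euc m} {s t : ℝ}
    (hi : ∀ i ≠ i₀, |x i - y i| ≤ t) (hhalf : 0 ≤ x i₀ ↔ 0 ≤ y i₀)
    (hs : |taxicab x - taxicab y| ≤ s) : taxicab (x - y) ≤ s + 2 * ((m - 1 : ℕ) * t) := by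
  have hsum : ∀ f : Fin m → ℝ, (∀ i ≠ i₀, |f i| ≤ t) →
      |∑ i ∈ Finset.univ.erase i₀, f i| ≤ (m - 1 : ℕ) * t := fun f hf ↦ by
    refine (Finset.abs_sum_le_sum_abs _ _).trans
      ((Finset.sum_le_card_nsmul _ _ t fun i hi ↦ hf i (Finset.ne_of_mem_erase hi)).trans_eq ?_)
    simp
  have h1 := hsum (fun i ↦ |x i - y i|) fun i h ↦ by rw [abs_abs]; exact hi i h
  have h2 := hsum (fun i ↦ |x i| - |y i|) fun i h ↦ (abs_abs_sub_abs_le _ _).trans (hi i h)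
  have e1 : taxicab (x - y) = |x i₀ - y i₀| + ∑ i ∈ Finset.univ.erase i₀, |x i - y i| :=
    (Finset.add_sum_erase _ (fun i ↦ |x i - y i|) (Finset.mem_univ i₀)).symm
  have e2 : taxicab x - taxicab y =
      (|x i₀| - |y i₀|) + ∑ i ∈ Finset.univ.erase i₀, (|x i| - |y i|) := by
    rw [taxicab, taxicab, ← Finset.sum_sub_distrib]
    exact (Finset.add_sum_erase _ (fun i ↦ |x i| - |y i|) (Finset.mem_univ i₀)).symm
  -- With equal signs, the remaining coordinate is recovered from its absolute value, which the `ℓ¹`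
  -- norm and the other coordinates determine.
  have e3 : |x i₀ - y i₀| = |(|x i₀| - |y i₀|)| := by
    by_cases hx : 0 ≤ x i₀
    · rw [abs_of_nonneg hx, abs_of_nonneg (hhalf.1 hx)]
    · have hy : ¬0 ≤ y i₀ := fun h ↦ hx (hhalf.2 h)
      rw [abs_of_neg (not_le.1 hx), abs_of_neg (not_le.1 hy), neg_sub_neg, abs_sub_comm]
  rw [e1, e3]
  rw [e2] at hs
  have h3 : |(|x i₀| - |y i₀|)| ≤ s + (m - 1 : ℕ) * t := by
    rw [abs_le] at hs h2 ⊢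
    constructor <;> linarith
  linarith [le_abs_self (∑ i ∈ Finset.univ.erase i₀, |x i - y i|)]

end Octahedral

/-! ### Asymptotic dimension of the profile metric -/

variable {m : ℕ} {h : ℝ → ℝ}

/-- The difference is `F (bracket x - ‖x‖) / bracket x`, where `F ≤ bracket x` and `bracket x - ‖x‖
≤ 1 / bracket x`. -/
theorem abs_norm_sphereCoord_sub_radius_le (hh : IsProfile h) (x : Euc m) :
    |‖sphereCoord h 0 x‖ - radius h x| ≤ 1 := by
  have hb := bracket_pos x
  have hF := radius_pos h x
  have e : ‖sphereCoord h 0 x‖ - radius h x = -(radius h x * (bracket x - ‖x‖) / bracket x) := by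
    rw [norm_sphereCoord_zero]
    field_simp
    ring
  have h1 := norm_le_bracket x
  have h2 : (bracket x - ‖x‖) * bracket x ≤ 1 := by
    nlinarith [bracket_sq x, norm_nonneg x]
  rw [e, abs_neg, abs_of_nonneg (by have := sub_nonneg.2 h1; positivity), div_le_one hb]
  calc radius h x * (bracket x - ‖x‖) ≤ bracket x * (bracket x - ‖x‖) :=
        mul_le_mul_of_nonneg_right (radius_le_bracket hh x) (sub_nonneg.2 h1)
    _ ≤ 1 := by linarith
    _ ≤ bracket x := one_le_bracket x

/-- As functions of `t`, the radius has derivative `h' e^h`, and the radial coordinate has the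
larger derivative `e^h / 2`. -/
theorem abs_radius_sub_le_abs_radialCoord_sub (hh : IsProfile h) (x y : Euc m) :
    |radius h x - radius h y| ≤ |radialCoord h x - radialCoord h y| := by
  have hexp : ∀ t, HasDerivAt (fun t ↦ Real.exp (h t)) (Real.exp (h t) * deriv h t) t :=
    fun t ↦ (hh.hasDerivAt t).exp
  have hd : ∀ t, HasDerivAt (fun t ↦ radialPrimitive h t - Real.exp (h t))
      (Real.exp (h t) / 2 - Real.exp (h t) * deriv h t) t := fun t ↦
    (hasDerivAt_radialPrimitive hh t).sub (hexp t)
  have hmono : Monotone fun t ↦ radialPrimitive h t - Real.exp (h t) :=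
    monotone_of_deriv_nonneg (fun t ↦ (hd t).differentiableAt) fun t ↦ by
      rw [(hd t).deriv]
      nlinarith [Real.exp_pos (h t), hh.deriv_le t]
  have hle : ∀ s t, s ≤ t → |Real.exp (h s) - Real.exp (h t)| ≤
      |radialPrimitive h s - radialPrimitive h t| := by
    intro s t hst
    have h1 := hmono hst
    dsimp only at h1
    have h2 := Real.exp_le_exp.2 (hh.monotone hst)
    rw [abs_sub_comm, abs_of_nonneg (by linarith), abs_sub_comm, abs_of_nonneg (by linarith)]
    linarith
  rcases le_total (logBracket x) (logBracket y) with hxy | hxy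
  · exact hle _ _ hxy
  · rw [abs_sub_comm, abs_sub_comm (radialCoord h x)]
    exact hle _ _ hxy

/-- The `m` coordinates are the radial one and the octahedral ones other than `i₀`. The `ℓ¹` norm of
`Q x` is within 1 of `F`, hence controlled by the radial coordinate, so the coordinate at `i₀` is
determined up to sign; the sign is the Boolean that splits boxes into two pieces. -/
theorem asdimLEWith_profileMetric (hh : IsProfile h) (hm : 3 ≤ m) :
    AsdimLEWith (RiemannianSpace (profileMetric m hh)) m fun r ↦
      (6 * (4 * (m + 2)) * ((2 + 36 * m ^ 2) * (m + 1)) + 2) * r + 2 * (36 * m + 216) := by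
  have hm0 : 0 < m := by omega
  let i₀ : Fin m := ⟨0, hm0⟩
  let Q : Euc m → Euc m := fun x ↦ toOctahedral (sphereCoord h 0 x)
  have hQ : ∀ x y, ‖Q x - Q y‖ ≤ 4 * (m + 2) * rdist (profileMetric m hh) x y := fun x y ↦ by
    refine (norm_toOctahedral_sub_le _ _).trans ?_
    calc _ ≤ ((m : ℝ) + 2) * (4 * rdist (profileMetric m hh) x y) := by
          gcongr
          exact norm_sphereCoord_sub_le hh 0 x y
      _ = _ := by ring
  refine asdimLEWith_of_coordinates (by positivity)
    (fun i (x : Euc m) ↦ if i = i₀ then radialCoord h x else Q x i) (fun i (x y : Euc m) ↦ ?_)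
    (fun x : Euc m ↦ decide (0 ≤ Q x i₀)) (fun ℓ hℓ (x y : Euc m) hxy hi ↦ ?_)
  · change _ ≤ _ * rdist (profileMetric m hh) x y
    push_cast
    have h0 := rdist_nonneg (profileMetric m hh) x y
    split_ifs
    · refine (abs_radialCoord_sub_le hh x y).trans ?_
      have : (0 : ℝ) ≤ m := by positivity
      nlinarith
    · exact (abs_coord_le_norm (Q x - Q y) i).trans (hQ x y)
  · change rdist (profileMetric m hh) x y ≤ _
    set t : ℝ := (m + 1) * ℓ with ht
    have ht0 : 0 < t := by positivity
    have hrad : |radialCoord h x - radialCoord h y| ≤ t := by simpa using hi i₀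
    have htaxi : |taxicab (Q x) - taxicab (Q y)| ≤ t + 2 := by
      simp only [Q, taxicab_toOctahedral]
      have h1 := abs_norm_sphereCoord_sub_radius_le hh x
      have h2 := abs_norm_sphereCoord_sub_radius_le hh y
      have h3 := (abs_radius_sub_le_abs_radialCoord_sub hh x y).trans hrad
      rw [abs_le] at *
      constructor <;> linarith
    have hsub := taxicab_sub_le (i₀ := i₀) (x := Q x) (y := Q y)
      (fun i hne ↦ by simpa [hne] using hi i) (by simpa using hxy) htaxi
    have hm1 : ((m - 1 : ℕ) : ℝ) = m - 1 := by
      rw [Nat.cast_sub (by omega)]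
      simp
    rw [hm1] at hsub
    have h4 : ‖Q x - Q y‖ ≤ 2 * m * t + 2 := (norm_le_taxicab _).trans (by linarith)
    have h5 : ‖sphereCoord h 0 x - sphereCoord h 0 y‖ ≤ 3 * m * (2 * m * t + 2) :=
      (norm_sub_le_norm_toOctahedral_sub _ _).trans (by gcongr)
    refine (rdist_le hh hm x y).trans ?_
    push_cast
    calc _ ≤ 2 * t + 6 * (3 * m * (2 * m * t + 2)) + 216 := by gcongr
      _ = _ := by rw [ht]; ring

end

section

/-! ### Construction of arbitrarily slow profiles -/

section Staircase

/-- A superposition of stretched copies of `φ`, which start at the points `a k`. -/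
def staircase (a : ℕ → ℝ) (q : ℝ) (φ : ℝ → ℝ) (w : ℝ) : ℝ :=
  ∑ k ∈ Finset.range ⌈w⌉₊, q ^ k * φ ((w - a k) / 2 ^ k)

variable {a : ℕ → ℝ} {q : ℝ} {φ φ' : ℝ → ℝ} {w : ℝ}

/-- The terms with `k ≥ w` vanish because `a k ≥ k`. Hence the number of terms can be fixed locally,
which makes the sum smooth. -/
theorem staircase_eq (ha : ∀ k : ℕ, (k : ℝ) ≤ a k) (hφ : ∀ t ≤ 0, φ t = 0) {N : ℕ} (hN : w ≤ N) :
    staircase a q φ w = ∑ k ∈ Finset.range N, q ^ k * φ ((w - a k) / 2 ^ k) := by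
  refine Finset.sum_subset (Finset.range_subset_range.2 (Nat.ceil_le.2 hN)) fun k _ hk ↦ ?_
  have hk' : w ≤ k := Nat.ceil_le.1 (not_lt.1 fun h ↦ hk (Finset.mem_range.2 h))
  rw [hφ _ (div_nonpos_of_nonpos_of_nonneg (by linarith [ha k]) (by positivity)), mul_zero]

theorem staircase_eventuallyEq (ha : ∀ k : ℕ, (k : ℝ) ≤ a k) (hφ : ∀ t ≤ 0, φ t = 0) {N : ℕ}
    (hN : w < N) :
    staircase a q φ =ᶠ[𝓝 w] fun w ↦ ∑ k ∈ Finset.range N, q ^ k * φ ((w - a k) / 2 ^ k) := by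
  filter_upwards [Iio_mem_nhds hN] with v hv
  exact staircase_eq ha hφ (le_of_lt hv)

theorem contDiff_staircase (ha : ∀ k : ℕ, (k : ℝ) ≤ a k) (hφ : ∀ t ≤ 0, φ t = 0)
    (hc : ContDiff ℝ ∞ φ) : ContDiff ℝ ∞ (staircase a q φ) := by
  rw [contDiff_iff_contDiffAt]
  intro w
  obtain ⟨N, hN⟩ := exists_nat_gt w
  refine ContDiffAt.congr_of_eventuallyEq ?_ (staircase_eventuallyEq ha hφ hN)
  refine (ContDiff.sum fun k _ ↦ ?_).contDiffAt
  exact contDiff_const.mul (hc.comp ((contDiff_id.sub contDiff_const).div_const _))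

/-- The stretching by `2^k` costs a factor `2^{-k}` under differentiation, so derivatives stay in
the same family with `q` halved, and become bounded by a geometric series. -/
theorem hasDerivAt_staircase (ha : ∀ k : ℕ, (k : ℝ) ≤ a k) (hφ : ∀ t ≤ 0, φ t = 0)
    (hφ' : ∀ t ≤ 0, φ' t = 0) (hd : ∀ t, HasDerivAt φ (φ' t) t) (w : ℝ) :
    HasDerivAt (staircase a q φ) (staircase a (q / 2) φ' w) w := by
  obtain ⟨N, hN⟩ := exists_nat_gt w
  refine HasDerivAt.congr_of_eventuallyEq ?_ (staircase_eventuallyEq ha hφ hN)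
  rw [staircase_eq ha hφ' hN.le]
  refine HasDerivAt.fun_sum fun k _ ↦ ?_
  have h1 : HasDerivAt (fun w ↦ (w - a k) / 2 ^ k) (1 / 2 ^ k) w :=
    ((hasDerivAt_id w).sub_const _).div_const _
  refine (((hd _).comp w h1).const_mul (q ^ k)).congr_deriv ?_
  rw [div_pow]
  ring

theorem abs_staircase_le {C : ℝ} (hC : ∀ t, |φ t| ≤ C) (hq : 0 ≤ q) (hq' : q ≤ 1 / 2) (w : ℝ) :
    |staircase a q φ w| ≤ 2 * C := by
  have hC0 : 0 ≤ C := (abs_nonneg _).trans (hC 0)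
  calc |staircase a q φ w| ≤ ∑ k ∈ Finset.range ⌈w⌉₊, |q ^ k * φ ((w - a k) / 2 ^ k)| :=
        Finset.abs_sum_le_sum_abs _ _
    _ ≤ ∑ k ∈ Finset.range ⌈w⌉₊, (1 / 2 : ℝ) ^ k * C := by
        refine Finset.sum_le_sum fun k _ ↦ ?_
        rw [abs_mul, abs_of_nonneg (pow_nonneg hq k)]
        gcongr
        exact hC _
    _ ≤ 2 * C := by
        rw [← Finset.sum_mul]
        gcongr
        exact sum_geometric_two_le _

theorem staircase_nonneg (hφ : ∀ t, 0 ≤ φ t) (hq : 0 ≤ q) (w : ℝ) : 0 ≤ staircase a q φ w :=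
  Finset.sum_nonneg fun _ _ ↦ mul_nonneg (pow_nonneg hq _) (hφ _)

theorem staircase_eq_zero (hw : w ≤ 0) : staircase a q φ w = 0 := by
  rw [staircase, Nat.ceil_eq_zero.2 hw, Finset.range_zero, Finset.sum_empty]

/-- The value of a staircase of unit steps is at most `k + 1`, where `k` is the last step. -/
theorem staircase_eq_zero_or (hφ : ∀ t ≤ 0, φ t = 0) (hφ1 : ∀ t, φ t ≤ 1) (w : ℝ) :
    staircase a 1 φ w = 0 ∨ ∃ k : ℕ, a k < w ∧ staircase a 1 φ w ≤ k + 1 := by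
  classical
  set T := (Finset.range ⌈w⌉₊).filter fun k ↦ a k < w with hT
  have hsum : staircase a 1 φ w = ∑ k ∈ T, φ ((w - a k) / 2 ^ k) := by
    rw [staircase, hT, Finset.sum_filter]
    refine Finset.sum_congr rfl fun k _ ↦ ?_
    split_ifs with hk
    · rw [one_pow, one_mul]
    · rw [hφ _ (div_nonpos_of_nonpos_of_nonneg (by linarith [not_lt.1 hk]) (by positivity)),
        mul_zero]
  rcases T.eq_empty_or_nonempty with h | h
  · left
    rw [hsum, h, Finset.sum_empty]
  · right
    refine ⟨T.max' h, (Finset.mem_filter.1 (T.max'_mem h)).2, ?_⟩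
    have hsub : T ⊆ Finset.range (T.max' h + 1) := fun k hk ↦
      Finset.mem_range.2 (Nat.lt_succ_of_le (T.le_max' k hk))
    have hcard := Finset.card_le_card hsub
    rw [Finset.card_range] at hcard
    rw [hsum]
    calc ∑ k ∈ T, φ ((w - a k) / 2 ^ k) ≤ T.card • (1 : ℝ) :=
          Finset.sum_le_card_nsmul _ _ _ fun k _ ↦ hφ1 _
      _ ≤ T.max' h + 1 := by
          rw [nsmul_eq_mul, mul_one]
          exact_mod_cast hcard

theorem tendsto_staircase (ha : ∀ k : ℕ, (k : ℝ) ≤ a k) (hφ : ∀ t ≤ 0, φ t = 0)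
    (hφ0 : ∀ t, 0 ≤ φ t) (hφ1 : ∀ t, 1 ≤ t → φ t = 1) :
    Tendsto (staircase a 1 φ) atTop atTop := by
  rw [tendsto_atTop]
  intro M
  obtain ⟨N, hN⟩ := exists_nat_ge M
  have hev : ∀ᶠ w : ℝ in atTop, ∀ k ∈ Finset.range N, a k + 2 ^ k ≤ w :=
    (Finset.eventually_all _).2 fun k _ ↦ eventually_ge_atTop _
  filter_upwards [hev] with w hw
  rw [staircase_eq (N := max N ⌈w⌉₊) ha hφ ((Nat.le_ceil w).trans (by simp))]
  calc M ≤ ∑ k ∈ Finset.range N, (1 : ℝ) := by simpa using hN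
    _ = ∑ k ∈ Finset.range N, 1 ^ k * φ ((w - a k) / 2 ^ k) := by
        refine Finset.sum_congr rfl fun k hk ↦ ?_
        rw [hφ1 _ ((one_le_div (by positivity)).2 (by linarith [hw k hk])), one_pow, one_mul]
    _ ≤ _ := Finset.sum_le_sum_of_subset_of_nonneg
        (Finset.range_subset_range.2 (le_max_left _ _)) fun k _ _ ↦
          mul_nonneg (by simp) (hφ0 _)

end Staircase

theorem deriv_eq_zero_of_eq_zero_of_nonpos {φ : ℝ → ℝ} (hd : Differentiable ℝ φ)
    (hφ : ∀ t ≤ 0, φ t = 0) : ∀ t ≤ 0, deriv φ t = 0 := fun t ht ↦ by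
  have h1 := (hd t).hasDerivAt.hasDerivWithinAt (s := Iic t)
  have h2 : HasDerivWithinAt φ 0 (Iic t) t :=
    (hasDerivWithinAt_const t (Iic t) (0 : ℝ)).congr (fun s hs ↦ hφ s (hs.trans ht)) (hφ t ht)
  exact (uniqueDiffWithinAt_Iic t).eq_deriv _ h1 h2

theorem exists_abs_le_of_eq_zero {φ : ℝ → ℝ} (hc : Continuous φ) (h0 : ∀ t ≤ 0, φ t = 0)
    (h1 : ∀ t > 1, φ t = 0) : ∃ C, ∀ t, |φ t| ≤ C := by
  obtain ⟨C, hC⟩ := isCompact_Icc.exists_bound_of_continuousOn (s := Icc (0 : ℝ) 1) hc.continuousOn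
  refine ⟨C, fun t ↦ ?_⟩
  have hC0 : 0 ≤ C := (norm_nonneg _).trans (hC 0 (by simp))
  rcases le_or_gt t 0 with h | h
  · rw [h0 t h, abs_zero]
    exact hC0
  rcases le_or_gt t 1 with h' | h'
  · exact hC t ⟨h.le, h'⟩
  · rw [h1 t h', abs_zero]
    exact hC0

theorem deriv_eq_zero_of_eqOn_Ioi {φ : ℝ → ℝ} {c : ℝ} (h : ∀ t > 1, φ t = c) :
    ∀ t > 1, deriv φ t = 0 := fun t ht ↦ by
  have : φ =ᶠ[𝓝 t] fun _ ↦ c := by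
    filter_upwards [Ioi_mem_nhds ht] with s hs
    exact h s hs
  rw [this.deriv_eq, deriv_const]

/-- A profile which grows as slowly as a given control function requires. -/
theorem exists_isProfile {G : ℝ≥0 → ℝ≥0} (hG : IsControlFunction G) :
    ∃ h, IsProfile h ∧ ∀ r : ℝ≥0, Real.exp (4 * h (3 * r)) ≤ max 1 (G r : ℝ) := by
  set S := Real.smoothTransition with hS
  have hSc : ContDiff ℝ ∞ S := Real.smoothTransition.contDiff
  have hS'c : ContDiff ℝ ∞ (deriv S) := hSc.iterate_deriv 1
  have hS''c : ContDiff ℝ ∞ (deriv (deriv S)) := hSc.iterate_deriv 2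
  have hSd := hSc.differentiable (by simp)
  have hS'd := hS'c.differentiable (by simp)
  have hS0 : ∀ t ≤ 0, S t = 0 := fun t ht ↦ Real.smoothTransition.zero_of_nonpos ht
  have hS'0 := deriv_eq_zero_of_eq_zero_of_nonpos hSd hS0
  have hS''0 := deriv_eq_zero_of_eq_zero_of_nonpos hS'd hS'0
  have hS1 : ∀ t, 1 ≤ t → S t = 1 := fun t ht ↦ Real.smoothTransition.one_of_one_le ht
  have hS'1 := deriv_eq_zero_of_eqOn_Ioi fun t (ht : t > 1) ↦ hS1 t ht.le
  have hS''1 := deriv_eq_zero_of_eqOn_Ioi hS'1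
  obtain ⟨C₁, hC₁⟩ := exists_abs_le_of_eq_zero hS'c.continuous hS'0 hS'1
  obtain ⟨C₂, hC₂⟩ := exists_abs_le_of_eq_zero hS''c.continuous hS''0 hS''1
  have hC₁0 : 0 ≤ C₁ := (abs_nonneg _).trans (hC₁ 0)
  have hC₂0 : 0 ≤ C₂ := (abs_nonneg _).trans (hC₂ 0)
  -- The staircase derivatives are bounded by `2C₁` and `2C₂`; this `δ` brings both below `1/32`.
  set δ : ℝ := 1 / (64 * (C₁ + C₂ + 1)) with hδ
  have hδ0 : 0 < δ := by positivity
  have hδC : ∀ x ≤ 2 * (C₁ + C₂), δ * x ≤ 1 / 32 := fun x hx ↦ by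
    rw [hδ, div_mul_eq_mul_div, div_le_div_iff₀ (by positivity) (by norm_num)]
    linarith
  -- Step `k` may start only once `G` affords the height `δ(k + 1)` that `h` can then reach. The
  -- starting points are tripled below because the bound concerns `h (3r)`.
  have hex : ∀ k : ℕ, ∃ r : ℝ≥0, (k : ℝ≥0) ≤ r ∧ Real.exp (4 * (δ * (k + 1))) ≤ G r := fun k ↦ by
    obtain ⟨r, hr1, hr2⟩ := ((eventually_ge_atTop (k : ℝ≥0)).and
      (hG.2.eventually_ge_atTop (Real.exp (4 * (δ * (k + 1)))).toNNReal)).exists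
    exact ⟨r, hr1, Real.toNNReal_le_iff_le_coe.1 hr2⟩
  choose ρ hρ hρG using hex
  set a : ℕ → ℝ := fun k ↦ 3 * ρ k with ha
  have hak : ∀ k : ℕ, (k : ℝ) ≤ a k := fun k ↦ by
    have : (k : ℝ) ≤ ρ k := by exact_mod_cast hρ k
    rw [ha]
    linarith [(ρ k).2]
  have hd1 : ∀ w, HasDerivAt (fun w ↦ δ * staircase a 1 S w)
      (δ * staircase a (1 / 2) (deriv S) w) w := fun w ↦
    (hasDerivAt_staircase hak hS0 hS'0 (fun t ↦ (hSd t).hasDerivAt) w).const_mul δ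
  have hd1' : deriv (fun w ↦ δ * staircase a 1 S w) =
      fun w ↦ δ * staircase a (1 / 2) (deriv S) w := funext fun w ↦ (hd1 w).deriv
  have hd2 : ∀ w, HasDerivAt (fun w ↦ δ * staircase a (1 / 2) (deriv S) w)
      (δ * staircase a (1 / 2 / 2) (deriv (deriv S)) w) w := fun w ↦
    (hasDerivAt_staircase hak hS'0 hS''0 (fun t ↦ (hS'd t).hasDerivAt) w).const_mul δ
  have hSmono : ∀ t, 0 ≤ deriv S t := fun t ↦ Real.smoothTransition.monotone.deriv_nonneg
  refine ⟨fun w ↦ δ * staircase a 1 S w, ⟨?_, ?_, ?_, ?_, ?_, ?_⟩, ?_⟩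
  · exact contDiff_const.mul (contDiff_staircase hak hS0 hSc)
  · intro t ht
    simp only [staircase_eq_zero ht, mul_zero]
  · intro t
    rw [hd1']
    exact mul_nonneg hδ0.le (staircase_nonneg hSmono (by norm_num) t)
  · intro t
    rw [hd1']
    refine hδC _ ((le_abs_self _).trans ((abs_staircase_le hC₁ (by norm_num) le_rfl t).trans ?_))
    linarith
  · intro t
    rw [hd1', (hd2 t).deriv, abs_mul, abs_of_pos hδ0]
    refine hδC _ ((abs_staircase_le hC₂ (by norm_num) (by norm_num) t).trans ?_)
    linarith
  · exact (tendsto_staircase hak hS0 Real.smoothTransition.nonneg hS1).const_mul_atTop hδ0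
  · intro r
    dsimp only
    rcases staircase_eq_zero_or (a := a) hS0 Real.smoothTransition.le_one (3 * r) with h | ⟨k, hk, h⟩
    · rw [h]
      simp
    · have hkr : ρ k ≤ r := by
        rw [← NNReal.coe_le_coe]
        rw [ha] at hk
        linarith
      refine le_max_of_le_right (le_trans ?_ ((hρG k).trans (NNReal.coe_le_coe.2 (hG.1 hkr))))
      gcongr

end

end ScalarDecay

end

theorem proposition5p11 (m : ℕ) (hm : 3 ≤ m) :
    ∃ a b : ℝ≥0, ∀ G : ℝ≥0 → ℝ≥0, ScalarDecay.IsControlFunction G →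
      ∃ g : ScalarDecay.SmoothMetric m,
        CompleteSpace (ScalarDecay.RiemannianSpace g) ∧
        ScalarDecay.HasBoundedGeometry g ∧
        ScalarDecay.UniformlyContractible (ScalarDecay.RiemannianSpace g) ∧
        ScalarDecay.AsdimLEWith (ScalarDecay.RiemannianSpace g) m (fun r ↦ a * r + b) ∧
        (∀ x : ScalarDecay.RiemannianSpace g, 0 < ScalarDecay.scalarCurvature g x) ∧
        ∀ x₀ : ScalarDecay.RiemannianSpace g,
          Tendsto (fun r : ℝ≥0 ↦ (G r : ℝ) *
            ⨅ x : Metric.closedBall x₀ (r : ℝ), ScalarDecay.scalarCurvature g x.1) atTop atTop := by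
  refine ⟨6 * (4 * (m + 2)) * ((2 + 36 * m ^ 2) * (m + 1)) + 2, 2 * (36 * m + 216),
    fun G hG ↦ ?_⟩
  obtain ⟨h, hh, hhG⟩ := ScalarDecay.exists_isProfile hG
  exact ⟨ScalarDecay.profileMetric m hh, ScalarDecay.completeSpace_profileMetric hh,
    ScalarDecay.hasBoundedGeometry_profileMetric hh,
    ScalarDecay.uniformlyContractible_profileMetric hh,
    ScalarDecay.asdimLEWith_profileMetric hh hm,
    fun x ↦ (Real.exp_pos _).trans_le (ScalarDecay.exp_neg_le_scalarCurvature hh hm x),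
    fun x₀ ↦ ScalarDecay.tendsto_mul_iInf_scalarCurvature hh hm hG.2 hhG x₀⟩
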